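/- A *cluster graph* is a graph without an induced path on three vertices, i.e. a disjoint union of cliques (its *clusters*). For cluster graphs $G_1=(V,E_1)$, $G_2=(V,E_2)$ the *edge-based distance* is $d_E(G_1,G_2)=|E_1\oplus E_2|$ (symmetric difference). The *matching-based distance* is $d_M(G_1,G_2)=|V|-W$, where $W$ is the weight of a maximum-weight matching in the complete bipartite graph whose two sides are the clusters of $G_1$ and the clusters of $G_2$, the edge between clusters $C$ and $D$ having weight $|C\cap D|$. An instance consists of a graph $G$ and a cluster graph $G_c$ on the same set of $n$ vertices, a budget $k\in\mathbb{N}$ and a distance bound $d\in\mathbb{N}$. The question is whether there is a cluster graph $G'$ on the same vertex set with $|E(G)\oplus E(G')|\le k$ and $\mathrm{dist}(G',G_c)\le d$ such that, in the *Deletion* variant, $E(G')\subseteq E(G)$ and, in the *Completion* variant, $E(G)\subseteq E(G')$. Here $\mathrm{dist}$ is $d_E$ (*Edge Dist*) or $d_M$ (*Matching Dist*). Running times are counted on a word RAM with words of $O(\log(n+k+d+2))$ bits and with both graphs given as adjacency matrices. A problem is in FPT with respect to a parameter $r$ if some algorithm decides every instance $I$ in at most $f(r)\cdot|I|^{c}$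 steps, for some computable function $f$ and some constant $c$, where $|I|$ is the binary encoding length. **Theorem.** 1. *Dynamic Cluster Deletion (Edge Dist)* is in FPT when parameterized by $k$, and it can be solved in $O(4^{k^2}\cdot \max\{n,1\}^3)$ time. 2. *Dynamic Cluster Completion (Matching Dist)* is in FPT when parameterized by $d$, and it can be solved in $O(\max\{d,1\}^{d+2}\cdot \max\{n,1\}^3)$ time. 3. *Dynamic Cluster Completion (Edge Dist)* is in FPT when parameterized by $d$, and it can be solved in $O(\max\{d,1\}^{d+1}\cdot \max\{n,1\}^3)$ time. The constants hidden in the $O$-notation are absolute, i.e. independent of the instance. -/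

import Mathlib

namespace DynCluster

/-! ### Cluster graphs and their distances -/

/-- A cluster graph: no three vertices `u, v, w` induce a path `u - v - w`. -/
def IsClusterGraph {V : Type*} (G : SimpleGraph V) : Prop :=
  ∀ u v w : V, ¬ (G.Adj u v ∧ G.Adj v w ∧ u ≠ w ∧ ¬ G.Adj u w)

/-- Number of vertices shared by a cluster of `G₁` and a cluster of `G₂`. The clusters of a
cluster graph are its connected components. -/
noncomputable def overlap {V : Type*} {G₁ G₂ : SimpleGraph V}
    (e : G₁.ConnectedComponent × G₂.ConnectedComponent) : ℕ :=
  (e.1.supp ∩ e.2.supp).ncard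

/-- A matching of the complete bipartite graph with sides `α` and `β`: a set of edges (pairs), no
two of which share an endpoint. -/
def IsPairMatching {α β : Type*} (M : Finset (α × β)) : Prop :=
  ∀ e ∈ M, ∀ f ∈ M, (e.1 = f.1 ∨ e.2 = f.2) → e = f

/-- The weight of a maximum-weight matching between the clusters of `G₁` and of `G₂`
(on a finite vertex set the supremum is over a finite nonempty set). -/
noncomputable def maxMatchingWeight {V : Type*} (G₁ G₂ : SimpleGraph V) : ℕ :=
  ⨆ M : {M : Finset (G₁.ConnectedComponent × G₂.ConnectedComponent) // IsPairMatching M},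
    ∑ e ∈ M.1, overlap e

/-- The matching-based distance `|V| - W`; the subtraction never truncates since `W ≤ |V|`. -/
noncomputable def matchingDist {V : Type*} (G₁ G₂ : SimpleGraph V) : ℕ :=
  Nat.card V - maxMatchingWeight G₁ G₂

/-- `|E(G₁) ⊕ E(G₂)|`; for two cluster graphs this is the edge-based distance. -/
noncomputable def edgeDist {V : Type*} (G₁ G₂ : SimpleGraph V) : ℕ :=
  (symmDiff G₁.edgeSet G₂.edgeSet).ncard

/-! ### Problems -/

/-- An instance of the dynamic cluster problems: a graph `G` and a cluster graph `Gc` on the same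
`n` vertices, a budget `k` and a distance bound `d`. -/
structure Instance where
  n : ℕ
  G : SimpleGraph (Fin n)
  Gc : SimpleGraph (Fin n)
  isCluster_Gc : IsClusterGraph Gc
  k : ℕ
  d : ℕ

/-- The length of an instance written down as two `n × n` bit matrices and the three numbers
`n`, `k`, `d` in binary, each followed by a separator. -/
def Instance.size (I : Instance) : ℕ :=
  2 * I.n ^ 2 + (Nat.size I.n + 1) + (Nat.size I.k + 1) + (Nat.size I.d + 1)

/-- Yes-instances of Dynamic Cluster Deletion with edge-based distance. -/
def DeletionEdge (I : Instance) : Prop :=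
  ∃ G' : SimpleGraph (Fin I.n), IsClusterGraph G' ∧ G'.edgeSet ⊆ I.G.edgeSet ∧
    edgeDist I.G G' ≤ I.k ∧ edgeDist G' I.Gc ≤ I.d

/-- Yes-instances of Dynamic Cluster Completion with matching-based distance. -/
def CompletionMatching (I : Instance) : Prop :=
  ∃ G' : SimpleGraph (Fin I.n), IsClusterGraph G' ∧ I.G.edgeSet ⊆ G'.edgeSet ∧
    edgeDist I.G G' ≤ I.k ∧ matchingDist G' I.Gc ≤ I.d

/-- Yes-instances of Dynamic Cluster Completion with edge-based distance. -/
def CompletionEdge (I : Instance) : Prop :=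
  ∃ G' : SimpleGraph (Fin I.n), IsClusterGraph G' ∧ I.G.edgeSet ⊆ G'.edgeSet ∧
    edgeDist I.G G' ≤ I.k ∧ edgeDist G' I.Gc ≤ I.d

/-! ### The machine model: programs for a word RAM -/

/-- Machine arithmetic and comparisons (a comparison returns `1` for true and `0` for false). -/
inductive BinOp where
  | add | sub | mul | div | mod | lt | eq

def BinOp.eval : BinOp → ℕ → ℕ → ℕ
  | add, a, b => a + b
  | sub, a, b => a - b
  | mul, a, b => a * b
  | div, a, b => a / b
  | mod, a, b => a % b
  | lt, a, b => if a < b then 1 else 0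
  | eq, a, b => if a = b then 1 else 0

/-- The memory: registers `reg x`, and arrays with cells `arr a i`. A program mentions only
finitely many registers `x` and arrays `a`; cells are addressed indirectly. -/
structure Store where
  reg : ℕ → ℕ
  arr : ℕ → ℕ → ℕ

def Store.setReg (s : Store) (x v : ℕ) : Store :=
  { s with reg := Function.update s.reg x v }

def Store.setArr (s : Store) (a i v : ℕ) : Store :=
  { s with arr := Function.update s.arr a (Function.update (s.arr a) i v) }

inductive Expr where
  | lit (c : ℕ)
  | reg (x : ℕ)
  | read (a : ℕ) (i : Expr)
  | op (o : BinOp) (e₁ e₂ : Expr)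

def Expr.eval (s : Store) : Expr → ℕ
  | lit c => c
  | reg x => s.reg x
  | read a i => s.arr a (i.eval s)
  | op o e₁ e₂ => o.eval (e₁.eval s) (e₂.eval s)

/-- Number of elementary steps in the evaluation of an expression: one for each node. -/
def Expr.cost : Expr → ℕ
  | lit _ => 1
  | reg _ => 1
  | read _ i => i.cost + 1
  | op _ e₁ e₂ => e₁.cost + e₂.cost + 1

inductive Prog where
  | nop
  | assign (x : ℕ) (e : Expr)
  | write (a : ℕ) (i e : Expr)
  | seq (p q : Prog)
  | ite (e : Expr) (p q : Prog)
  | loop (e : Expr) (p : Prog)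

/-- `Run B p s s' t`: on a machine whose words hold the numbers `0, …, B`, the program `p` started
in memory `s` halts in memory `s'` after exactly `t` steps. There is no rule for storing a number
above `B` or at an address above `B`, so a program that tries this has no run. (Expressions have
fixed size, so their intermediate values fit in a fixed number of words.) -/
inductive Run (B : ℕ) : Prog → Store → Store → ℕ → Prop
  | nop (s : Store) : Run B .nop s s 1
  | assign (s : Store) (x : ℕ) (e : Expr) (he : e.eval s ≤ B) :
      Run B (.assign x e) s (s.setReg x (e.eval s)) (e.cost + 1)
  | write (s : Store) (a : ℕ) (i e : Expr) (hi : i.eval s ≤ B) (he : e.eval s ≤ B) :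
      Run B (.write a i e) s (s.setArr a (i.eval s) (e.eval s)) (i.cost + e.cost + 1)
  | seq {p q : Prog} {s s₁ s₂ : Store} {t₁ t₂ : ℕ} (hp : Run B p s s₁ t₁) (hq : Run B q s₁ s₂ t₂) :
      Run B (.seq p q) s s₂ (t₁ + t₂)
  | iteTrue {e : Expr} {p q : Prog} {s s₁ : Store} {t : ℕ} (he : e.eval s ≠ 0)
      (hp : Run B p s s₁ t) : Run B (.ite e p q) s s₁ (e.cost + 1 + t)
  | iteFalse {e : Expr} {p q : Prog} {s s₁ : Store} {t : ℕ} (he : e.eval s = 0)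
      (hq : Run B q s s₁ t) : Run B (.ite e p q) s s₁ (e.cost + 1 + t)
  | loopDone {e : Expr} {p : Prog} {s : Store} (he : e.eval s = 0) :
      Run B (.loop e p) s s (e.cost + 1)
  | loopStep {e : Expr} {p : Prog} {s s₁ s₂ : Store} {t₁ t₂ : ℕ} (he : e.eval s ≠ 0)
      (hp : Run B p s s₁ t₁) (hl : Run B (.loop e p) s₁ s₂ t₂) :
      Run B (.loop e p) s s₂ (e.cost + 1 + t₁ + t₂)

/-- The machine is deterministic. -/
theorem Run.deterministic {B : ℕ} {p : Prog} {s s₁ s₂ : Store} {t₁ t₂ : ℕ}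
    (h₁ : Run B p s s₁ t₁) (h₂ : Run B p s s₂ t₂) : s₁ = s₂ ∧ t₁ = t₂ := by
  induction h₁ generalizing s₂ t₂ with
  | nop | assign | write => cases h₂; exact ⟨rfl, rfl⟩
  | seq _ _ ihp ihq =>
    cases h₂ with
    | seq hp hq =>
      obtain ⟨rfl, rfl⟩ := ihp hp
      obtain ⟨rfl, rfl⟩ := ihq hq
      exact ⟨rfl, rfl⟩
  | iteTrue he _ ih =>
    cases h₂ with
    | iteTrue _ hp => obtain ⟨rfl, rfl⟩ := ih hp; exact ⟨rfl, rfl⟩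
    | iteFalse he' _ => exact absurd he' he
  | iteFalse he _ ih =>
    cases h₂ with
    | iteTrue he' _ => exact absurd he he'
    | iteFalse _ hp => obtain ⟨rfl, rfl⟩ := ih hp; exact ⟨rfl, rfl⟩
  | loopDone he =>
    cases h₂ with
    | loopDone _ => exact ⟨rfl, rfl⟩
    | loopStep he' _ _ => exact absurd he he'
  | loopStep he _ _ ihp ihl =>
    cases h₂ with
    | loopDone he' => exact absurd he' he
    | loopStep _ hp hl =>
      obtain ⟨rfl, rfl⟩ := ihp hp
      obtain ⟨rfl, rfl⟩ := ihl hl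
      exact ⟨rfl, rfl⟩

open Classical in
/-- The adjacency matrix as an array, row by row: cell `u * n + v` is `1` if `u`, `v` are adjacent;
all other cells are `0`. -/
noncomputable def adjArray {n : ℕ} (G : SimpleGraph (Fin n)) (i : ℕ) : ℕ :=
  if ∃ u v : Fin n, G.Adj u v ∧ i = u * n + v then 1 else 0

/-- The memory at the start: `n`, `k`, `d` in registers `0`, `1`, `2`, the adjacency matrices of
`G` and `Gc` in arrays `0` and `1`, and `0` everywhere else. -/
noncomputable def Instance.init (I : Instance) : Store where
  reg x := if x = 0 then I.n else if x = 1 then I.k else if x = 2 then I.d else 0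
  arr a i := if a = 0 then adjArray I.G i else if a = 1 then adjArray I.Gc i else 0

/-- The program `p` decides the problem `L` within `T I` steps on every instance `I`, with words of
`O(log (n + k + d + 2))` bits. The answer is returned in register `0` (nonzero means yes). -/
def DecidesInTime (p : Prog) (L : Instance → Prop) (T : Instance → ℕ) : Prop :=
  ∃ c : ℕ, ∀ I : Instance, ∃ (s : Store) (t : ℕ),
    Run ((I.n + I.k + I.d + 2) ^ c) p I.init s t ∧ t ≤ T I ∧ (s.reg 0 ≠ 0 ↔ L I)

/-- Fixed-parameter tractability of the problem `L` with respect to the parameter `param`. -/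
def IsFPT (L : Instance → Prop) (param : Instance → ℕ) : Prop :=
  ∃ (p : Prog) (f : ℕ → ℕ) (c : ℕ), Computable f ∧
    DecidesInTime p L (fun I => f (param I) * I.size ^ c)

end DynCluster

namespace DynCluster

section

/-! ### Stores and expressions -/

/-! Cluster graphs on `n` vertices are equivalence relations on `{0, …, n - 1}`; the mathematics is
done with relations on `ℕ`, and a small calculus `Tri` of total correctness with time bounds
connects it with word RAM programs.

Both edge-distance problems are instances of one problem: given a graph `E` and, for each pair of
vertices, a weight for keeping it together and one for cutting it, find a cluster graph `S` that
differs from `E` on at most `K` pairs and has weight at most a threshold. For Deletion, `E = G`, `K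
= k`, and the weight is the distance to `Gc`, where joining a non-edge of `G` is made prohibitively
expensive. For Completion, the roles are exchanged: `E = G ∪ Gc`, `K` is `d` minus the unavoidable
`|G \ Gc|`, and the weight is the number of edges, where cutting an edge of `G` is prohibitive.

The common problem is solved by branching and splitting. While an induced path `u - v - w` is
present, `S` disagrees with the current graph on one of its three pairs; flipping that pair brings
the graph closer to `S`. After some `L ≤ K` flips a cluster graph `H` is reached
(`exists_resolveSeq`), and `S` may be replaced by its intersection with `H`, because cutting is no
dearer than keeping outside `E` (`exists_cluster_iff`). It remains to split clusters of `H` while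
cutting at most `R = K - L` pairs. A cluster that is really split has at most `R + 1` vertices
(`rankIn_le_of_split`), so that `(R + 1) ^ R` strings describe all its splittings (`exists_code`);
clusters are independent and their tables "number of cut pairs ↦ least weight" are combined by
min-plus convolution (`exists_split_iff`, `Tri.leafProg`). The sum of `3 ^ L * (K - L + 1) ^ (K - L
+ 1)` over `L` is `O(max K 1 ^ (K + 1))`, which for Deletion is at most `4 ^ (k ^ 2)` up to a
constant.

For Completion with the matching distance, a solution merges connected components of `G`. Each
component is put into the group of a cluster of `Gc` or stays separate (group `0`); the distance
becomes the number of vertices outside the group of their own cluster, and the budget bounds the sum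
of the squared cluster sizes (`completionMatching_iff`). A component only needs to go to the group
of one of its own vertices (`exists_normal`). At most `d` components meet several clusters of `Gc`,
and for each of them one of `d + 2` digits suffices: separate, or the group of one of its first `d +
1` vertices (`exists_digits`). The other, pure, components stay in their natural group, except for
some of total size at most `d` that are made separate; which ones is settled by a knapsack program,
within each group and then across the groups (`Tri.removeProg`). The `(d + 2) ^ d` strings and the
tables of length at most `d + 1` give `(d + 2) ^ (d + 2)`, which is `O(max d 1 ^ (d + 2))`. -/

@[simp] theorem Store.setReg_reg (s : Store) (x v y : ℕ) :
    (s.setReg x v).reg y = if y = x then v else s.reg y := by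
  simp [Store.setReg, Function.update_apply]

@[simp] theorem Store.setReg_arr (s : Store) (x v a : ℕ) : (s.setReg x v).arr a = s.arr a := rfl

@[simp] theorem Store.setArr_reg (s : Store) (a i v x : ℕ) : (s.setArr a i v).reg x = s.reg x := rfl

@[simp] theorem Store.setArr_arr (s : Store) (a i v b : ℕ) :
    (s.setArr a i v).arr b = if b = a then Function.update (s.arr a) i v else s.arr b := by
  simp [Store.setArr, Function.update_apply]

instance : Add Expr := ⟨.op .add⟩
instance : Sub Expr := ⟨.op .sub⟩
instance : Mul Expr := ⟨.op .mul⟩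
instance : Div Expr := ⟨.op .div⟩
instance : Mod Expr := ⟨.op .mod⟩
instance (c : ℕ) : OfNat Expr c := ⟨.lit c⟩

namespace Expr

abbrev less (e f : Expr) : Expr := .op .lt e f
abbrev equal (e f : Expr) : Expr := .op .eq e f

variable (s : Store) (e f : Expr)

@[simp] theorem eval_zero : (0 : Expr).eval s = 0 := rfl
@[simp] theorem eval_one : (1 : Expr).eval s = 1 := rfl
@[simp] theorem eval_two : (2 : Expr).eval s = 2 := rfl
@[simp] theorem eval_reg (x : ℕ) : (reg x).eval s = s.reg x := rfl
@[simp] theorem eval_read (a : ℕ) : (read a e).eval s = s.arr a (e.eval s) := rfl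
@[simp] theorem eval_add : (e + f).eval s = e.eval s + f.eval s := rfl
@[simp] theorem eval_sub : (e - f).eval s = e.eval s - f.eval s := rfl
@[simp] theorem eval_mul : (e * f).eval s = e.eval s * f.eval s := rfl
@[simp] theorem eval_div : (e / f).eval s = e.eval s / f.eval s := rfl
@[simp] theorem eval_mod : (e % f).eval s = e.eval s % f.eval s := rfl
@[simp] theorem eval_less : (less e f).eval s = if e.eval s < f.eval s then 1 else 0 := rfl
@[simp] theorem eval_equal : (equal e f).eval s = if e.eval s = f.eval s then 1 else 0 := rfl

@[simp] theorem cost_zero : (0 : Expr).cost = 1 := rfl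
@[simp] theorem cost_one : (1 : Expr).cost = 1 := rfl
@[simp] theorem cost_two : (2 : Expr).cost = 1 := rfl
@[simp] theorem cost_reg (x : ℕ) : (reg x).cost = 1 := rfl
@[simp] theorem cost_read (a : ℕ) : (read a e).cost = e.cost + 1 := rfl
@[simp] theorem cost_add : (e + f).cost = e.cost + f.cost + 1 := rfl
@[simp] theorem cost_sub : (e - f).cost = e.cost + f.cost + 1 := rfl
@[simp] theorem cost_mul : (e * f).cost = e.cost + f.cost + 1 := rfl
@[simp] theorem cost_div : (e / f).cost = e.cost + f.cost + 1 := rfl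
@[simp] theorem cost_mod : (e % f).cost = e.cost + f.cost + 1 := rfl
@[simp] theorem cost_less : (less e f).cost = e.cost + f.cost + 1 := rfl
@[simp] theorem cost_equal : (equal e f).cost = e.cost + f.cost + 1 := rfl

end Expr

/-! ### Straight-line programs -/

namespace Prog

/-- `p` may write register `x`. -/
def writesReg : Prog → ℕ → Bool
  | nop, _ => false
  | assign y _, x => x == y
  | write _ _ _, _ => false
  | seq p q, x => p.writesReg x || q.writesReg x
  | ite _ p q, x => p.writesReg x || q.writesReg x
  | loop _ p, x => p.writesReg x

/-- `p` may write array `a`. -/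
def writesArr : Prog → ℕ → Bool
  | nop, _ => false
  | assign _ _, _ => false
  | write b _ _, a => a == b
  | seq p q, a => p.writesArr a || q.writesArr a
  | ite _ p q, a => p.writesArr a || q.writesArr a
  | loop _ p, a => p.writesArr a

/-- The effect of a loop-free program. -/
def exec : Prog → Store → Store
  | nop, s => s
  | assign x e, s => s.setReg x (e.eval s)
  | write a i e, s => s.setArr a (i.eval s) (e.eval s)
  | seq p q, s => q.exec (p.exec s)
  | ite e p q, s => if e.eval s ≠ 0 then p.exec s else q.exec s
  | loop _ _, s => s

/-- The loop-free program `p` runs from `s` with words up to `B`. -/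
def Ok (B : ℕ) : Prog → Store → Prop
  | nop, _ => True
  | assign _ e, s => e.eval s ≤ B
  | write _ i e, s => i.eval s ≤ B ∧ e.eval s ≤ B
  | seq p q, s => p.Ok B s ∧ q.Ok B (p.exec s)
  | ite e p q, s => if e.eval s ≠ 0 then p.Ok B s else q.Ok B s
  | loop _ _, _ => False

/-- A bound on the running time of a loop-free program. -/
def maxCost : Prog → ℕ
  | nop => 1
  | assign _ e => e.cost + 1
  | write _ i e => i.cost + e.cost + 1
  | seq p q => p.maxCost + q.maxCost
  | ite e p q => e.cost + 1 + p.maxCost + q.maxCost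
  | loop _ _ => 0

/-- A conditional without alternative. -/
abbrev when (e : Expr) (p : Prog) : Prog := .ite e p .nop

end Prog

/-! ### Total correctness with time bounds -/

/-- `s'` agrees with `s` on everything that `p` does not write. -/
structure Agree (p : Prog) (s s' : Store) : Prop where
  reg : ∀ x, p.writesReg x = false → s'.reg x = s.reg x
  arr : ∀ a, p.writesArr a = false → s'.arr a = s.arr a

/-- The frame rule. Since `writesReg` and `writesArr` compute, a register or array is carried
unchanged through a whole program by `rfl` or `decide`; postconditions therefore only mention what a
program produces. -/
theorem Run.agree {B : ℕ} {p : Prog} {s s' : Store} {t : ℕ} (h : Run B p s s' t) :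
    Agree p s s' := by
  induction h with
  | nop s => exact ⟨fun _ _ => rfl, fun _ _ => rfl⟩
  | assign s x e he =>
    refine ⟨fun y hy => ?_, fun _ _ => rfl⟩
    have : y ≠ x := by simpa [Prog.writesReg] using hy
    simp [this]
  | write s a i e hi he =>
    refine ⟨fun _ _ => rfl, fun b hb => ?_⟩
    have : b ≠ a := by simpa [Prog.writesArr] using hb
    simp [this]
  | seq hp hq ihp ihq =>
    refine ⟨fun y hy => ?_, fun b hb => ?_⟩
    · simp only [Prog.writesReg, Bool.or_eq_false_iff] at hy
      rw [ihq.reg y hy.2, ihp.reg y hy.1]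
    · simp only [Prog.writesArr, Bool.or_eq_false_iff] at hb
      rw [ihq.arr b hb.2, ihp.arr b hb.1]
  | iteTrue he hp ih =>
    refine ⟨fun y hy => ?_, fun b hb => ?_⟩
    · simp only [Prog.writesReg, Bool.or_eq_false_iff] at hy
      exact ih.reg y hy.1
    · simp only [Prog.writesArr, Bool.or_eq_false_iff] at hb
      exact ih.arr b hb.1
  | iteFalse he hp ih =>
    refine ⟨fun y hy => ?_, fun b hb => ?_⟩
    · simp only [Prog.writesReg, Bool.or_eq_false_iff] at hy
      exact ih.reg y hy.2
    · simp only [Prog.writesArr, Bool.or_eq_false_iff] at hb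
      exact ih.arr b hb.2
  | loopDone he => exact ⟨fun _ _ => rfl, fun _ _ => rfl⟩
  | loopStep he hp hl ihp ihl =>
    refine ⟨fun y hy => ?_, fun b hb => ?_⟩
    · rw [ihl.reg y hy, ihp.reg y hy]
    · rw [ihl.arr b hb, ihp.arr b hb]

theorem Agree.trans {p : Prog} {s s' s'' : Store} (h : Agree p s s') (h' : Agree p s' s'') :
    Agree p s s'' :=
  ⟨fun x hx => (h'.reg x hx).trans (h.reg x hx), fun a ha => (h'.arr a ha).trans (h.arr a ha)⟩

theorem Agree.mono {p q : Prog} {s s' : Store} (h : Agree p s s')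
    (hr : ∀ x, q.writesReg x = false → p.writesReg x = false)
    (ha : ∀ x, q.writesArr x = false → p.writesArr x = false) : Agree q s s' :=
  ⟨fun x hx => h.reg x (hr x hx), fun a hx => h.arr a (ha a hx)⟩

/-- From `s`, the program `p` halts within `T` steps in a store satisfying `Q`. -/
def Tri (B : ℕ) (p : Prog) (s : Store) (T : ℕ) (Q : Store → Prop) : Prop :=
  ∃ s' t, Run B p s s' t ∧ t ≤ T ∧ Q s'

namespace Tri

variable {B : ℕ} {p q : Prog} {s : Store} {T T₁ T₂ : ℕ} {Q Q' : Store → Prop}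

theorem mono (h : Tri B p s T₁ Q) (hT : T₁ ≤ T) (hQ : ∀ s', Agree p s s' → Q s' → Q' s') :
    Tri B p s T Q' := by
  obtain ⟨s', t, hr, ht, hq⟩ := h
  exact ⟨s', t, hr, ht.trans hT, hQ s' hr.agree hq⟩

/-- The second program is verified inside the postcondition of the first, where the frame
information `Agree` is also at hand. -/
theorem seq (h : Tri B p s T₁ fun s₁ => Agree p s s₁ → Tri B q s₁ T₂ Q) :
    Tri B (p.seq q) s (T₁ + T₂) Q := by
  obtain ⟨s₁, t₁, hr₁, ht₁, h⟩ := h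
  obtain ⟨s₂, t₂, hr₂, ht₂, hq⟩ := h hr₁.agree
  exact ⟨s₂, t₁ + t₂, hr₁.seq hr₂, by omega, hq⟩

theorem nop (h : Q s) : Tri B .nop s 1 Q := ⟨s, 1, .nop s, le_rfl, h⟩

theorem assign {x : ℕ} {e : Expr} (he : e.eval s ≤ B) (h : Q (s.setReg x (e.eval s))) :
    Tri B (.assign x e) s (e.cost + 1) Q := ⟨_, _, .assign s x e he, le_rfl, h⟩

theorem write {a : ℕ} {i e : Expr} (hi : i.eval s ≤ B) (he : e.eval s ≤ B)
    (h : Q (s.setArr a (i.eval s) (e.eval s))) :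
    Tri B (.write a i e) s (i.cost + e.cost + 1) Q := ⟨_, _, .write s a i e hi he, le_rfl, h⟩

theorem ite {e : Expr} (hp : e.eval s ≠ 0 → Tri B p s T Q) (hq : e.eval s = 0 → Tri B q s T Q) :
    Tri B (.ite e p q) s (e.cost + 1 + T) Q := by
  by_cases h : e.eval s = 0
  · obtain ⟨s', t, hr, ht, hQ⟩ := hq h
    exact ⟨s', _, .iteFalse h hr, by omega, hQ⟩
  · obtain ⟨s', t, hr, ht, hQ⟩ := hp h
    exact ⟨s', _, .iteTrue h hr, by omega, hQ⟩

theorem when {e : Expr} (hp : e.eval s ≠ 0 → Tri B p s T Q) (hq : e.eval s = 0 → Q s) :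
    Tri B (.when e p) s (e.cost + 1 + (T + 1)) Q :=
  ite (fun h => (hp h).mono (by omega) fun _ _ h => h)
    (fun h => (nop (hq h)).mono (by omega) fun _ _ h => h)

/-- Loop-free programs are executed symbolically. `maxCost` charges both branches of a conditional,
a harmless overestimate. -/
theorem straight (hp : p.Ok B s) (hQ : Q (p.exec s)) : Tri B p s p.maxCost Q := by
  induction p generalizing s Q with
  | nop => exact nop hQ
  | assign x e => exact assign hp hQ
  | write a i e => exact write hp.1 hp.2 hQ
  | seq p q ihp ihq => exact seq (ihp hp.1 fun _ => ihq hp.2 hQ)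
  | ite e p q ihp ihq =>
    refine (ite (T := p.maxCost + q.maxCost) (fun h => ?_) (fun h => ?_)).mono
      (by simp only [Prog.maxCost]; omega) fun _ _ h => h
    · simp only [Prog.Ok, Prog.exec, if_pos h] at hp hQ
      exact (ihp hp hQ).mono (by omega) fun _ _ h => h
    · simp only [Prog.Ok, Prog.exec, h, ne_eq, not_true_eq_false, if_false] at hp hQ
      exact (ihq hp hQ).mono (by omega) fun _ _ h => h
  | loop e p _ => exact absurd hp id

theorem loopFree (hc : p.maxCost ≤ T) (hp : p.Ok B s) (hQ : Q (p.exec s)) : Tri B p s T Q :=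
  (straight hp hQ).mono hc fun _ _ h => h

end Tri

/-! ### Counting loops -/

/-- `for x in 0, …, y - 1 do p`. -/
def forLoop (x y : ℕ) (p : Prog) : Prog :=
  .seq (.assign x 0) (.loop (.less (.reg x) (.reg y)) (.seq p (.assign x (.reg x + 1))))

/-- Each round pays 4 steps for the test and 4 for the increment; the final 6 are the initialisation
and the failing last test. The bound may vary with the round, as is needed when summing over the
number of resolved paths in `coreProg`. -/
theorem Tri.forLoop_sum {B x y N : ℕ} {p : Prog} {s : Store} {T : ℕ → ℕ}
    (Inv : ℕ → Store → Prop) (hx : p.writesReg x = false) (hy : p.writesReg y = false)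
    (hxy : y ≠ x) (hN : s.reg y = N) (hNB : N ≤ B) (h0 : Inv 0 (s.setReg x 0))
    (hb : ∀ i s', i < N → s'.reg x = i → s'.reg y = N → Agree (forLoop x y p) s s' → Inv i s' →
      Tri B p s' (T i) fun s'' => Inv (i + 1) (s''.setReg x (i + 1))) :
    Tri B (forLoop x y p) s (∑ i ∈ Finset.range N, (T i + 8) + 6)
      fun s' => s'.reg x = N ∧ Inv N s' := by
  have key : ∀ m i s', i + m = N → s'.reg x = i → Agree (forLoop x y p) s s' → Inv i s' →
      Tri B (.loop (.less (.reg x) (.reg y)) (.seq p (.assign x (.reg x + 1)))) s'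
        (∑ j ∈ Finset.Ico i N, (T j + 8) + 4) fun s' => s'.reg x = N ∧ Inv N s' := by
    intro m
    induction m with
    | zero =>
      intro i s' hi hxi hag hinv
      obtain rfl : i = N := by omega
      have hyN : s'.reg y = i := by
        rw [hag.reg y (by simp [forLoop, Prog.writesReg, hy, hxy]), hN]
      refine ⟨s', _, .loopDone (by simp [hxi, hyN]), ?_, hxi, hinv⟩
      simp [Expr.cost]
    | succ m ih =>
      intro i s' hi hxi hag hinv
      have hyN : s'.reg y = N := by
        rw [hag.reg y (by simp [forLoop, Prog.writesReg, hy, hxy]), hN]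
      obtain ⟨s₁, t₁, hr₁, ht₁, hinv₁⟩ := hb i s' (by omega) hxi hyN hag hinv
      have hx₁ : s₁.reg x = i := by rw [hr₁.agree.reg x hx, hxi]
      have hr₂ : Run B (.assign x (.reg x + 1)) s₁ (s₁.setReg x (i + 1)) 4 := by
        have := Run.assign (B := B) s₁ x (.reg x + 1) (by simp [hx₁]; omega)
        simpa [hx₁] using this
      have hr := hr₁.seq hr₂
      have hag' : Agree (forLoop x y p) s' (s₁.setReg x (i + 1)) := by
        refine hr.agree.mono (fun z hz => ?_) (fun z hz => ?_)
        · simp only [forLoop, Prog.writesReg, Bool.or_eq_false_iff] at hz ⊢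
          exact hz.2
        · simp only [forLoop, Prog.writesArr, Bool.or_eq_false_iff] at hz ⊢
          exact hz.2
      obtain ⟨s₂, t₂, hr₂, ht₂, hq⟩ :=
        ih (i + 1) _ (by omega) (by simp) (hag.trans hag') hinv₁
      refine ⟨s₂, _, .loopStep (by simp [hxi, hyN]; omega) hr hr₂, ?_, hq⟩
      rw [← Finset.add_sum_Ioo_eq_sum_Ico (by omega : i < N)]
      have : Finset.Ioo i N = Finset.Ico (i + 1) N := by
        ext; simp
      rw [this]
      simp only [Expr.cost]
      omega
  have hr : Run B (.assign x 0) s (s.setReg x 0) 2 := by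
    have := Run.assign (B := B) s x 0 (by simp)
    simpa using this
  obtain ⟨s₂, t₂, hr₂, ht₂, hq⟩ := key N 0 (s.setReg x 0) (by omega) (by simp) (by
    refine hr.agree.mono (fun z hz => ?_) (fun z hz => ?_)
    · simp only [forLoop, Prog.writesReg, Bool.or_eq_false_iff] at hz ⊢
      exact hz.1
    · simp [Prog.writesArr]) h0
  refine ⟨s₂, _, hr.seq hr₂, ?_, hq⟩
  rw [Finset.range_eq_Ico]
  omega

theorem Tri.forLoop {B x y N : ℕ} {p : Prog} {s : Store} {T : ℕ}
    (Inv : ℕ → Store → Prop) (hx : p.writesReg x = false) (hy : p.writesReg y = false)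
    (hxy : y ≠ x) (hN : s.reg y = N) (hNB : N ≤ B) (h0 : Inv 0 (s.setReg x 0))
    (hb : ∀ i s', i < N → s'.reg x = i → s'.reg y = N → Agree (forLoop x y p) s s' → Inv i s' →
      Tri B p s' T fun s'' => Inv (i + 1) (s''.setReg x (i + 1))) :
    Tri B (forLoop x y p) s (N * (T + 8) + 6) fun s' => s'.reg x = N ∧ Inv N s' :=
  (Tri.forLoop_sum (T := fun _ => T) Inv hx hy hxy hN hNB h0 hb).mono (by simp) fun _ _ h => h

end

/-! ### Enumerating strings with an odometer -/

/-- The base `b` digits of `c`, in cells `1, 2, …`. -/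
def digArr (b c i : ℕ) : ℕ := if i = 0 then 0 else c / b ^ (i - 1) % b

theorem digArr_zero (b : ℕ) : digArr b 0 = fun _ => 0 := by
  funext i; simp [digArr]

/-- Every string of length `l` occurs. -/
theorem exists_digArr {b : ℕ} (hb : 0 < b) (l : ℕ) (f : ℕ → ℕ) (hf : ∀ i < l, f i < b) :
    ∃ c < b ^ l, ∀ i < l, digArr b c (i + 1) = f i := by
  induction l generalizing f with
  | zero => exact ⟨0, by simp, by simp⟩
  | succ l ih =>
    obtain ⟨c, hc, h⟩ := ih (fun i => f (i + 1)) fun i hi => hf _ (by omega)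
    have h0 := hf 0 (by omega)
    refine ⟨f 0 + b * c, ?_, ?_⟩
    · calc f 0 + b * c < b * (c + 1) := by rw [mul_add]; omega
        _ ≤ b * b ^ l := Nat.mul_le_mul_left _ hc
        _ = b ^ (l + 1) := by ring
    · intro i hi
      rcases i with _ | i
      · simp [digArr, Nat.mod_eq_of_lt h0]
      · have := h i (by omega)
        simp only [digArr, Nat.add_eq_zero_iff, one_ne_zero, and_false, if_false,
          Nat.add_sub_cancel] at this ⊢
        rw [pow_succ', ← Nat.div_div_eq_div_mul, Nat.add_mul_div_left _ _ hb,
          Nat.div_eq_of_lt h0, zero_add, this]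

/-- Advance the odometer in cells `1, …, l` of array `a`; on overflow register `fl` is cleared. -/
def odoInc (a b l pos fl : ℕ) : Prog :=
  .seq (.assign pos 1) <| .seq
    (.loop (.less (.reg pos) (.reg l + 1) * .equal (.read a (.reg pos) + 1) (.reg b))
      (.seq (.write a (.reg pos) 0) (.assign pos (.reg pos + 1))))
    (.ite (.less (.reg pos) (.reg l + 1)) (.write a (.reg pos) (.read a (.reg pos) + 1))
      (.assign fl 0))

/-- Run `p` once for every string of length `l` over `0, …, b - 1`. -/
def odoLoop (a b l pos fl : ℕ) (p : Prog) : Prog :=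
  .seq (.assign fl 1) (.loop (.reg fl) (.seq p (odoInc a b l pos fl)))

/-- Divisibility of `c + 1` by `b ^ j` says that the lowest `j` digits of `c` are all `b - 1`. If
the next digit is `b - 1` too, the carry moves on. -/
theorem mod_pow_succ_of_digit {b c j : ℕ} (h : (c + 1) % b ^ j = 0)
    (hd : c / b ^ j % b + 1 = b) : (c + 1) % b ^ (j + 1) = 0 := by
  have hb : 0 < b := by omega
  have hbj : 0 < b ^ j := pow_pos hb j
  obtain ⟨q, hq⟩ := Nat.dvd_of_mod_eq_zero h
  have hq0 : 0 < q := by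
    rcases Nat.eq_zero_or_pos q with rfl | h
    · simp at hq
    · exact h
  have hc : c / b ^ j = q - 1 := by
    rw [Nat.div_eq_iff hbj]
    have : b ^ j * q = (q - 1) * b ^ j + b ^ j := by
      obtain ⟨r, rfl⟩ : ∃ r, q = r + 1 := ⟨q - 1, by omega⟩
      simp; ring
    omega
  rw [hc] at hd
  have hbq : b ∣ q := by
    have h1 := Nat.div_add_mod (q - 1) b
    refine ⟨(q - 1) / b + 1, ?_⟩
    rw [mul_add]; omega
  obtain ⟨r, rfl⟩ := hbq
  rw [hq, pow_succ]
  exact Nat.mod_eq_zero_of_dvd ⟨r, by ring⟩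

/-- The carry stops at digit `j`, which sits in cell `j + 1`: the digits below it turn from `b - 1`
to `0`, those above it are untouched. -/
theorem digArr_succ {b c j : ℕ} (h : (c + 1) % b ^ j = 0) (hd : c / b ^ j % b + 1 < b) (i : ℕ) :
    digArr b (c + 1) i =
      if i ≤ j then 0 else if i = j + 1 then digArr b c i + 1 else digArr b c i := by
  have hb : 0 < b := by omega
  have hbj : 0 < b ^ j := pow_pos hb j
  obtain ⟨q, hq⟩ := Nat.dvd_of_mod_eq_zero h
  have hq0 : 0 < q := by
    rcases Nat.eq_zero_or_pos q with rfl | h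
    · simp at hq
    · exact h
  have hc : c / b ^ j = q - 1 := by
    rw [Nat.div_eq_iff hbj]
    have : b ^ j * q = (q - 1) * b ^ j + b ^ j := by
      obtain ⟨r, rfl⟩ : ∃ r, q = r + 1 := ⟨q - 1, by omega⟩
      simp; ring
    omega
  have hc1 : (c + 1) / b ^ j = q := by rw [hq]; exact Nat.mul_div_cancel_left _ hbj
  rcases Nat.eq_zero_or_pos i with rfl | hi
  · simp [digArr]
  split_ifs with h1 h2
  · simp only [digArr, hi.ne', if_false]
    have : b ^ i ∣ b ^ j := pow_dvd_pow b h1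
    have h3 : b ^ i ∣ c + 1 := this.trans ⟨q, hq⟩
    obtain ⟨r, hr⟩ := h3
    have : b ^ i = b ^ (i - 1) * b := by rw [← pow_succ]; congr 1; omega
    rw [hr, this, mul_assoc, Nat.mul_div_cancel_left _ (pow_pos hb _), Nat.mul_mod_right]
  · subst h2
    simp only [digArr, Nat.add_eq_zero_iff, one_ne_zero, and_false, if_false,
      Nat.add_sub_cancel, hc, hc1] at hd ⊢
    have h1 := Nat.div_add_mod (q - 1) b
    have h2 : q = ((q - 1) % b + 1) + b * ((q - 1) / b) := by omega
    conv_lhs => rw [h2]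
    rw [Nat.add_mul_mod_self_left, Nat.mod_eq_of_lt hd]
  · simp only [digArr, hi.ne', if_false]
    obtain ⟨e, rfl⟩ : ∃ e, i = j + 1 + e + 1 := ⟨i - (j + 2), by omega⟩
    rw [Nat.add_sub_cancel, pow_add, pow_succ, ← Nat.div_div_eq_div_mul, ← Nat.div_div_eq_div_mul,
      ← Nat.div_div_eq_div_mul, ← Nat.div_div_eq_div_mul, hc, hc1]
    have : q / b = (q - 1) / b := by
      rw [hc] at hd
      have h1 := Nat.div_add_mod (q - 1) b
      have h2 : q = ((q - 1) % b + 1) + b * ((q - 1) / b) := by omega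
      conv_lhs => rw [h2]
      rw [Nat.add_mul_div_left _ _ hb, Nat.div_eq_of_lt hd, zero_add]
    rw [this]

/-- On overflow the array is back to all zeros, so that the same odometer can be started again; the
nested enumerations depend on this. -/
theorem Tri.odoInc {B a b l pos fl β ℓ c : ℕ} {s : Store} (hpf : pos ≠ fl) (hbp : b ≠ pos)
    (hlp : l ≠ pos) (hsb : s.reg b = β) (hsl : s.reg l = ℓ)
    (hβ : 0 < β) (hβB : β ≤ B) (hℓB : ℓ + 1 ≤ B) (hc : c < β ^ ℓ) (harr : s.arr a = digArr β c) :
    Tri B (odoInc a b l pos fl) s (20 * ℓ + 40) fun s' =>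
      (c + 1 < β ^ ℓ ∧ s'.arr a = digArr β (c + 1) ∧ s'.reg fl = s.reg fl) ∨
      (c + 1 = β ^ ℓ ∧ s'.arr a = (fun _ => 0) ∧ s'.reg fl = 0) := by
  -- Invariant of the carry: cells up to `j` are already reset, `β ^ j` divides `c + 1`, and `m`
  -- cells remain.
  have key : ∀ m j s', j + m = ℓ → s'.reg pos = j + 1 → s'.reg b = β → s'.reg l = ℓ →
      s'.reg fl = s.reg fl →
      (c + 1) % β ^ j = 0 → s'.arr a = (fun i => if i ≤ j then 0 else digArr β c i) →
      Tri B (.seq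
    (.loop (.less (.reg pos) (.reg l + 1) * .equal (.read a (.reg pos) + 1) (.reg b))
      (.seq (.write a (.reg pos) 0) (.assign pos (.reg pos + 1))))
    (.ite (.less (.reg pos) (.reg l + 1)) (.write a (.reg pos) (.read a (.reg pos) + 1))
      (.assign fl 0))) s' (20 * m + 30) fun s' =>
      (c + 1 < β ^ ℓ ∧ s'.arr a = digArr β (c + 1) ∧ s'.reg fl = s.reg fl) ∨
      (c + 1 = β ^ ℓ ∧ s'.arr a = (fun _ => 0) ∧ s'.reg fl = 0) := by
    intro m
    induction m with
    | zero =>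
      intro j s' hj hpos hb hl hfl hmod ha
      obtain rfl : j = ℓ := by omega
      -- A positive multiple of `β ^ ℓ` that is at most `β ^ ℓ`.
      have hle : c + 1 = β ^ j := by
        have := Nat.le_of_dvd (by omega) (Nat.dvd_of_mod_eq_zero hmod)
        omega
      have hr : Run B (.assign fl 0) s' (s'.setReg fl 0) 2 := by
        simpa using Run.assign (B := B) s' fl 0 (by simp)
      refine ⟨_, _, (Run.loopDone (by simp [hpos, hl])).seq
        (.iteFalse (by simp [hpos, hl]) hr), by simp, Or.inr ⟨hle, ?_, by simp⟩⟩
      simp only [Store.setReg_arr, ha]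
      funext i
      split_ifs with hi
      · rfl
      · simp only [digArr, show i ≠ 0 by omega, if_false]
        rw [Nat.div_eq_of_lt, Nat.zero_mod]
        exact lt_of_lt_of_le hc (Nat.pow_le_pow_right hβ (by omega))
    | succ m ih =>
      intro j s' hj hpos hb hl hfl hmod ha
      have hda : s'.arr a (j + 1) = c / β ^ j % β := by simp [ha, digArr]
      have hdl : c / β ^ j % β < β := Nat.mod_lt _ hβ
      by_cases hd : c / β ^ j % β + 1 = β
      · have hr₁ : Run B (.write a (.reg pos) 0) s' (s'.setArr a (j + 1) 0) 3 := by
          have := Run.write (B := B) s' a (.reg pos) 0 (by simp [hpos]; omega) (by simp)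
          simpa [hpos] using this
        have hr₂ : Run B (.assign pos (.reg pos + 1)) (s'.setArr a (j + 1) 0)
            ((s'.setArr a (j + 1) 0).setReg pos (j + 2)) 4 := by
          have := Run.assign (B := B) (s'.setArr a (j + 1) 0) pos (.reg pos + 1)
            (by simp [hpos]; omega)
          simpa [hpos] using this
        obtain ⟨s₂, t₂, hr, ht, hq⟩ := ih (j + 1) ((s'.setArr a (j + 1) 0).setReg pos (j + 2))
          (by omega) (by simp) (by simp [hbp, hb]) (by simp [hlp, hl]) (by simp [hpf.symm, hfl])
          (mod_pow_succ_of_digit hmod hd) (by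
            simp only [Store.setReg_arr, Store.setArr_arr, if_true, ha]
            funext i
            by_cases hi : i = j + 1
            · simp [hi]
            · simp only [Function.update_of_ne hi]
              by_cases h : i ≤ j
              · simp [h, show i ≤ j + 1 by omega]
              · simp [h, show ¬ i ≤ j + 1 by omega])
        cases hr with
        | seq hl' he =>
          refine ⟨_, _, (Run.loopStep ?_ (hr₁.seq hr₂) hl').seq he, ?_, hq⟩
          · simp [hpos, hl, hda, hb, hd]; omega
          · simp; omega
      · have hr₁ : Run B (.write a (.reg pos) (.read a (.reg pos) + 1)) s'
            (s'.setArr a (j + 1) (c / β ^ j % β + 1)) 6 := by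
          have := Run.write (B := B) s' a (.reg pos) (.read a (.reg pos) + 1)
            (by simp [hpos]; omega) (by simp [hpos, hda]; omega)
          simpa [hpos, hda] using this
        refine ⟨_, _, (Run.loopDone ?_).seq (.iteTrue ?_ hr₁), by simp, Or.inl ⟨?_, ?_, ?_⟩⟩
        · simp [hpos, hda, hb, hd]
        · simp [hpos, hl]; omega
        -- If `c + 1` were `β ^ ℓ`, all digits of `c` would be `β - 1`, including the one that has
        -- just stopped the carry.
        · by_contra hcon
          have hcl : c + 1 = β ^ ℓ := by omega
          have hj' : ℓ = j + 1 + m := by omega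
          apply hd
          have hbj : 0 < β ^ j := pow_pos hβ j
          have h1 : c / β ^ j = β ^ (m + 1) - 1 := by
            rw [Nat.div_eq_iff hbj]
            have h2 : β ^ ℓ = β ^ (m + 1) * β ^ j := by rw [← pow_add]; congr 1; omega
            have h3 : 0 < β ^ (m + 1) := pow_pos hβ _
            have h4 : (β ^ (m + 1) - 1) * β ^ j + β ^ j = β ^ (m + 1) * β ^ j := by
              rw [← Nat.succ_mul]; congr 1; omega
            omega
          have h3 : 0 < β ^ m := pow_pos hβ _
          have h2 : β ^ (m + 1) - 1 = (β - 1) + β * (β ^ m - 1) := by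
            have : β * (β ^ m - 1) + β = β ^ (m + 1) := by
              rw [pow_succ, Nat.mul_sub, mul_one, mul_comm]
              have : β ≤ β ^ m * β := Nat.le_mul_of_pos_left _ h3
              omega
            omega
          rw [h1, h2, Nat.add_mul_mod_self_left, Nat.mod_eq_of_lt (by omega)]
          omega
        · funext i
          rw [digArr_succ hmod (by omega)]
          simp only [Store.setArr_arr, if_true, ha]
          by_cases hi : i = j + 1
          · simp [hi, digArr]
          · simp only [Function.update_of_ne hi, hi, if_false]
        · simp [hfl]
  have hr : Run B (.assign pos 1) s (s.setReg pos 1) 2 := by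
    simpa using Run.assign (B := B) s pos 1 (by simp; omega)
  obtain ⟨s₂, t₂, hr₂, ht, hq⟩ := key ℓ 0 (s.setReg pos 1) (by omega) (by simp)
    (by simp [hbp, hsb]) (by simp [hlp, hsl]) (by simp [hpf.symm]) (by simp [Nat.mod_one])
    (by simp only [Store.setReg_arr, harr]; funext i; rcases i with _ | i <;> simp [digArr])
  exact ⟨s₂, _, hr.seq hr₂, by omega, hq⟩

/-- `hInv` demands an invariant that does not notice the odometer's own array and registers. The
flag may start at `1` because there is always at least one string. -/
theorem Tri.odoLoop {B a b l pos fl β ℓ T : ℕ} {p : Prog} {s : Store} (Inv : ℕ → Store → Prop)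
    (hpf : pos ≠ fl) (hbp : b ≠ pos) (hlp : l ≠ pos) (hbf : b ≠ fl) (hlf : l ≠ fl)
    (hpb : p.writesReg b = false) (hpl : p.writesReg l = false) (hpfl : p.writesReg fl = false)
    (hpa : p.writesArr a = false) (hsb : s.reg b = β) (hsl : s.reg l = ℓ)
    (hβ : 0 < β) (hβB : β ≤ B) (hℓB : ℓ + 1 ≤ B) (harr : s.arr a = fun _ => 0)
    (hInv : ∀ c s₁ s₂, Agree (.seq (DynCluster.odoInc a b l pos fl) (.assign fl 0)) s₁ s₂ → Inv c s₁ →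
      Inv c s₂)
    (h0 : Inv 0 s)
    (hb : ∀ c s', c < β ^ ℓ → s'.arr a = digArr β c → Agree (DynCluster.odoLoop a b l pos fl p) s s' →
      Inv c s' → Tri B p s' T (Inv (c + 1))) :
    Tri B (odoLoop a b l pos fl p) s (β ^ ℓ * (T + 20 * ℓ + 42) + 4) fun s' =>
      s'.arr a = (fun _ => 0) ∧ Inv (β ^ ℓ) s' := by
  have key : ∀ m c s', c + m = β ^ ℓ → 0 < m → s'.reg fl = 1 →
      Agree (DynCluster.odoLoop a b l pos fl p) s s' →
      s'.arr a = digArr β c → Inv c s' →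
      Tri B (.loop (.reg fl) (.seq p (DynCluster.odoInc a b l pos fl))) s'
        (m * (T + 20 * ℓ + 42) + 2) fun s' => s'.arr a = (fun _ => 0) ∧ Inv (β ^ ℓ) s' := by
    intro m
    induction m with
    | zero => intro c s' _ h0; omega
    | succ m ih =>
      intro c s' hcm _ hfl hag ha hinv
      have hbs : s'.reg b = β := by
        rw [hag.reg b (by simp [DynCluster.odoLoop, DynCluster.odoInc, Prog.writesReg, hbp, hbf, hpb]), hsb]
      have hls : s'.reg l = ℓ := by
        rw [hag.reg l (by simp [DynCluster.odoLoop, DynCluster.odoInc, Prog.writesReg, hlp, hlf, hpl]), hsl]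
      obtain ⟨s₁, t₁, hr₁, ht₁, hi₁⟩ := hb c s' (by omega) ha hag hinv
      obtain ⟨s₂, t₂, hr₂, ht₂, hq⟩ := Tri.odoInc (B := B) (s := s₁) hpf hbp hlp
        ((hr₁.agree.reg b hpb).trans hbs) ((hr₁.agree.reg l hpl).trans hls) hβ hβB hℓB
        (show c < β ^ ℓ by omega) ((hr₁.agree.arr a hpa).trans ha)
      have hi₂ : Inv (c + 1) s₂ := hInv _ _ _ (hr₂.agree.mono
        (fun x hx => by simp only [Prog.writesReg, Bool.or_eq_false_iff] at hx; exact hx.1)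
        (fun x hx => by simp only [Prog.writesArr, Bool.or_eq_false_iff] at hx; exact hx.1)) hi₁
      have hr := hr₁.seq hr₂
      have hag₂ : Agree (DynCluster.odoLoop a b l pos fl p) s s₂ := hag.trans (hr.agree.mono
        (fun x hx => by
          simp only [DynCluster.odoLoop, Prog.writesReg, Bool.or_eq_false_iff] at hx ⊢; exact hx.2)
        (fun x hx => by
          simp only [DynCluster.odoLoop, Prog.writesArr, Bool.or_eq_false_iff] at hx ⊢
          exact hx.2))
      rcases hq with ⟨hc, ha₂, hf₂⟩ | ⟨hc, ha₂, hf₂⟩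
      · obtain ⟨s₃, t₃, hr₃, ht₃, hq⟩ := ih (c + 1) s₂ (by omega) (by omega)
          (by rw [hf₂, hr₁.agree.reg fl hpfl, hfl]) hag₂ ha₂ hi₂
        refine ⟨s₃, _, .loopStep (by simp [hfl]) hr hr₃, ?_, hq⟩
        simp only [Expr.cost_reg, Nat.succ_mul m]
        omega
      · refine ⟨s₂, _, .loopStep (by simp [hfl]) hr (.loopDone (by simp [hf₂])), ?_, ha₂, hc ▸ hi₂⟩
        simp only [Expr.cost_reg, Nat.succ_mul m]
        omega
  have hr : Run B (.assign fl 1) s (s.setReg fl 1) 2 := by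
    simpa using Run.assign (B := B) s fl 1 (by simp; omega)
  have hag := hr.agree
  obtain ⟨s₂, t₂, hr₂, ht, hq⟩ := key (β ^ ℓ) 0 (s.setReg fl 1) (by simp) (pow_pos hβ _) (by simp)
    (hag.mono (fun x hx => by
          simp only [DynCluster.odoLoop, Prog.writesReg, Bool.or_eq_false_iff] at hx ⊢; exact hx.1)
        (fun x hx => by simp [Prog.writesArr]))
    (by simp [harr, digArr_zero])
    (hInv _ _ _ (hag.mono (fun x hx => by
          simp only [Prog.writesReg, Bool.or_eq_false_iff] at hx ⊢; exact hx.2)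
        (fun x hx => by simp [Prog.writesArr])) h0)
  exact ⟨s₂, _, hr.seq hr₂, by omega, hq⟩

/-! ### Tables of capped minima and their min-plus convolution -/

/-- Cell `r < t` of `f` is the least `y` with `P r y`, or `cap` if there is no such `y < cap`. -/
def Table (f : ℕ → ℕ) (t cap : ℕ) (P : ℕ → ℕ → Prop) : Prop :=
  ∀ r < t, f r ≤ cap ∧ ∀ y < cap, f r ≤ y ↔ P r y

theorem Table.congr {f : ℕ → ℕ} {t cap : ℕ} {P Q : ℕ → ℕ → Prop} (h : Table f t cap P)
    (hPQ : ∀ r < t, ∀ y < cap, P r y ↔ Q r y) : Table f t cap Q :=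
  fun r hr => ⟨(h r hr).1, fun y hy => ((h r hr).2 y hy).trans (hPQ r hr y hy)⟩

/-- Fill the first `reg 20` cells of array `a` with the cap `reg 4 + 1`. -/
def fillCap (a : ℕ) : Prog := forLoop 34 20 (.write a (.reg 34) (.reg 4 + 1))

theorem Tri.fillCap {B a t thr : ℕ} {s : Store} (ht : s.reg 20 = t) (hthr : s.reg 4 = thr)
    (htB : t ≤ B) (hB : thr + 1 ≤ B) :
    Tri B (fillCap a) s (t * 13 + 6) fun s' => ∀ i < t, s'.arr a i = thr + 1 := by
  refine (Tri.forLoop (T := 5) (fun i s' => ∀ j < i, s'.arr a j = thr + 1) rfl rfl (by decide) ht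
    htB (by simp) ?_).mono le_rfl fun _ _ h => h.2
  intro i s' hi hx hy hag hinv
  have h4 : s'.reg 4 = thr := (hag.reg 4 rfl).trans hthr
  refine (Tri.write (by simp [hx]; omega) (by simp [h4, hB]) ?_).mono (by simp) fun _ _ h => h
  intro j hj
  simp only [Store.setReg_arr, Store.setArr_arr, if_true, Expr.eval_reg, hx, Expr.eval_add, h4,
    Expr.eval_one, Function.update_apply]
  split_ifs with h
  · rfl
  · exact hinv j (by omega)

/-- Replace the table in array `a` (of length `reg 20`, capped at `reg 4 + 1`) by its min-plus
convolution with the table in array `b`. -/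
def convolve (a b : ℕ) : Prog :=
  forLoop 30 20 <| .seq (.assign 32 (.reg 20 - .reg 30)) <| .seq (.assign 33 (.reg 4 + 1)) <|
    .seq (forLoop 31 32 (.when
      (.less (.read a (.reg 32 - 1 - .reg 31) + .read b (.reg 31)) (.reg 33))
      (.assign 33 (.read a (.reg 32 - 1 - .reg 31) + .read b (.reg 31)))))
    (.write a (.reg 32 - 1) (.reg 33))

/-- The convolution can be done in place because cells are replaced from the last one downwards and
cell `r` only depends on cells `≤ r`. Capping loses nothing: a sum below the cap has both summands
below the cap, where the tables are exact. -/
theorem Tri.convolve {B a b t thr : ℕ} {s : Store} {P Q : ℕ → ℕ → Prop} (hab : b ≠ a)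
    (ht : s.reg 20 = t) (hthr : s.reg 4 = thr) (htB : t ≤ B) (hB : thr + 1 ≤ B)
    (ha : Table (s.arr a) t (thr + 1) P) (hb : Table (s.arr b) t (thr + 1) Q) :
    Tri B (convolve a b) s (t * (t * 40 + 40) + 6) fun s' =>
      Table (s'.arr a) t (thr + 1)
        (fun r y => ∃ q ≤ r, ∃ y₁ y₂, y₁ + y₂ ≤ y ∧ P (r - q) y₁ ∧ Q q y₂) := by
  let Inv : ℕ → Store → Prop := fun i s' => (∀ r < t - i, s'.arr a r = s.arr a r) ∧
    ∀ r < t, t - i ≤ r → s'.arr a r ≤ thr + 1 ∧ ∀ y < thr + 1, s'.arr a r ≤ y ↔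
      ∃ q < r + 1, s.arr a (r - q) + s.arr b q ≤ y
  refine (Tri.forLoop (T := t * 40 + 32) Inv rfl rfl (by decide) ht htB
    (by simp [Inv]; intros; omega) ?_).mono le_rfl ?_
  · intro i s' hi hx hy hag hinv
    have h4 : s'.reg 4 = thr := (hag.reg 4 rfl).trans hthr
    have hbs : s'.arr b = s.arr b := hag.arr b (by simp [DynCluster.forLoop, Prog.writesArr, hab])
    refine Tri.mono (Tri.seq (Tri.assign (by simp [hx, hy]; omega) fun _ => Tri.seq
      (Tri.assign (by simp [h4, hB]) fun _ => Tri.seq (T₁ := t * 40 + 6) (T₂ := 5) ?_)))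
      (by simp; omega) fun _ _ h => h
    simp only [Expr.eval_sub, Expr.eval_reg, hx, hy, Expr.eval_add, Expr.eval_one, Store.setReg_reg,
      Nat.reduceEqDiff, if_false, h4]
    refine (Tri.forLoop (N := t - i) (T := 26) (fun j s₁ => s₁.reg 33 ≤ thr + 1 ∧ ∀ y < thr + 1,
      s₁.reg 33 ≤ y ↔ ∃ q < j, s.arr a (t - i - 1 - q) + s.arr b q ≤ y) rfl rfl (by decide)
      (by simp) (by omega) ?_ ?_).mono ?_ ?_
    · simp
    · intro j s₁ hj h31 h32 hag₁ hinv₁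
      have hab₁ : s₁.arr b = s.arr b := by rw [hag₁.arr b rfl]; simp [hbs]
      have haa₁ : s₁.arr a (t - i - 1 - j) = s.arr a (t - i - 1 - j) := by
        rw [hag₁.arr a rfl]; simp [hinv.1 (t - i - 1 - j) (by omega)]
      refine Tri.loopFree (by simp [Prog.maxCost]) ?_ ?_
      · simp only [Prog.Ok, Expr.eval_less, Expr.eval_add, Expr.eval_read, Expr.eval_sub,
          Expr.eval_reg, Expr.eval_one, h31, h32, haa₁, hab₁]
        split_ifs <;> simp_all; omega
      · simp only [Prog.exec, Expr.eval_less, Expr.eval_add, Expr.eval_read, Expr.eval_sub,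
          Expr.eval_reg, Expr.eval_one, h31, h32, haa₁, hab₁]
        obtain ⟨hle, hiff⟩ := hinv₁
        have hsplit : ∀ y, (∃ q < j + 1, s.arr a (t - i - 1 - q) + s.arr b q ≤ y) ↔
            (∃ q < j, s.arr a (t - i - 1 - q) + s.arr b q ≤ y) ∨
              s.arr a (t - i - 1 - j) + s.arr b j ≤ y := by
          intro y
          constructor
          · rintro ⟨q, hq, h⟩
            rcases Nat.lt_succ_iff_lt_or_eq.1 hq with hq | rfl
            · exact Or.inl ⟨q, hq, h⟩
            · exact Or.inr h
          · rintro (⟨q, hq, h⟩ | h)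
            · exact ⟨q, by omega, h⟩
            · exact ⟨j, by omega, h⟩
        split_ifs with h1 h2 h2
        · simp only [Store.setReg_reg, Nat.reduceEqDiff, if_false, if_true]
          refine ⟨by omega, fun y hy => ?_⟩
          rw [hsplit, ← hiff y hy]
          omega
        · simp at h2
        · simp at h2
        · simp only [Store.setReg_reg, Nat.reduceEqDiff, if_false]
          refine ⟨hle, fun y hy => ?_⟩
          rw [hsplit, ← hiff y hy]
          omega
    · have : (t - i) * (26 + 8) ≤ t * 34 := Nat.mul_le_mul_right _ (by omega)
      omega
    · rintro s₁ hag₁ ⟨-, hle, hiff⟩ -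
      have h32 : s₁.reg 32 = t - i := by rw [hag₁.reg 32 rfl]; simp
      have haa : s₁.arr a = s'.arr a := by rw [hag₁.arr a rfl]; simp
      refine (Tri.write (by simp [h32]; omega) (by simp; omega) ?_).mono (by simp) fun _ _ h => h
      simp only [Expr.eval_sub, Expr.eval_reg, Expr.eval_one, h32, Inv, Store.setReg_arr,
        Store.setArr_arr, if_true, haa]
      refine ⟨fun r hr => ?_, fun r hr hr' => ?_⟩
      · rw [Function.update_of_ne (by omega)]
        exact hinv.1 r (by omega)
      · by_cases hri : r = t - i - 1
        · subst hri
          rw [Function.update_self]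
          refine ⟨hle, fun y hy => ?_⟩
          rw [hiff y hy, show t - i - 1 + 1 = t - i by omega]
        · rw [Function.update_of_ne hri]
          exact hinv.2 r hr (by omega)
  · rintro s' - ⟨-, -, hinv⟩ r hr
    obtain ⟨h1, h2⟩ := hinv r hr (by omega)
    refine ⟨h1, fun y hy => (h2 y hy).trans ⟨?_, ?_⟩⟩
    · rintro ⟨q, hq, h⟩
      exact ⟨q, by omega, _, _, h, ((ha _ (by omega)).2 _ (by omega)).1 le_rfl,
        ((hb _ (by omega)).2 _ (by omega)).1 le_rfl⟩
    · rintro ⟨q, hq, y₁, y₂, hle, hp, hq'⟩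
      have e1 := ((ha (r - q) (by omega)).2 y₁ (by omega)).2 hp
      have e2 := ((hb q (by omega)).2 y₂ (by omega)).2 hq'
      exact ⟨q, by omega, by omega⟩

/-! ### Relations on `{0, …, n - 1}` and their matrices -/

/-- The pairs `u < v` of numbers below `n`. -/
def pairs (n : ℕ) : Finset (ℕ × ℕ) :=
  (Finset.range n ×ˢ Finset.range n).filter fun p => p.1 < p.2

theorem mem_pairs {n : ℕ} {p : ℕ × ℕ} : p ∈ pairs n ↔ p.1 < p.2 ∧ p.2 < n := by
  simp only [pairs, Finset.mem_filter, Finset.mem_product, Finset.mem_range]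
  omega

theorem cell_div {n u v : ℕ} (hv : v < n) : (u * n + v) / n = u := by
  rw [mul_comm, Nat.mul_add_div (by omega), Nat.div_eq_of_lt hv, add_zero]

theorem cell_mod {n u v : ℕ} (hv : v < n) : (u * n + v) % n = v := by
  rw [mul_comm, Nat.mul_add_mod, Nat.mod_eq_of_lt hv]

theorem cell_lt {n u v : ℕ} (hu : u < n) (hv : v < n) : u * n + v < n * n := by nlinarith

theorem div_lt_of_lt_sq {n p : ℕ} (hp : p < n * n) : p / n < n := Nat.div_lt_of_lt_mul hp

theorem mod_lt_of_lt_sq {n p : ℕ} (hp : p < n * n) : p % n < n :=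
  Nat.mod_lt _ (Nat.pos_of_ne_zero (by rintro rfl; simp at hp))

/-- Row-major summation. -/
theorem sum_range_mul_self (n : ℕ) (F : ℕ → ℕ → ℕ) :
    ∑ p ∈ Finset.range (n * n), F (p / n) (p % n) =
      ∑ q ∈ Finset.range n ×ˢ Finset.range n, F q.1 q.2 := by
  refine Finset.sum_nbij' (fun p => (p / n, p % n)) (fun q => q.1 * n + q.2) ?_ ?_ ?_ ?_ ?_
  · intro p hp
    have hp := Finset.mem_range.1 hp
    have hn : 0 < n := Nat.pos_of_ne_zero (by rintro rfl; simp at hp)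
    simp only [Finset.mem_product, Finset.mem_range]
    exact ⟨Nat.div_lt_of_lt_mul hp, Nat.mod_lt _ hn⟩
  · rintro ⟨u, v⟩ hq
    simp only [Finset.mem_product, Finset.mem_range] at hq ⊢
    nlinarith [hq.1, hq.2]
  · intro p _
    exact Nat.div_add_mod' p n
  · rintro ⟨u, v⟩ hq
    simp only [Finset.mem_product, Finset.mem_range] at hq
    simp [cell_div hq.2, cell_mod hq.2]
  · intro p _
    rfl

theorem sum_range_pairs (n : ℕ) (F : ℕ → ℕ → ℕ) :
    ∑ p ∈ Finset.range (n * n), (if p / n < p % n then F (p / n) (p % n) else 0) =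
      ∑ q ∈ pairs n, F q.1 q.2 := by
  rw [sum_range_mul_self n fun u v => if u < v then F u v else 0, pairs, Finset.sum_filter]

/-- The array `h` holds the `n × n` matrix `W`. -/
def IsMatrix (n : ℕ) (h : ℕ → ℕ) (W : ℕ → ℕ → ℕ) : Prop := ∀ p < n * n, h p = W (p / n) (p % n)

theorem IsMatrix.cell {n : ℕ} {h : ℕ → ℕ} {W : ℕ → ℕ → ℕ} (hW : IsMatrix n h W) {u v : ℕ}
    (hu : u < n) (hv : v < n) : h (u * n + v) = W u v := by
  rw [hW _ (cell_lt hu hv), cell_div hv, cell_mod hv]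

open Classical in
/-- The characteristic function of a relation. -/
noncomputable def ind (E : ℕ → ℕ → Prop) (u v : ℕ) : ℕ := if E u v then 1 else 0

theorem ind_le (E : ℕ → ℕ → Prop) (u v : ℕ) : ind E u v ≤ 1 := by unfold ind; split <;> omega

theorem ind_eq_one {E : ℕ → ℕ → Prop} {u v : ℕ} (h : E u v) : ind E u v = 1 := if_pos h
theorem ind_eq_zero {E : ℕ → ℕ → Prop} {u v : ℕ} (h : ¬ E u v) : ind E u v = 0 := if_neg h

@[simp] theorem ind_ne_zero_iff {E : ℕ → ℕ → Prop} {u v : ℕ} : ind E u v = 0 ↔ ¬ E u v := by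
  unfold ind; split <;> simp_all

open Classical in
/-- The number of pairs on which two relations differ. -/
noncomputable def distRel (n : ℕ) (E E' : ℕ → ℕ → Prop) : ℕ :=
  ((pairs n).filter fun p => ¬ (E p.1 p.2 ↔ E' p.1 p.2)).card

open Classical in
/-- The weight of a relation: a related pair contributes `Wk`, an unrelated one `Wc`. -/
noncomputable def weight (n : ℕ) (Wk Wc : ℕ → ℕ → ℕ) (E : ℕ → ℕ → Prop) : ℕ :=
  ∑ p ∈ pairs n, if E p.1 p.2 then Wk p.1 p.2 else Wc p.1 p.2

structure ReflSymm (E : ℕ → ℕ → Prop) : Prop where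
  refl : ∀ u, E u u
  symm : ∀ {u v}, E u v → E v u

/-- Transitivity on `{0, …, n - 1}`. -/
def TransOn (n : ℕ) (E : ℕ → ℕ → Prop) : Prop :=
  ∀ ⦃u v w⦄, u < n → v < n → w < n → E u v → E v w → E u w

/-! ### Induced paths on three vertices -/

/-- The triple coded by `i` is an induced path on three vertices. -/
def IsP3 (n : ℕ) (E : ℕ → ℕ → Prop) (i : ℕ) : Prop :=
  E (i / (n * n)) (i / n % n) ∧ E (i / n % n) (i % n) ∧ ¬ E (i / (n * n)) (i % n)

open Classical in
/-- One more than the last `i` below the bound that codes an induced path, `0` if there is none. -/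
noncomputable def lastP3 (n : ℕ) (E : ℕ → ℕ → Prop) : ℕ → ℕ
  | 0 => 0
  | i + 1 => if IsP3 n E i then i + 1 else lastP3 n E i

theorem lastP3_le (n : ℕ) (E : ℕ → ℕ → Prop) (i : ℕ) : lastP3 n E i ≤ i := by
  induction i with
  | zero => simp [lastP3]
  | succ i ih => unfold lastP3; split <;> omega

theorem isP3_of_lastP3_ne {n : ℕ} {E : ℕ → ℕ → Prop} {m : ℕ} (h : lastP3 n E m ≠ 0) :
    IsP3 n E (lastP3 n E m - 1) := by
  induction m with
  | zero => simp [lastP3] at h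
  | succ i ih =>
    unfold lastP3 at h ⊢
    split_ifs at h ⊢ with h1
    · simpa using h1
    · exact ih h

theorem not_isP3_of_lastP3_eq {n : ℕ} {E : ℕ → ℕ → Prop} {m i : ℕ} (h : lastP3 n E m = 0)
    (hi : i < m) : ¬ IsP3 n E i := by
  induction m with
  | zero => omega
  | succ k ih =>
    unfold lastP3 at h
    split_ifs at h with h1
    rcases Nat.lt_succ_iff_lt_or_eq.1 hi with hi | rfl
    · exact ih h hi
    · exact h1

theorem triple_lt {n i : ℕ} (hi : i < n * n * n) :
    i / (n * n) < n ∧ i / n % n < n ∧ i % n < n ∧ i / n < n * n ∧ i % (n * n) < n * n := by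
  have hn : 0 < n := Nat.pos_of_ne_zero (by rintro rfl; simp at hi)
  exact ⟨Nat.div_lt_of_lt_mul hi, Nat.mod_lt _ hn, Nat.mod_lt _ hn,
    Nat.div_lt_of_lt_mul (by linarith [mul_comm n (n * n)]), Nat.mod_lt _ (by positivity)⟩

theorem transOn_of_lastP3_eq {n : ℕ} {E : ℕ → ℕ → Prop} (h : lastP3 n E (n * n * n) = 0) :
    TransOn n E := by
  intro u v w hu hv hw huv hvw
  by_contra hcon
  have hn : 0 < n := by omega
  have hlt : (u * n + v) * n + w < n * n * n := by
    have := cell_lt hu hv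
    nlinarith
  refine not_isP3_of_lastP3_eq h hlt ?_
  have h1 : ((u * n + v) * n + w) / n = u * n + v := cell_div hw
  have h2 : ((u * n + v) * n + w) / (n * n) = u := by
    rw [← Nat.div_div_eq_div_mul, h1, cell_div hv]
  simp only [IsP3, h1, h2, cell_mod hv, cell_mod hw]
  exact ⟨huv, hvw, hcon⟩

theorem lastP3_eq_of_transOn {n : ℕ} {E : ℕ → ℕ → Prop} (h : TransOn n E) :
    lastP3 n E (n * n * n) = 0 := by
  by_contra hcon
  obtain ⟨h1, h2, h3⟩ := isP3_of_lastP3_ne hcon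
  have hlt : lastP3 n E (n * n * n) - 1 < n * n * n := by
    have := lastP3_le n E (n * n * n)
    omega
  obtain ⟨a, b, c, -, -⟩ := triple_lt hlt
  exact h3 (h a b c h1 h2)

/-- Flip the pair `x, y`. -/
def toggle (E : ℕ → ℕ → Prop) (x y u v : ℕ) : Prop :=
  ((u = x ∧ v = y ∨ u = y ∧ v = x) ∧ ¬ E u v) ∨ (¬ (u = x ∧ v = y ∨ u = y ∧ v = x) ∧ E u v)

/-- Resolve the last induced path `u, v, w` by flipping one pair:
`uv` if `δ = 1`, `vw` if `δ = 2`, `uw` otherwise. -/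
noncomputable def resolve (n : ℕ) (E : ℕ → ℕ → Prop) (δ : ℕ) : ℕ → ℕ → Prop :=
  if lastP3 n E (n * n * n) = 0 then E else
    let i := lastP3 n E (n * n * n) - 1
    toggle E (if δ = 2 then i / n % n else i / (n * n)) (if δ = 1 then i / n % n else i % n)

/-- Resolve induced paths one after the other. -/
noncomputable def resolveSeq (n : ℕ) (E : ℕ → ℕ → Prop) (f : ℕ → ℕ) : ℕ → ℕ → ℕ → Prop
  | 0 => E
  | j + 1 => resolve n (resolveSeq n E f j) (f j)

theorem resolveSeq_congr {n : ℕ} {E : ℕ → ℕ → Prop} {f g : ℕ → ℕ} {L : ℕ}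
    (h : ∀ i < L, f i = g i) : resolveSeq n E f L = resolveSeq n E g L := by
  induction L with
  | zero => rfl
  | succ L ih =>
    rw [resolveSeq, resolveSeq, ih fun i hi => h i (by omega), h L (by omega)]

theorem ReflSymm.toggle {E : ℕ → ℕ → Prop} (hE : ReflSymm E) {x y : ℕ} (hxy : x ≠ y) :
    ReflSymm (toggle E x y) := by
  refine ⟨fun u => Or.inr ⟨?_, hE.refl u⟩, fun {u v} h => ?_⟩
  · rintro (⟨rfl, rfl⟩ | ⟨rfl, rfl⟩) <;> exact hxy rfl
  · rcases h with ⟨h1, h2⟩ | ⟨h1, h2⟩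
    · exact Or.inl ⟨by tauto, fun h => h2 (hE.symm h)⟩
    · exact Or.inr ⟨by tauto, hE.symm h2⟩

/-- The pair flipped by `resolve`. -/
theorem resolve_eq {n : ℕ} {E : ℕ → ℕ → Prop} (hE : ReflSymm E)
    (h : lastP3 n E (n * n * n) ≠ 0) :
    ∃ u v w, u < n ∧ v < n ∧ w < n ∧ u ≠ v ∧ v ≠ w ∧ u ≠ w ∧ E u v ∧ E v w ∧ ¬ E u w ∧
      ∀ δ, resolve n E δ =
        DynCluster.toggle E (if δ = 2 then v else u) (if δ = 1 then v else w) := by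
  have hp := isP3_of_lastP3_ne h
  have hlt : lastP3 n E (n * n * n) - 1 < n * n * n := by
    have := lastP3_le n E (n * n * n)
    omega
  obtain ⟨a, b, c, -, -⟩ := triple_lt hlt
  obtain ⟨h1, h2, h3⟩ := hp
  refine ⟨_, _, _, a, b, c, ?_, ?_, ?_, h1, h2, h3, fun δ => ?_⟩
  · intro he; exact h3 (he ▸ h2)
  · intro he; exact h3 (he ▸ h1)
  · intro he; exact h3 (he ▸ hE.refl _)
  · simp [resolve, h]

theorem ReflSymm.resolve {n : ℕ} {E : ℕ → ℕ → Prop} (hE : ReflSymm E) {δ : ℕ} :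
    ReflSymm (resolve n E δ) := by
  by_cases h : lastP3 n E (n * n * n) = 0
  · simpa [DynCluster.resolve, h] using hE
  · obtain ⟨u, v, w, -, -, -, h1, h2, h3, -, -, -, h⟩ := resolve_eq hE h
    rw [h]
    refine hE.toggle ?_
    split_ifs <;> omega

theorem ReflSymm.resolveSeq {n : ℕ} {E : ℕ → ℕ → Prop} (hE : ReflSymm E) (f : ℕ → ℕ) (L : ℕ) :
    ReflSymm (resolveSeq n E f L) := by
  induction L with
  | zero => exact hE
  | succ L ih => exact ih.resolve

theorem toggle_iff_of_ne {E : ℕ → ℕ → Prop} {x y u v : ℕ}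
    (h : ¬ (u = x ∧ v = y ∨ u = y ∧ v = x)) : toggle E x y u v ↔ E u v := by
  unfold toggle; tauto

theorem toggle_iff_not {E : ℕ → ℕ → Prop} {x y u v : ℕ}
    (h : u = x ∧ v = y ∨ u = y ∧ v = x) : toggle E x y u v ↔ ¬ E u v := by
  unfold toggle; tauto

theorem toggle_comm (E : ℕ → ℕ → Prop) (x y : ℕ) : toggle E x y = toggle E y x := by
  funext u v; unfold toggle; apply propext; tauto

theorem distRel_toggle_le (n : ℕ) (E E₀ : ℕ → ℕ → Prop) (x y : ℕ) :
    distRel n E₀ (toggle E x y) ≤ distRel n E₀ E + 1 := by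
  classical
  wlog hxy : x ≤ y generalizing x y
  · rw [toggle_comm]; exact this y x (by omega)
  unfold distRel
  refine le_trans (Finset.card_le_card (t := insert (x, y) _) ?_) (Finset.card_insert_le _ _)
  rintro ⟨u, v⟩ h
  simp only [Finset.mem_filter, mem_pairs, Finset.mem_insert, Prod.mk.injEq] at h ⊢
  by_cases hc : u = x ∧ v = y
  · exact Or.inl hc
  · refine Or.inr ⟨h.1, ?_⟩
    rw [toggle_iff_of_ne (by omega)] at h
    exact h.2

/-- Flipping a pair on which `E` differs from `E'` brings `E` closer to `E'`. -/
theorem distRel_toggle {n : ℕ} {E E' : ℕ → ℕ → Prop} (hE : ReflSymm E) (hE' : ReflSymm E')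
    {x y : ℕ} (hx : x < n) (hy : y < n) (hxy : x ≠ y) (h : ¬ (E x y ↔ E' x y)) :
    distRel n (toggle E x y) E' + 1 = distRel n E E' := by
  classical
  wlog hlt : x < y generalizing x y
  · rw [toggle_comm]
    refine this hy hx hxy.symm (fun h' => h ⟨fun h1 => hE'.symm (h'.1 (hE.symm h1)),
      fun h1 => hE.symm (h'.2 (hE'.symm h1))⟩) (by omega)
  unfold distRel
  have hmem : (x, y) ∈ (pairs n).filter fun p => ¬ (E p.1 p.2 ↔ E' p.1 p.2) := by
    simp [mem_pairs, hlt, hy, h]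
  rw [← Finset.card_erase_add_one hmem]
  congr 2
  ext ⟨u, v⟩
  simp only [Finset.mem_filter, mem_pairs, Finset.mem_erase, ne_eq, Prod.mk.injEq]
  by_cases hc : u = x ∧ v = y
  · obtain ⟨rfl, rfl⟩ := hc
    rw [toggle_iff_not (by simp)]
    simp only [and_self, not_true_eq_false, false_and, iff_false, not_and]
    tauto
  · constructor
    · rintro ⟨h1, h2⟩
      rw [toggle_iff_of_ne (by omega)] at h2
      exact ⟨hc, h1, h2⟩
    · rintro ⟨-, h1, h2⟩
      rw [toggle_iff_of_ne (by omega)]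
      exact ⟨h1, h2⟩

theorem distRel_resolveSeq_le {n : ℕ} {E : ℕ → ℕ → Prop} (f : ℕ → ℕ) (L : ℕ) :
    distRel n E (resolveSeq n E f L) ≤ L := by
  induction L with
  | zero => simp [resolveSeq, distRel]
  | succ L ih =>
    rw [resolveSeq, resolve]
    by_cases h : lastP3 n (resolveSeq n E f L) (n * n * n) = 0
    · rw [if_pos h]; omega
    · rw [if_neg h]
      exact (distRel_toggle_le _ _ _ _ _).trans (by omega)

/-- Every cluster graph is approached by resolving induced paths appropriately. -/
theorem exists_resolveSeq {n : ℕ} {E E' : ℕ → ℕ → Prop} (hE : ReflSymm E) (hE' : ReflSymm E')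
    (ht : TransOn n E') : ∃ f : ℕ → ℕ, (∀ i, f i < 3) ∧ ∃ L,
      distRel n (resolveSeq n E f L) E' + L = distRel n E E' ∧ TransOn n (resolveSeq n E f L) ∧
      ∀ u v, (resolveSeq n E f L u v ↔ E u v) ∨ (resolveSeq n E f L u v ↔ E' u v) := by
  -- Only pairs on which the current relation differs from `E'` are flipped. Hence each step lowers
  -- the distance by exactly one, and every pair always agrees with `E` or with `E'`. The induction
  -- is on the number of steps, with an early stop once the relation is transitive.
  have key : ∀ m, ∃ f : ℕ → ℕ, (∀ i, f i < 3) ∧ ∃ L,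
      distRel n (resolveSeq n E f L) E' + L = distRel n E E' ∧
      (TransOn n (resolveSeq n E f L) ∨ L = m) ∧
      ∀ u v, (resolveSeq n E f L u v ↔ E u v) ∨ (resolveSeq n E f L u v ↔ E' u v) := by
    intro m
    induction m with
    | zero => exact ⟨fun _ => 0, by simp, 0, by simp [resolveSeq], Or.inr rfl, by simp [resolveSeq]⟩
    | succ m ih =>
      obtain ⟨f, hf, L, hd, hT, hb⟩ := ih
      rcases hT with hT | rfl
      · exact ⟨f, hf, L, hd, Or.inl hT, hb⟩
      by_cases h0 : lastP3 n (resolveSeq n E f L) (n * n * n) = 0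
      · exact ⟨f, hf, L, hd, Or.inl (transOn_of_lastP3_eq h0), hb⟩
      have hF := hE.resolveSeq (n := n) f L
      obtain ⟨u, v, w, hu, hv, hw, huv, hvw, huw, e1, e2, e3, hres⟩ := resolve_eq hF h0
      -- A transitive relation cannot agree with an induced path on all three of its pairs.
      obtain ⟨δ, hδ, hne⟩ : ∃ δ < 3, ¬ (resolveSeq n E f L (if δ = 2 then v else u)
          (if δ = 1 then v else w) ↔ E' (if δ = 2 then v else u) (if δ = 1 then v else w)) := by
        by_contra hcon
        push Not at hcon
        have c0 := hcon 0 (by omega)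
        have c1 := hcon 1 (by omega)
        have c2 := hcon 2 (by omega)
        simp only [OfNat.zero_ne_ofNat, OfNat.one_ne_ofNat, if_false, if_true, zero_ne_one,
          OfNat.ofNat_ne_one] at c0 c1 c2
        exact e3 (c0.2 (ht hu hv hw (c1.1 e1) (c2.1 e2)))
      have hx : (if δ = 2 then v else u) < n := by split_ifs <;> assumption
      have hy : (if δ = 1 then v else w) < n := by split_ifs <;> assumption
      have hxy : (if δ = 2 then v else u) ≠ (if δ = 1 then v else w) := by
        split_ifs <;> omega
      have hcongr : resolveSeq n E (Function.update f L δ) L = resolveSeq n E f L :=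
        resolveSeq_congr fun i hi => by rw [Function.update_of_ne (by omega)]
      have hstep : resolveSeq n E (Function.update f L δ) (L + 1) =
          toggle (resolveSeq n E f L) (if δ = 2 then v else u) (if δ = 1 then v else w) := by
        rw [resolveSeq, hcongr, Function.update_self, hres]
      refine ⟨Function.update f L δ, fun i => ?_, L + 1, ?_, Or.inr rfl, fun a b => ?_⟩
      · rw [Function.update_apply]; split_ifs
        · exact hδ
        · exact hf i
      · rw [hstep]
        have := distRel_toggle hF hE' hx hy hxy hne
        omega
      · rw [hstep]
        by_cases hc : a = (if δ = 2 then v else u) ∧ b = (if δ = 1 then v else w) ∨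
            a = (if δ = 1 then v else w) ∧ b = (if δ = 2 then v else u)
        · refine Or.inr ?_
          rw [toggle_iff_not hc]
          rcases hc with ⟨rfl, rfl⟩ | ⟨rfl, rfl⟩
          · tauto
          · have s1 : ∀ {x y}, resolveSeq n E f L x y ↔ resolveSeq n E f L y x :=
              ⟨hF.symm, hF.symm⟩
            have s2 : ∀ {x y}, E' x y ↔ E' y x := ⟨hE'.symm, hE'.symm⟩
            rw [s1, s2]; tauto
        · rw [toggle_iff_of_ne hc]
          exact hb a b
  -- The number of steps never exceeds the initial distance, so asking for one more step forces the
  -- early stop.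
  obtain ⟨f, hf, L, hd, hT, hb⟩ := key (distRel n E E' + 1)
  refine ⟨f, hf, L, hd, hT.resolve_right (by omega), hb⟩

section

/-! ### Splitting the clusters of a cluster graph -/

open Classical in
/-- The number of smaller vertices related to `v`. -/
noncomputable def rankIn (E : ℕ → ℕ → Prop) (v : ℕ) : ℕ :=
  ((Finset.range v).filter fun u => E u v).card

open Classical in
/-- The first vertices of the clusters. -/
noncomputable def leaders (n : ℕ) (E : ℕ → ℕ → Prop) : Finset ℕ :=
  (Finset.range n).filter fun v => rankIn E v = 0

open Classical in
/-- The number of pairs cut when the cluster of `g` is split according to `σ`. -/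
noncomputable def cutAt (n : ℕ) (E : ℕ → ℕ → Prop) (σ : ℕ → ℕ) (g : ℕ) : ℕ :=
  ∑ p ∈ pairs n, if E g p.1 ∧ E g p.2 then
    if σ (rankIn E p.1) = σ (rankIn E p.2) then 0 else 1 else 0

open Classical in
/-- The weight of the cluster of `g` when it is split according to `σ`. -/
noncomputable def weightAt (n : ℕ) (Wk Wc : ℕ → ℕ → ℕ) (E : ℕ → ℕ → Prop) (σ : ℕ → ℕ) (g : ℕ) :
    ℕ :=
  ∑ p ∈ pairs n, if E g p.1 ∧ E g p.2 then
    if σ (rankIn E p.1) = σ (rankIn E p.2) then Wk p.1 p.2 else Wc p.1 p.2 else 0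

open Classical in
/-- The weight of the pairs that are not related by `E`. -/
noncomputable def weightOff (n : ℕ) (Wc : ℕ → ℕ → ℕ) (E : ℕ → ℕ → Prop) : ℕ :=
  ∑ p ∈ pairs n, if E p.1 p.2 then 0 else Wc p.1 p.2

variable {n : ℕ} {E S : ℕ → ℕ → Prop}

theorem rankIn_lt (ht : TransOn n E) {u v : ℕ} (hv : v < n) (huv : u < v)
    (h : E u v) : rankIn E u < rankIn E v := by
  classical
  refine Finset.card_lt_card ⟨fun w hw => ?_, fun hcon => ?_⟩
  · simp only [Finset.mem_filter, Finset.mem_range] at hw ⊢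
    exact ⟨by omega, ht (by omega) (by omega) hv hw.2 h⟩
  · have := hcon (show u ∈ _ by simp [huv, h])
    simp at this

theorem rankIn_inj (hE : ReflSymm E) (ht : TransOn n E) {u v : ℕ} (hu : u < n) (hv : v < n)
    (h : E u v) (hr : rankIn E u = rankIn E v) : u = v := by
  rcases lt_trichotomy u v with h1 | h1 | h1
  · have := rankIn_lt ht hv h1 h; omega
  · exact h1
  · have := rankIn_lt ht hu h1 (hE.symm h); omega

/-- The smallest related vertex has rank `0`: anything smaller related to it would by transitivity
be related to `u`. -/
theorem exists_leader (hE : ReflSymm E) (ht : TransOn n E) {u : ℕ} (hu : u < n) :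
    ∃ g ∈ leaders n E, E g u ∧ g ≤ u := by
  classical
  have hex : ∃ w, E w u := ⟨u, hE.refl u⟩
  have hle : Nat.find hex ≤ u := Nat.find_min' hex (hE.refl u)
  have hsp := Nat.find_spec hex
  refine ⟨Nat.find hex, ?_, hsp, hle⟩
  simp only [leaders, Finset.mem_filter, Finset.mem_range, rankIn, Finset.card_eq_zero,
    Finset.filter_eq_empty_iff]
  refine ⟨by omega, fun w hw hcon => Nat.find_min hex hw (ht (by omega) (by omega) hu hcon hsp)⟩

theorem leader_unique (hE : ReflSymm E) (ht : TransOn n E) {g g' : ℕ} (hg : g ∈ leaders n E)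
    (hg' : g' ∈ leaders n E) (h : E g g') : g = g' := by
  classical
  simp only [leaders, Finset.mem_filter, Finset.mem_range] at hg hg'
  exact rankIn_inj hE ht hg.1 hg'.1 h (by omega)

/-- A pair inside a cluster is counted for exactly one leader, and a pair between clusters for none.
`F` may depend on the leader because each cluster has its own splitting code. -/
theorem sum_leaders (hE : ReflSymm E) (ht : TransOn n E) {lead : ℕ → ℕ}
    (hl : ∀ u < n, lead u ∈ leaders n E ∧ E (lead u) u) (F : ℕ → ℕ × ℕ → ℕ)
    [DecidableRel E] :
    ∑ g ∈ leaders n E, ∑ p ∈ pairs n, (if E g p.1 ∧ E g p.2 then F g p else 0) =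
      ∑ p ∈ pairs n, if E p.1 p.2 then F (lead p.1) p else 0 := by
  classical
  have hlt : ∀ g ∈ leaders n E, g < n := fun g hg => by
    simp only [leaders, Finset.mem_filter, Finset.mem_range] at hg; exact hg.1
  rw [Finset.sum_comm]
  refine Finset.sum_congr rfl fun p hp => ?_
  obtain ⟨h1, h2⟩ := mem_pairs.1 hp
  have h3 : p.1 < n := by omega
  obtain ⟨hl1, hl2⟩ := hl p.1 h3
  split_ifs with h
  · rw [Finset.sum_eq_single (lead p.1)]
    · rw [if_pos ⟨hl2, ht (hlt _ hl1) h3 h2 hl2 h⟩]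
    · intro g hg hne
      rw [if_neg]
      rintro ⟨e1, -⟩
      exact hne (leader_unique hE ht hg hl1 (ht (hlt _ hg) h3 (hlt _ hl1) e1 (hE.symm hl2)))
    · exact fun h => absurd hl1 h
  · refine Finset.sum_eq_zero fun g hg => if_neg ?_
    rintro ⟨e1, e2⟩
    exact h (ht h3 (hlt _ hg) h2 (hE.symm e1) e2)

theorem distRel_of_le (hle : ∀ u v, u < n → v < n → S u v → E u v) [DecidableRel E]
    [DecidableRel S] :
    distRel n E S = ∑ p ∈ pairs n, if E p.1 p.2 then if S p.1 p.2 then 0 else 1 else 0 := by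
  classical
  rw [distRel, Finset.card_filter]
  refine Finset.sum_congr rfl fun p hp => ?_
  obtain ⟨h1, h2⟩ := mem_pairs.1 hp
  have := hle p.1 p.2 (by omega) h2
  split_ifs <;> tauto

theorem weight_of_le (hle : ∀ u v, u < n → v < n → S u v → E u v) (Wk Wc : ℕ → ℕ → ℕ)
    [DecidableRel E] [DecidableRel S] :
    weight n Wk Wc S = weightOff n Wc E +
      ∑ p ∈ pairs n, if E p.1 p.2 then if S p.1 p.2 then Wk p.1 p.2 else Wc p.1 p.2 else 0 := by
  classical
  rw [weight, weightOff, ← Finset.sum_add_distrib]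
  refine Finset.sum_congr rfl fun p hp => ?_
  obtain ⟨h1, h2⟩ := mem_pairs.1 hp
  have := hle p.1 p.2 (by omega) h2
  split_ifs <;> first | omega | tauto

/-- A cluster that is split by `S` has at most `distRel n E S + 1` elements. -/
theorem rankIn_le_of_split (hE : ReflSymm E) (ht : TransOn n E) (hS : ReflSymm S)
    (hSt : TransOn n S) {a b w : ℕ} (ha : a < n) (hb : b < n) (hw : w < n) (hab : E a b)
    (haw : E a w) (hns : ¬ S a b) : rankIn E w ≤ distRel n E S := by
  classical
  set cl := (Finset.range n).filter fun x => E a x with hcl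
  have h1 : rankIn E w ≤ (cl.erase w).card := by
    refine Finset.card_le_card fun x hx => ?_
    simp only [Finset.mem_filter, Finset.mem_range] at hx
    simp only [hcl, Finset.mem_erase, Finset.mem_filter, Finset.mem_range]
    exact ⟨by omega, by omega, ht ha hw (by omega) haw (hE.symm hx.2)⟩
  have h2 : (cl.erase w).card = (cl.erase a).card := by
    rw [Finset.card_erase_of_mem (by simp [hcl, hw, haw]),
      Finset.card_erase_of_mem (by simp [hcl, ha, hE.refl])]
  rw [h2] at h1
  refine h1.trans ?_
  have hsort : ∀ x y : ℕ, x < n → y < n → E x y → ¬ S x y → (min x y, max x y) ∈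
      (pairs n).filter fun p => ¬ (E p.1 p.2 ↔ S p.1 p.2) := by
    intro x y hx hy hxy hns
    have hne : x ≠ y := fun h => hns (h ▸ hS.refl x)
    simp only [Finset.mem_filter, mem_pairs]
    rcases lt_or_gt_of_ne hne with h | h
    · rw [min_eq_left h.le, max_eq_right h.le]; tauto
    · rw [min_eq_right h.le, max_eq_left h.le]
      exact ⟨⟨h, hx⟩, fun hi => hns (hS.symm (hi.1 (hE.symm hxy)))⟩
  have hor : ∀ x < n, S x a → ¬ S x b := fun x hx h1 h2 => hns (hSt ha hx hb (hS.symm h1) h2)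
  -- Since `S` separates `a` from `b`, every vertex `x ≠ a` of the cluster is separated from one of
  -- them. Sending `x` to the cut pair `{x, b}` or `{x, a}` is injective because `x` is never `a`.
  refine Finset.card_le_card_of_injOn
    (fun x => if S x a then (min x b, max x b) else (min x a, max x a)) ?_ ?_
  · intro x hx
    simp only [hcl, Finset.coe_erase, Finset.coe_filter, Finset.mem_range, Set.mem_sdiff,
      Set.mem_ofPred_eq, Set.mem_singleton_iff] at hx
    dsimp only
    split_ifs with h
    · exact hsort x b hx.1.1 hb (ht hx.1.1 ha hb (hE.symm hx.1.2) hab) (hor x hx.1.1 h)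
    · exact hsort x a hx.1.1 ha (hE.symm hx.1.2) h
  · intro x hx y hy hxy
    simp only [hcl, Finset.coe_erase, Finset.coe_filter, Finset.mem_range, Set.mem_sdiff,
      Set.mem_ofPred_eq, Set.mem_singleton_iff] at hx hy
    dsimp only at hxy
    have hba : b ≠ a := fun h => hns (h ▸ hS.refl _)
    split_ifs at hxy with h1 h2 h2 <;> simp only [Prod.mk.injEq] at hxy <;> omega

/-- Every splitting of a cluster that cuts at most `R` pairs is described by a string over
`0, …, R` that starts with `0`. -/
theorem exists_code (hE : ReflSymm E) (ht : TransOn n E) (hS : ReflSymm S) (hSt : TransOn n S)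
    (hle : ∀ u v, u < n → v < n → S u v → E u v) {R : ℕ} (hR : distRel n E S ≤ R) {g : ℕ}
    (hg : g ∈ leaders n E) :
    ∃ c < (R + 1) ^ R, ∀ u v, u < n → v < n → E g u → E g v →
      (digArr (R + 1) c (rankIn E u) = digArr (R + 1) c (rankIn E v) ↔ S u v) := by
  classical
  simp only [leaders, Finset.mem_filter, Finset.mem_range] at hg
  obtain ⟨hgn, hg0⟩ := hg
  -- An unsplit cluster may be arbitrarily large, but the string of zeros codes it. Only a split
  -- cluster has all its ranks within `0, …, R`.
  by_cases hall : ∀ u v, u < n → v < n → E g u → E g v → S u v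
  · exact ⟨0, pow_pos (by omega) _, fun u v hu hv h1 h2 => by
      simp [digArr_zero, hall u v hu hv h1 h2]⟩
  push Not at hall
  obtain ⟨a, b, ha, hb, hga, hgb, hab⟩ := hall
  have hrank : ∀ w < n, E g w → rankIn E w ≤ R := fun w hw hgw =>
    (rankIn_le_of_split hE ht hS hSt ha hb hw (ht ha hgn hb (hE.symm hga) hgb)
      (ht ha hgn hw (hE.symm hga) hgw) hab).trans hR
  choose! m hm1 hm2 hm3 using fun u (hu : u < n) => exists_leader hS hSt hu
  have hml : ∀ u < n, m u < n := fun u hu => lt_of_le_of_lt (hm3 u hu) hu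
  have hmg : ∀ u < n, E g u → E g (m u) := fun u hu h =>
    ht hgn hu (hml u hu) h (hE.symm (hle _ _ (hml u hu) hu (hm2 u hu)))
  have hmS : ∀ u v, u < n → v < n → (m u = m v ↔ S u v) := by
    intro u v hu hv
    constructor
    · intro h
      exact hSt hu (hml u hu) hv (hS.symm (hm2 u hu)) (h ▸ hm2 v hv)
    · intro h
      refine leader_unique hS hSt (hm1 u hu) (hm1 v hv) ?_
      exact hSt (hml u hu) hv (hml v hv) (hSt (hml u hu) hu hv (hm2 u hu) h) (hS.symm (hm2 v hv))
  -- The part containing `w` is named by the rank of its first vertex `m w` within the whole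
  -- cluster. Rank `0` belongs to `g`, which heads its own part; hence `σ 0 = 0`, in accordance with
  -- cell `0` of `digArr`, and only `R` digits are needed.
  let σ : ℕ → ℕ := fun i => if h : ∃ w < n, E g w ∧ rankIn E w = i then rankIn E (m h.choose) else 0
  have hσ : ∀ w < n, E g w → σ (rankIn E w) = rankIn E (m w) := by
    intro w hw hgw
    have hex : ∃ w' < n, E g w' ∧ rankIn E w' = rankIn E w := ⟨w, hw, hgw, rfl⟩
    simp only [σ, dif_pos hex]
    obtain ⟨h1, h2, h3⟩ := hex.choose_spec
    rw [rankIn_inj hE ht h1 hw (ht h1 hgn hw (hE.symm h2) hgw) h3]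
  have hσ0 : σ 0 = 0 := by
    have h := hσ g hgn (hE.refl g)
    rw [hg0] at h
    rw [h]
    have h1 := hm3 g hgn
    rcases lt_or_eq_of_le h1 with h2 | h2
    · have := rankIn_lt ht hgn h2 (hle _ _ (hml g hgn) hgn (hm2 g hgn))
      omega
    · rw [h2, hg0]
  have hσR : ∀ i, σ i < R + 1 := by
    intro i
    simp only [σ]
    split_ifs with h
    · obtain ⟨h1, h2, -⟩ := h.choose_spec
      have := hrank _ (hml _ h1) (hmg _ h1 h2)
      omega
    · omega
  obtain ⟨c, hc, hdig⟩ := exists_digArr (b := R + 1) (by omega) R (fun i => σ (i + 1))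
    fun i _ => hσR _
  have hdσ : ∀ i ≤ R, digArr (R + 1) c i = σ i := by
    intro i hi
    rcases i with _ | i
    · simp [digArr, hσ0]
    · exact hdig i (by omega)
  refine ⟨c, hc, fun u v hu hv hgu hgv => ?_⟩
  rw [hdσ _ (hrank u hu hgu), hdσ _ (hrank v hv hgv), hσ u hu hgu, hσ v hv hgv, ← hmS u v hu hv]
  refine ⟨fun h => rankIn_inj hE ht (hml u hu) (hml v hv) ?_ h, fun h => by rw [h]⟩
  exact ht (hml u hu) hgn (hml v hv) (hE.symm (hmg u hu hgu)) (hmg v hv hgv)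

/-- Splittings of a cluster graph are described by one string for each cluster. -/
theorem exists_split_iff (hE : ReflSymm E) (ht : TransOn n E) (Wk Wc : ℕ → ℕ → ℕ) (R thr : ℕ) :
    (∃ c : ℕ → ℕ, (∀ g, c g < (R + 1) ^ R) ∧
      ∑ g ∈ leaders n E, cutAt n E (digArr (R + 1) (c g)) g ≤ R ∧
      weightOff n Wc E + ∑ g ∈ leaders n E, weightAt n Wk Wc E (digArr (R + 1) (c g)) g ≤ thr) ↔
    ∃ S, ReflSymm S ∧ TransOn n S ∧ (∀ u v, u < n → v < n → S u v → E u v) ∧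
      distRel n E S ≤ R ∧ weight n Wk Wc S ≤ thr := by
  classical
  choose! lead hl1 hl2 hl3 using fun u (hu : u < n) => exists_leader hE ht hu
  have hlt : ∀ g ∈ leaders n E, g < n := fun g hg => by
    simp only [leaders, Finset.mem_filter, Finset.mem_range] at hg; exact hg.1
  have huniq : ∀ g ∈ leaders n E, ∀ u < n, E g u → lead u = g := fun g hg u hu h =>
    leader_unique hE ht (hl1 u hu) hg
      (ht (hlt _ (hl1 u hu)) hu (hlt g hg) (hl2 u hu) (hE.symm h))
  have hl : ∀ u < n, lead u ∈ leaders n E ∧ E (lead u) u := fun u hu => ⟨hl1 u hu, hl2 u hu⟩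
  constructor
  · rintro ⟨c, -, hcut, hw⟩
    -- The disjunct `u = v` makes the relation reflexive on all of `ℕ`, as `ReflSymm` requires.
    let S : ℕ → ℕ → Prop := fun u v => u = v ∨ (u < n ∧ v < n ∧ E u v ∧
      digArr (R + 1) (c (lead u)) (rankIn E u) = digArr (R + 1) (c (lead u)) (rankIn E v))
    have hlead : ∀ u v, u < n → v < n → E u v → lead u = lead v := fun u v hu hv h =>
      (huniq _ (hl1 u hu) v hv (ht (hlt _ (hl1 u hu)) hu hv (hl2 u hu) h)).symm
    have hle : ∀ u v, u < n → v < n → S u v → E u v := by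
      rintro u v - - (rfl | ⟨-, -, h, -⟩)
      · exact hE.refl u
      · exact h
    have hSσ : ∀ p ∈ pairs n, E p.1 p.2 → (S p.1 p.2 ↔ digArr (R + 1) (c (lead p.1))
        (rankIn E p.1) = digArr (R + 1) (c (lead p.1)) (rankIn E p.2)) := by
      intro p hp h
      obtain ⟨h1, h2⟩ := mem_pairs.1 hp
      exact ⟨fun h' => (h'.resolve_left (by omega)).2.2.2,
        fun h' => Or.inr ⟨by omega, h2, h, h'⟩⟩
    refine ⟨S, ⟨fun u => Or.inl rfl, ?_⟩, ?_, hle, ?_, ?_⟩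
    · rintro u v (rfl | ⟨hu, hv, h1, h2⟩)
      · exact Or.inl rfl
      · exact Or.inr ⟨hv, hu, hE.symm h1, by rw [← hlead u v hu hv h1]; exact h2.symm⟩
    · rintro u v w - - - (rfl | ⟨hu, hv, h1, h2⟩)
      · exact id
      · rintro (rfl | ⟨-, hw, h3, h4⟩)
        · exact Or.inr ⟨hu, hv, h1, h2⟩
        · rw [← hlead u v hu hv h1] at h4
          exact Or.inr ⟨hu, hw, ht hu hv hw h1 h3, h2.trans h4⟩
    · refine le_trans (le_of_eq ?_) hcut
      simp only [cutAt]
      rw [distRel_of_le hle, sum_leaders hE ht hl fun g p => if digArr (R + 1) (c g)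
        (rankIn E p.1) = digArr (R + 1) (c g) (rankIn E p.2) then 0 else 1]
      refine Finset.sum_congr rfl fun p hp => ?_
      by_cases h3 : E p.1 p.2
      · simp only [h3, if_true, hSσ p hp h3]
      · simp only [h3, if_false]
    · refine le_trans (le_of_eq ?_) hw
      simp only [weightAt]
      rw [weight_of_le hle, sum_leaders hE ht hl fun g p => if digArr (R + 1) (c g)
        (rankIn E p.1) = digArr (R + 1) (c g) (rankIn E p.2) then Wk p.1 p.2 else Wc p.1 p.2]
      congr 1
      refine Finset.sum_congr rfl fun p hp => ?_
      by_cases h3 : E p.1 p.2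
      · simp only [h3, if_true, hSσ p hp h3]
      · simp only [h3, if_false]
  · rintro ⟨S, hS, hSt, hle, hR, hw⟩
    choose! c hc hcode using fun g (hg : g ∈ leaders n E) => exists_code hE ht hS hSt hle hR hg
    have key : ∀ p ∈ pairs n, E p.1 p.2 → (digArr (R + 1) (c (lead p.1)) (rankIn E p.1) =
        digArr (R + 1) (c (lead p.1)) (rankIn E p.2) ↔ S p.1 p.2) := by
      intro p hp h
      obtain ⟨h1, h2⟩ := mem_pairs.1 hp
      have h3 : p.1 < n := by omega
      exact hcode _ (hl1 _ h3) _ _ h3 h2 (hl2 _ h3) (ht (hlt _ (hl1 _ h3)) h3 h2 (hl2 _ h3) h)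
    -- The size bound is required of every number, so codes of non-leaders are set to `0`.
    let c' : ℕ → ℕ := fun g => if g ∈ leaders n E then c g else 0
    have hc' : ∀ g ∈ leaders n E, c' g = c g := fun g hg => if_pos hg
    refine ⟨c', fun g => ?_, le_trans (le_of_eq ?_) hR, le_trans (le_of_eq ?_) hw⟩
    · simp only [c']
      split_ifs with h
      · exact hc g h
      · exact pow_pos (by omega) _
    · rw [Finset.sum_congr rfl fun g hg => by rw [hc' g hg]]
      simp only [cutAt]
      rw [distRel_of_le hle, sum_leaders hE ht hl fun g p => if digArr (R + 1) (c g)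
        (rankIn E p.1) = digArr (R + 1) (c g) (rankIn E p.2) then 0 else 1]
      refine Finset.sum_congr rfl fun p hp => ?_
      by_cases h3 : E p.1 p.2
      · simp only [h3, if_true, key p hp h3]
      · simp only [h3, if_false]
    · rw [Finset.sum_congr rfl fun g hg => by rw [hc' g hg]]
      simp only [weightAt]
      rw [weight_of_le hle, sum_leaders hE ht hl fun g p => if digArr (R + 1) (c g)
        (rankIn E p.1) = digArr (R + 1) (c g) (rankIn E p.2) then Wk p.1 p.2 else Wc p.1 p.2]
      congr 1
      refine Finset.sum_congr rfl fun p hp => ?_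
      by_cases h3 : E p.1 p.2
      · simp only [h3, if_true, key p hp h3]
      · simp only [h3, if_false]

theorem distRel_triangle (n : ℕ) (E F S : ℕ → ℕ → Prop) :
    distRel n E S ≤ distRel n E F + distRel n F S := by
  classical
  refine le_trans (Finset.card_le_card ?_) (Finset.card_union_le _ _)
  intro p hp
  simp only [Finset.mem_filter, Finset.mem_union] at hp ⊢
  tauto

/-- Resolving induced paths and splitting clusters finds a cluster graph of small weight close to
`E`, if there is one. -/
theorem exists_cluster_iff (hE : ReflSymm E) (Wk Wc : ℕ → ℕ → ℕ) (K thr : ℕ)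
    (hmono : ∀ u v, u < v → v < n → ¬ E u v → Wc u v ≤ Wk u v) :
    (∃ L ≤ K, ∃ c < 3 ^ L, ∃ H, H = resolveSeq n E (fun i => digArr 3 c (i + 1)) L ∧
      TransOn n H ∧ ∃ S, ReflSymm S ∧ TransOn n S ∧ (∀ u v, u < n → v < n → S u v → H u v) ∧
        distRel n H S ≤ K - L ∧ weight n Wk Wc S ≤ thr) ↔
    ∃ S, ReflSymm S ∧ TransOn n S ∧ distRel n E S ≤ K ∧ weight n Wk Wc S ≤ thr := by
  classical
  constructor
  · rintro ⟨L, hL, c, -, H, rfl, -, S, hS, hSt, -, hd, hw⟩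
    have := distRel_resolveSeq_le (n := n) (E := E) (fun i => digArr 3 c (i + 1)) L
    exact ⟨S, hS, hSt, (distRel_triangle n _ _ _).trans ((Nat.add_le_add this hd).trans (by omega)), hw⟩
  · rintro ⟨S, hS, hSt, hd, hw⟩
    obtain ⟨f, hf, L, hL, hT, hb⟩ := exists_resolveSeq hE hS hSt
    obtain ⟨c, hc, hdig⟩ := exists_digArr (b := 3) (by omega) L f fun i _ => hf i
    have hH := hE.resolveSeq (n := n) f L
    -- The intersection of `S` with the resolved cluster graph is an equivalence relation that
    -- refines the latter and differs from it on no more pairs than `S` does.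
    refine ⟨L, by omega, c, hc, resolveSeq n E f L, resolveSeq_congr fun i hi => (hdig i hi).symm,
      hT, fun u v => S u v ∧ resolveSeq n E f L u v, ⟨fun u => ⟨hS.refl u, hH.refl u⟩,
        fun h => ⟨hS.symm h.1, hH.symm h.2⟩⟩,
      fun u v w hu hv hw h1 h2 => ⟨hSt hu hv hw h1.1 h2.1, hT hu hv hw h1.2 h2.2⟩,
      fun u v _ _ h => h.2, ?_, ?_⟩
    · refine le_trans (Finset.card_le_card fun p hp => ?_)
        (show distRel n (resolveSeq n E f L) S ≤ K - L by omega)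
      simp only [Finset.mem_filter] at hp ⊢
      tauto
    · refine le_trans (Finset.sum_le_sum fun p hp => ?_) hw
      obtain ⟨h1, h2⟩ := mem_pairs.1 hp
      by_cases h3 : S p.1 p.2
      · by_cases h4 : resolveSeq n E f L p.1 p.2
        · simp [h3, h4]
        · simp only [h3, h4, and_false, if_false, if_true]
          -- A pair of `S` that is lost in the intersection differs between `S` and the resolved
          -- graph. The latter thus agrees with `E` there, so the pair is not in `E`, and cutting it
          -- is no dearer than keeping it.
          refine hmono _ _ h1 h2 fun h5 => ?_
          rcases hb p.1 p.2 with h | h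
          · exact h4 (h.2 h5)
          · exact h4 (h.2 h3)
      · simp [h3]

end

/-! ### The common program for edge distances: branching -/

/-- Register `15` becomes `lastP3` of the matrix in array `5`. -/
def findP3 : Prog :=
  .seq (.assign 15 0) <| forLoop 16 7 <| .when
    (.less (.read 5 (.reg 16 / .reg 6 * .reg 0 + .reg 16 % .reg 0))
      (.read 5 (.reg 16 / .reg 0) * .read 5 (.reg 16 % .reg 6)))
    (.assign 15 (.reg 16 + 1))

/-- Flip the pair in registers `17` and `18`. -/
def flipPair : Prog :=
  .seq (.write 5 (.reg 17 * .reg 0 + .reg 18) (1 - .read 5 (.reg 17 * .reg 0 + .reg 18)))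
    (.write 5 (.reg 18 * .reg 0 + .reg 17) (1 - .read 5 (.reg 18 * .reg 0 + .reg 17)))

/-- Flip a pair of the induced path found by `findP3`, as told by cell `reg 14 + 1` of array `6`. -/
def resolveProg : Prog :=
  .when (.reg 15) <|
    .seq (.ite (.equal (.read 6 (.reg 14 + 1)) 2) (.assign 17 ((.reg 15 - 1) / .reg 0 % .reg 0))
      (.assign 17 ((.reg 15 - 1) / .reg 6))) <|
    .seq (.ite (.equal (.read 6 (.reg 14 + 1)) 1) (.assign 18 ((.reg 15 - 1) / .reg 0 % .reg 0))
      (.assign 18 ((.reg 15 - 1) % .reg 0))) <|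
    flipPair

/-- Copy the matrix in array `2` to array `5` and resolve `reg 9` induced paths. -/
def branchProg : Prog :=
  .seq (forLoop 16 6 (.write 5 (.reg 16) (.read 2 (.reg 16)))) <|
    .seq findP3 (forLoop 14 9 (.seq resolveProg findP3))

/-- Registers `0`, `6`, `7` hold `n`, `n²`, `n³`. -/
structure HasSize (n : ℕ) (s : Store) : Prop where
  r0 : s.reg 0 = n
  r6 : s.reg 6 = n * n
  r7 : s.reg 7 = n * n * n

theorem HasSize.agree {n : ℕ} {s s' : Store} (h : HasSize n s) {p : Prog} (ha : Agree p s s')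
    (hp : ∀ x ∈ [0, 6, 7], p.writesReg x = false) : HasSize n s' :=
  ⟨(ha.reg 0 (hp 0 (by simp))).trans h.r0, (ha.reg 6 (hp 6 (by simp))).trans h.r6,
    (ha.reg 7 (hp 7 (by simp))).trans h.r7⟩

theorem sq_le_cube (n : ℕ) : n * n ≤ n * n * n := by
  rcases Nat.eq_zero_or_pos n with rfl | h
  · simp
  · exact Nat.le_mul_of_pos_right _ h

theorem le_sq (n : ℕ) : n ≤ n * n := by
  rcases Nat.eq_zero_or_pos n with rfl | h
  · simp
  · exact Nat.le_mul_of_pos_right _ h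

/-- With `i = (u * n + v) * n + w`, the numbers `i / n` and `i % (n * n)` are already the matrix
cells of `u, v` and `v, w`. On 0-1 matrices the inequality "entry of `u, w` below the product of the
other two" holds exactly for induced paths. -/
theorem Tri.findP3 {B n : ℕ} {s : Store} {E : ℕ → ℕ → Prop} (hs : HasSize n s)
    (hm : IsMatrix n (s.arr 5) (ind E)) (hB : n * n * n ≤ B) :
    Tri B findP3 s (n * n * n * 40 + 10) fun s' => s'.reg 15 = lastP3 n E (n * n * n) := by
  refine Tri.mono (Tri.seq (Tri.assign (by simp) fun _ => Tri.forLoop (T := 32) (N := n * n * n)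
    (fun i s' => s'.reg 15 = lastP3 n E i) rfl rfl (by decide) (by simp [hs.r7]) hB
    (by simp [lastP3]) ?_)) (by simp; omega) fun _ _ h => h.2
  intro i s' hi hx hy hag hinv
  obtain ⟨h1, h2, h3, h4, h5⟩ := triple_lt hi
  have hn : 0 < n := by omega
  have r0 : s'.reg 0 = n := by rw [hag.reg 0 rfl]; simp [hs.r0]
  have r6 : s'.reg 6 = n * n := by rw [hag.reg 6 rfl]; simp [hs.r6]
  have hm : IsMatrix n (s'.arr 5) (ind E) := by rw [hag.arr 5 rfl]; exact hm
  have e1 : s'.arr 5 (i / (n * n) * n + i % n) = ind E (i / (n * n)) (i % n) := hm.cell h1 h3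
  have e2 : s'.arr 5 (i / n) = ind E (i / (n * n)) (i / n % n) := by
    rw [hm _ h4, Nat.div_div_eq_div_mul]
  have e3 : s'.arr 5 (i % (n * n)) = ind E (i / n % n) (i % n) := by
    rw [hm _ h5, Nat.mod_mul_left_div_self, Nat.mod_mul_right_mod]
  have hcond : ind E (i / (n * n)) (i % n) < ind E (i / (n * n)) (i / n % n) *
      ind E (i / n % n) (i % n) ↔ IsP3 n E i := by
    unfold IsP3 ind
    split_ifs <;> simp_all
  refine Tri.loopFree (by simp [Prog.maxCost]) ?_ ?_
  · simp only [Prog.Ok, Expr.eval_less, Expr.eval_read, Expr.eval_add, Expr.eval_mul, Expr.eval_div,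
      Expr.eval_mod, Expr.eval_reg, Expr.eval_one, hx, r0, r6, e1, e2, e3]
    split_ifs
    · omega
    · trivial
  · simp only [Prog.exec, Expr.eval_less, Expr.eval_read, Expr.eval_add, Expr.eval_mul,
      Expr.eval_div, Expr.eval_mod, Expr.eval_reg, Expr.eval_one, hx, r0, r6, e1, e2, e3]
    by_cases h : IsP3 n E i
    · simp [h, hcond.2 h, lastP3]
    · simp only [h, lastP3, mt hcond.1 h, if_false, hinv, ne_eq, not_true_eq_false, Store.setReg_reg, Nat.reduceEqDiff]

/-- Flipping a single ordered cell; `toggle` arises from two such flips, the intermediate relation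
being asymmetric. -/
theorem IsMatrix.update {n : ℕ} {h : ℕ → ℕ} {E : ℕ → ℕ → Prop} (hm : IsMatrix n h (ind E))
    {x y : ℕ} (hy : y < n) {F : ℕ → ℕ → Prop}
    (hF : ∀ u v, F u v ↔ (u = x ∧ v = y ∧ ¬ E u v) ∨ (¬ (u = x ∧ v = y) ∧ E u v)) :
    IsMatrix n (Function.update h (x * n + y) (1 - ind E x y)) (ind F) := by
  classical
  intro p hp
  by_cases hpe : p = x * n + y
  · subst hpe
    rw [Function.update_self, cell_div hy, cell_mod hy]
    unfold ind
    simp only [hF]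
    split_ifs <;> simp_all
  · rw [Function.update_of_ne hpe, hm p hp]
    have : ¬ (p / n = x ∧ p % n = y) := fun h => hpe (by
      rw [← h.1, ← h.2]; exact (Nat.div_add_mod' p n).symm)
    unfold ind
    simp only [hF]
    split_ifs <;> tauto

theorem Tri.flipPair {B n x y : ℕ} {s : Store} {E : ℕ → ℕ → Prop} (hs : HasSize n s)
    (hm : IsMatrix n (s.arr 5) (ind E)) (hB : n * n * n ≤ B) (hx : x < n) (hy : y < n)
    (hxy : x ≠ y) (h17 : s.reg 17 = x) (h18 : s.reg 18 = y) :
    Tri B flipPair s 30 fun s' => IsMatrix n (s'.arr 5) (ind (toggle E x y)) := by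
  have c1 := cell_lt hx hy
  have c2 := cell_lt hy hx
  have hn2 := sq_le_cube n
  have hn1 := le_sq n
  have hne : y * n + x ≠ x * n + y := fun h => hxy (by
    rw [← cell_mod (n := n) (u := y) hx, h, cell_mod hy])
  refine Tri.loopFree (by simp [DynCluster.flipPair, Prog.maxCost]) ?_ ?_
  · simp only [DynCluster.flipPair, Prog.Ok, Prog.exec, Expr.eval_add, Expr.eval_mul,
      Expr.eval_reg, h17, h18, hs.r0, Expr.eval_sub, Expr.eval_one, Expr.eval_read,
      Store.setArr_reg]
    omega
  · simp only [DynCluster.flipPair, Prog.exec, Expr.eval_add, Expr.eval_mul, Expr.eval_reg, h17,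
      h18, hs.r0, Expr.eval_sub, Expr.eval_one, Expr.eval_read, Store.setArr_reg,
      Store.setArr_arr, if_true, Function.update_of_ne hne, hm.cell hx hy, hm.cell hy hx]
    have step := hm.update (x := x) hy (F := fun u v =>
      (u = x ∧ v = y ∧ ¬ E u v) ∨ (¬ (u = x ∧ v = y) ∧ E u v)) fun _ _ => Iff.rfl
    have hval : ind E y x = ind (fun u v =>
        (u = x ∧ v = y ∧ ¬ E u v) ∨ (¬ (u = x ∧ v = y) ∧ E u v)) y x := by
      have hne' : ¬ y = x := fun h => hxy h.symm
      unfold ind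
      by_cases h : E y x <;> simp [hne', h]
    rw [hval]
    refine step.update hx fun u v => ?_
    unfold toggle
    by_cases h1 : u = x ∧ v = y
    · obtain ⟨rfl, rfl⟩ := h1
      have : ¬ (u = v ∧ v = u) := fun h => hxy h.1
      tauto
    · tauto

theorem Tri.resolveProg {B n : ℕ} {s : Store} {E : ℕ → ℕ → Prop} (hs : HasSize n s)
    (hE : ReflSymm E) (hm : IsMatrix n (s.arr 5) (ind E)) (hB : n * n * n ≤ B)
    (h15 : s.reg 15 = lastP3 n E (n * n * n)) :
    Tri B resolveProg s 100 fun s' =>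
      IsMatrix n (s'.arr 5) (ind (resolve n E (s.arr 6 (s.reg 14 + 1)))) := by
  refine Tri.mono (Tri.when (T := 90) (fun h => ?_) fun h => ?_) (by simp) fun _ _ h => h
  · have h0 : lastP3 n E (n * n * n) ≠ 0 := by simpa [h15] using h
    have hlt : lastP3 n E (n * n * n) - 1 < n * n * n := by
      have := lastP3_le n E (n * n * n)
      omega
    obtain ⟨h1, h2, h3⟩ := isP3_of_lastP3_ne h0
    have hres : resolve n E (s.arr 6 (s.reg 14 + 1)) = _ := if_neg h0
    rw [hres]
    generalize lastP3 n E (n * n * n) = l at *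
    obtain ⟨a, b, c, -, -⟩ := triple_lt hlt
    set i := l - 1 with hi
    set δ := s.arr 6 (s.reg 14 + 1) with hδ
    have d12 : i / (n * n) ≠ i / n % n := fun he => h3 (he ▸ h2)
    have d23 : i / n % n ≠ i % n := fun he => h3 (he ▸ h1)
    have d13 : i / (n * n) ≠ i % n := fun he => h3 (he ▸ hE.refl _)
    have ha : (if δ = 2 then i / n % n else i / (n * n)) < n := by split_ifs <;> assumption
    have hb : (if δ = 1 then i / n % n else i % n) < n := by split_ifs <;> assumption
    have hab : (if δ = 2 then i / n % n else i / (n * n)) ≠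
        (if δ = 1 then i / n % n else i % n) := by split_ifs <;> omega
    have hn2 := sq_le_cube n
    have hn1 := le_sq n
    refine Tri.mono (T₁ := 30 + (30 + 30)) (Q := fun s' => IsMatrix n (s'.arr 5) (ind (toggle E
        (if δ = 2 then i / n % n else i / (n * n)) (if δ = 1 then i / n % n else i % n))))
        (Tri.seq (Q := _) (Tri.mono (Q := fun s' => s'.reg 17 =
        (if δ = 2 then i / n % n else i / (n * n))) (Tri.straight (p := .ite _ _ _) ?_ ?_)
        (by simp [Prog.maxCost]) fun s₁ hag h17 hag' => ?_)) (by omega) fun _ _ h => h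
    · simp only [Prog.Ok, Expr.eval_equal, Expr.eval_read, Expr.eval_add, Expr.eval_reg,
        Expr.eval_one, Expr.eval_two, Expr.eval_div, Expr.eval_sub, Expr.eval_mod, h15, hs.r0,
        hs.r6, ← hi, ← hδ]
      by_cases h : δ = 2 <;> simp only [h, if_true, if_false, ne_eq, one_ne_zero, not_true_eq_false,
        not_false_eq_true] <;> omega
    · simp only [Prog.exec, Expr.eval_equal, Expr.eval_read, Expr.eval_add, Expr.eval_reg,
        Expr.eval_one, Expr.eval_two, Expr.eval_div, Expr.eval_sub, Expr.eval_mod, h15, hs.r0,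
        hs.r6, ← hi, ← hδ]
      by_cases h : δ = 2 <;> simp [h]
    · generalize (if δ = 2 then i / n % n else i / (n * n)) = x at *
      have hs₁ : HasSize n s₁ := hs.agree hag (by decide)
      have h15₁ : s₁.reg 15 = l := (hag.reg 15 rfl).trans h15
      have hδ₁ : s₁.arr 6 (s₁.reg 14 + 1) = δ := by rw [hag.reg 14 rfl, hag.arr 6 rfl]
      have hm₁ : IsMatrix n (s₁.arr 5) (ind E) := by rw [hag.arr 5 rfl]; exact hm
      refine Tri.seq (Q := _) (Tri.mono (Q := fun s' => s'.reg 18 =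
        (if δ = 1 then i / n % n else i % n)) (Tri.straight (p := .ite _ _ _) ?_ ?_)
        (by simp [Prog.maxCost]) fun s₂ hag₂ h18 hag' => ?_)
      · simp only [Prog.Ok, Expr.eval_equal, Expr.eval_read, Expr.eval_add, Expr.eval_reg,
          Expr.eval_one, Expr.eval_div, Expr.eval_sub, Expr.eval_mod, h15₁, hs₁.r0, ← hi, hδ₁]
        by_cases h : δ = 1 <;> simp only [h, if_true, if_false, ne_eq, one_ne_zero,
          not_true_eq_false, not_false_eq_true] <;> omega
      · simp only [Prog.exec, Expr.eval_equal, Expr.eval_read, Expr.eval_add, Expr.eval_reg,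
          Expr.eval_one, Expr.eval_div, Expr.eval_sub, Expr.eval_mod, h15₁, hs₁.r0, ← hi, hδ₁]
        by_cases h : δ = 1 <;> simp [h]
      · generalize (if δ = 1 then i / n % n else i % n) = y at *
        have hs₂ : HasSize n s₂ := hs₁.agree hag₂ (by decide)
        have h17₂ : s₂.reg 17 = x := (hag₂.reg 17 rfl).trans h17
        have hm₂ : IsMatrix n (s₂.arr 5) (ind E) := by rw [hag₂.arr 5 rfl]; exact hm₁
        exact Tri.flipPair hs₂ hm₂ hB ha hb hab h17₂ h18
  · have h0 : lastP3 n E (n * n * n) = 0 := by simpa [h15] using h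
    rw [resolve, if_pos h0]
    exact hm

/-- The search for an induced path is repeated after each flip, so register `15` finally tells
whether the resulting relation is transitive. -/
theorem Tri.branchProg {B n L : ℕ} {s : Store} {E : ℕ → ℕ → Prop} (hs : HasSize n s)
    (hE : ReflSymm E) (hm : IsMatrix n (s.arr 2) (ind E)) (hB : n * n * n ≤ B)
    (h9 : s.reg 9 = L) (hL : L ≤ B) :
    Tri B branchProg s ((n * n * n + 3) * (L + 2) * 150) fun s' =>
      IsMatrix n (s'.arr 5) (ind (resolveSeq n E (fun i => s.arr 6 (i + 1)) L)) ∧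
      s'.reg 15 = lastP3 n (resolveSeq n E (fun i => s.arr 6 (i + 1)) L) (n * n * n) := by
  have hn2 := sq_le_cube n
  have hn1 := le_sq n
  have hcopy : Tri B (DynCluster.forLoop 16 6 (.write 5 (.reg 16) (.read 2 (.reg 16)))) s
      (n * n * n * 12 + 6) fun s' => IsMatrix n (s'.arr 5) (ind E) := by
    refine (Tri.forLoop (T := 4) (N := n * n) (fun i s' => ∀ p < i, s'.arr 5 p = s.arr 2 p) rfl rfl
      (by decide) hs.r6 (by omega) (by simp) ?_).mono (by omega) fun s' _ h p hp =>
        (h.2 p hp).trans (hm p hp)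
    intro i s' hi hx hy hag hinv
    have h2 : s'.arr 2 = s.arr 2 := hag.arr 2 rfl
    refine Tri.loopFree (by simp [Prog.maxCost]) ?_ ?_
    · simp only [Prog.Ok, Expr.eval_reg, Expr.eval_read, hx, h2, hm i hi]
      have := ind_le E (i / n) (i % n)
      omega
    · simp only [Prog.exec, Expr.eval_reg, Expr.eval_read, hx, h2, Store.setReg_arr,
        Store.setArr_arr, if_true]
      intro p hp
      by_cases hpi : p = i
      · simp [hpi]
      · rw [Function.update_of_ne hpi]; exact hinv p (by omega)
  refine Tri.mono (Tri.seq (hcopy.mono le_rfl fun s₁ hag₁ hm₁ _ => Tri.seq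
    ((Tri.findP3 (hs.agree hag₁ (by decide)) hm₁ hB).mono le_rfl fun s₂ hag₂ h15 _ => ?_))
    (T₂ := n * n * n * 40 + 10 + (L * (n * n * n * 40 + 120) + 6))) ?_ fun _ _ h => h
  · have hs₂ : HasSize n s₂ := (hs.agree hag₁ (by decide)).agree hag₂ (by decide)
    have h9₂ : s₂.reg 9 = L := by rw [hag₂.reg 9 rfl, hag₁.reg 9 rfl, h9]
    have hm₂ : IsMatrix n (s₂.arr 5) (ind E) := by rw [hag₂.arr 5 rfl]; exact hm₁
    have h6₂ : s₂.arr 6 = s.arr 6 := by rw [hag₂.arr 6 rfl, hag₁.arr 6 rfl]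
    refine (Tri.forLoop (T := n * n * n * 40 + 112) (fun j s' =>
      IsMatrix n (s'.arr 5) (ind (resolveSeq n E (fun i => s.arr 6 (i + 1)) j)) ∧
      s'.reg 15 = lastP3 n (resolveSeq n E (fun i => s.arr 6 (i + 1)) j) (n * n * n)) rfl rfl
      (by decide) h9₂ hL ⟨hm₂, by simpa [resolveSeq] using h15⟩ ?_).mono le_rfl fun s' _ h => h.2
    intro j s₃ hj hx hy hag₃ ⟨hm₃, h15₃⟩
    have hs₃ := hs₂.agree hag₃ (by decide)
    have h6₃ : s₃.arr 6 = s.arr 6 := by rw [hag₃.arr 6 rfl, h6₂]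
    refine Tri.mono (Tri.seq ((Tri.resolveProg hs₃ (hE.resolveSeq _ _) hm₃ hB h15₃).mono le_rfl
      fun s₄ hag₄ hm₄ _ => (Tri.findP3 (hs₃.agree hag₄ (by decide)) hm₄ hB).mono le_rfl
      fun s₅ hag₅ h15₅ => ?_)) (by omega) fun _ _ h => h
    have hdef : resolveSeq n E (fun i => s.arr 6 (i + 1)) (j + 1) =
        resolve n (resolveSeq n E (fun i => s.arr 6 (i + 1)) j) (s₃.arr 6 (s₃.reg 14 + 1)) := by
      rw [h6₃, hx]; rfl
    rw [hdef]
    refine ⟨?_, h15₅⟩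
    simp only [Store.setReg_arr]
    rw [hag₅.arr 5 rfl]
    exact hm₄
  · nlinarith [Nat.zero_le (n * n * n), Nat.zero_le L, Nat.zero_le (n * n * n * L)]

/-! ### The common program for edge distances: splitting clusters -/

/-- Cell `v < n` of array `a` becomes the number of `u < v` with condition `c`, where `c` reads the
pair `u, v` from register `27`. -/
def rankProg (a : ℕ) (c : Expr) : Prog :=
  .seq (forLoop 27 0 (.write a (.reg 27) 0)) <| forLoop 27 6 <|
    .when (.less (.reg 27 / .reg 0) (.reg 27 % .reg 0)) <| .when c <|
      .write a (.reg 27 % .reg 0) (.read a (.reg 27 % .reg 0) + 1)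

theorem rankIn_eq_sum {n v : ℕ} (E : ℕ → ℕ → Prop) (hv : v < n) [DecidableRel E] :
    rankIn E v = ∑ q ∈ pairs n, if q.2 = v ∧ E q.1 q.2 then 1 else 0 := by
  classical
  rw [rankIn, ← Finset.card_filter]
  refine Finset.card_nbij' (fun u => (u, v)) (fun q => q.1) ?_ ?_ ?_ ?_
  · intro u hu
    simp only [Finset.coe_filter, Finset.mem_range, Set.mem_ofPred_eq, mem_pairs] at hu ⊢
    exact ⟨⟨hu.1, hv⟩, trivial, hu.2⟩
  · rintro ⟨u, w⟩ hq
    simp only [Finset.coe_filter, Finset.mem_range, Set.mem_ofPred_eq, mem_pairs] at hq ⊢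
    obtain ⟨⟨h1, h2⟩, rfl, h3⟩ := hq
    exact ⟨h1, h3⟩
  · intro u _
    rfl
  · rintro ⟨u, w⟩ hq
    simp only [Finset.coe_filter, Set.mem_ofPred_eq] at hq
    rw [← hq.2.1]

/-- The test `c` is evaluated while array `a` is being filled; hence its meaning is required in all
memories that agree with `s` outside what the program writes. -/
theorem Tri.rankProg {B n a : ℕ} {c : Expr} {s : Store} {E : ℕ → ℕ → Prop} (hs : HasSize n s)
    (hB : n * n * n ≤ B)
    (hc : ∀ s', Agree (rankProg a c) s s' → ∀ i < n * n, s'.reg 27 = i →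
      (c.eval s' ≠ 0 ↔ E (i / n) (i % n))) :
    Tri B (rankProg a c) s ((n * n + 1) * (c.cost + 60)) fun s' =>
      ∀ v < n, s'.arr a v = rankIn E v := by
  classical
  have hn2 := sq_le_cube n
  have hn1 := le_sq n
  have hclear : Tri B (DynCluster.forLoop 27 0 (.write a (.reg 27) 0)) s (n * 11 + 6) fun s' =>
      ∀ v < n, s'.arr a v = 0 := by
    refine (Tri.forLoop (T := 3) (N := n) (fun i s' => ∀ p < i, s'.arr a p = 0) rfl rfl
      (by decide) hs.r0 (by omega) (by simp) ?_).mono (by omega) fun s' _ h => h.2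
    intro i s' hi hx hy hag hinv
    refine Tri.loopFree (by simp [Prog.maxCost]) ?_ ?_
    · simp only [Prog.Ok, Expr.eval_reg, Expr.eval_zero, hx]
      omega
    · simp only [Prog.exec, Expr.eval_reg, Expr.eval_zero, hx, Store.setReg_arr,
        Store.setArr_arr, if_true]
      intro p hp
      by_cases hpi : p = i
      · simp [hpi]
      · rw [Function.update_of_ne hpi]; exact hinv p (by omega)
  refine Tri.mono (Tri.seq (hclear.mono le_rfl fun s₁ hag₁ h0 _ =>
    (Tri.forLoop (T := c.cost + 30) (N := n * n) (fun i s' => ∀ v < n, s'.arr a v =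
      ∑ q ∈ Finset.range i, if q / n < q % n then (if q % n = v ∧ E (q / n) (q % n) then 1 else 0)
        else 0) rfl rfl (by decide) ((hag₁.reg 6 rfl).trans hs.r6) (by omega) (by simpa using h0) ?_).mono
      le_rfl fun s' _ h v hv => ?_)) ?_ fun _ _ h => h
  · intro i s' hi hx hy hag hinv
    have r0 : s'.reg 0 = n := by rw [hag.reg 0 rfl, hag₁.reg 0 rfl, hs.r0]
    have hci := hc s' ((hag₁.mono (fun x hx => by
        simp only [DynCluster.rankProg, Prog.writesReg, Bool.or_eq_false_iff] at hx; exact hx.1)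
      (fun x hx => by
        simp only [DynCluster.rankProg, Prog.writesArr, Bool.or_eq_false_iff] at hx
        exact hx.1)).trans (hag.mono (fun x hx => by
        simp only [DynCluster.rankProg, Prog.writesReg, Bool.or_eq_false_iff] at hx; exact hx.2)
      (fun x hx => by
        simp only [DynCluster.rankProg, Prog.writesArr, Bool.or_eq_false_iff] at hx
        exact hx.2))) i hi hx
    have hmod := mod_lt_of_lt_sq hi
    have hle : ∀ v < n, s'.arr a v ≤ i := by
      intro v hv
      rw [hinv v hv]
      refine (Finset.sum_le_card_nsmul _ _ 1 fun q _ => ?_).trans (by simp)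
      split_ifs <;> omega
    have hlei := hle _ hmod
    refine Tri.loopFree (by simp [Prog.maxCost]; omega) ?_ ?_
    · simp only [Prog.Ok, Expr.eval_less, Expr.eval_div, Expr.eval_mod, Expr.eval_reg, hx, r0,
        Expr.eval_add, Expr.eval_read, Expr.eval_one]
      split_ifs <;> first | trivial | omega
    · simp only [Prog.exec, Expr.eval_less, Expr.eval_div, Expr.eval_mod, Expr.eval_reg, hx, r0,
        Expr.eval_add, Expr.eval_read, Expr.eval_one, Store.setReg_arr]
      intro v hv
      rw [Finset.sum_range_succ, ← hinv v hv]
      by_cases h1 : i / n < i % n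
      · by_cases h2 : E (i / n) (i % n)
        · have h3 : c.eval s' ≠ 0 := hci.2 h2
          by_cases h4 : v = i % n
          · subst h4
            simp [h1, h2, h3]
          · simp [h1, h3, h4, Ne.symm h4]
        · have h3 : ¬ c.eval s' ≠ 0 := fun h => h2 (hci.1 h)
          simp only [h1, h2, h3, if_true, if_false, and_false, add_zero, ne_eq, one_ne_zero,
            not_false_eq_true]
      · simp [h1]
  · rw [h.2 v hv, sum_range_pairs n fun x y => if y = v ∧ E x y then 1 else 0,
      ← rankIn_eq_sum E hv]
  · nlinarith [Nat.zero_le c.cost]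

/-- Register `25` becomes the number of pairs cut, and register `26` the weight, when the cluster of
the vertex in register `22` is split according to array `7`. -/
def splitProg : Prog :=
  .seq (.assign 25 0) <| .seq (.assign 26 0) <| forLoop 27 6 <|
    .when (.less (.reg 27 / .reg 0) (.reg 27 % .reg 0)) <|
    .when (.read 5 (.reg 22 * .reg 0 + .reg 27 / .reg 0) *
      .read 5 (.reg 22 * .reg 0 + .reg 27 % .reg 0)) <|
    .ite (.equal (.read 7 (.read 8 (.reg 27 / .reg 0))) (.read 7 (.read 8 (.reg 27 % .reg 0))))
      (.assign 26 (.reg 26 + .read 3 (.reg 27)))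
      (.seq (.assign 25 (.reg 25 + 1)) (.assign 26 (.reg 26 + .read 4 (.reg 27))))

/-- What the leaf program needs to know about the memory. -/
structure LeafCtx (n thr : ℕ) (E : ℕ → ℕ → Prop) (Wk Wc : ℕ → ℕ → ℕ) (s : Store) : Prop
    extends HasSize n s where
  r4 : s.reg 4 = thr
  m3 : IsMatrix n (s.arr 3) Wk
  m4 : IsMatrix n (s.arr 4) Wc
  m5 : IsMatrix n (s.arr 5) (ind E)

theorem LeafCtx.agree {n thr : ℕ} {E : ℕ → ℕ → Prop} {Wk Wc : ℕ → ℕ → ℕ} {s s' : Store}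
    (h : LeafCtx n thr E Wk Wc s) {p : Prog} (ha : Agree p s s')
    (hp : ∀ x ∈ [0, 4, 6, 7], p.writesReg x = false)
    (hq : ∀ x ∈ [3, 4, 5], p.writesArr x = false) : LeafCtx n thr E Wk Wc s' where
  toHasSize := h.toHasSize.agree ha fun x hx => hp x (by simp at hx ⊢; omega)
  r4 := (ha.reg 4 (hp 4 (by simp))).trans h.r4
  m3 := by rw [ha.arr 3 (hq 3 (by simp))]; exact h.m3
  m4 := by rw [ha.arr 4 (hq 4 (by simp))]; exact h.m4
  m5 := by rw [ha.arr 5 (hq 5 (by simp))]; exact h.m5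

theorem sum_le_of_le {B W n i : ℕ} {F : ℕ → ℕ} (hF : ∀ q < n * n, F q ≤ W) (hi : i ≤ n * n)
    (hB : n * n * W ≤ B) : ∑ q ∈ Finset.range i, F q ≤ B := by
  refine le_trans (Finset.sum_le_card_nsmul _ _ W fun q hq => hF q ?_) ?_
  · have := Finset.mem_range.1 hq; omega
  · simp only [Finset.card_range, smul_eq_mul]
    exact (Nat.mul_le_mul_right _ hi).trans hB

/-- The bound `W` on the weights keeps all partial sums within `n * n * W`, hence within a word.
Nothing is assumed about the string in array `7`: the number of cut pairs is counted honestly for a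
cluster of any size. -/
theorem Tri.splitProg {B n thr g W : ℕ} {s : Store} {E : ℕ → ℕ → Prop} {Wk Wc : ℕ → ℕ → ℕ}
    (hs : LeafCtx n thr E Wk Wc s) (hB : n * n * n ≤ B) (hWB : n * n * W ≤ B)
    (hWk : ∀ u v, Wk u v ≤ W) (hWc : ∀ u v, Wc u v ≤ W)
    (h8 : ∀ v < n, s.arr 8 v = rankIn E v) (hg : s.reg 22 = g) (hgn : g < n) :
    Tri B splitProg s (n * n * 80 + 10) fun s' =>
      s'.reg 25 = cutAt n E (s.arr 7) g ∧ s'.reg 26 = weightAt n Wk Wc E (s.arr 7) g := by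
  classical
  have hn2 := sq_le_cube n
  have hn1 := le_sq n
  let F : ℕ → ℕ → ℕ := fun u v => if E g u ∧ E g v then
    if s.arr 7 (rankIn E u) = s.arr 7 (rankIn E v) then 0 else 1 else 0
  let G : ℕ → ℕ → ℕ := fun u v => if E g u ∧ E g v then
    if s.arr 7 (rankIn E u) = s.arr 7 (rankIn E v) then Wk u v else Wc u v else 0
  refine Tri.mono (Tri.seq (Tri.assign (by simp) fun hag₁ => Tri.seq (Tri.assign (by simp)
    fun hag₂ => (Tri.forLoop (T := 71) (N := n * n) (fun i s' =>
      s'.reg 25 = ∑ q ∈ Finset.range i, (if q / n < q % n then F (q / n) (q % n) else 0) ∧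
      s'.reg 26 = ∑ q ∈ Finset.range i, (if q / n < q % n then G (q / n) (q % n) else 0))
      rfl rfl (by decide) (by simp [hs.r6]) (by omega) (by simp) ?_).mono le_rfl
      fun s' _ h => ?_))) (by simp; omega) fun _ _ h => h
  · intro i s' hi hx hy hag ⟨hF, hG⟩
    have r0 : s'.reg 0 = n := by rw [hag.reg 0 rfl]; simp [hs.r0]
    have r22 : s'.reg 22 = g := by rw [hag.reg 22 rfl]; simp [hg]
    have a7 : s'.arr 7 = s.arr 7 := by rw [hag.arr 7 rfl]; simp
    have a8 : s'.arr 8 = s.arr 8 := by rw [hag.arr 8 rfl]; simp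
    have a3 : s'.arr 3 i = Wk (i / n) (i % n) := by rw [hag.arr 3 rfl]; exact hs.m3 i hi
    have a4 : s'.arr 4 i = Wc (i / n) (i % n) := by rw [hag.arr 4 rfl]; exact hs.m4 i hi
    have hu := div_lt_of_lt_sq hi
    have hv := mod_lt_of_lt_sq hi
    have e1 : s'.arr 5 (g * n + i / n) = ind E g (i / n) := by
      rw [hag.arr 5 rfl]; exact hs.m5.cell hgn hu
    have e2 : s'.arr 5 (g * n + i % n) = ind E g (i % n) := by
      rw [hag.arr 5 rfl]; exact hs.m5.cell hgn hv
    have b1 : s'.reg 25 ≤ i := by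
      rw [hF]
      refine (Finset.sum_le_card_nsmul _ _ 1 fun q _ => ?_).trans (by simp)
      simp only [F]
      split_ifs <;> omega
    have b2 : s'.reg 26 + (if i / n < i % n then G (i / n) (i % n) else 0) ≤ B := by
      rw [hG, ← Finset.sum_range_succ]
      refine sum_le_of_le (n := n) (W := W) (fun q _ => ?_) (by omega) hWB
      simp only [G]
      split_ifs <;> first | exact hWk _ _ | exact hWc _ _ | exact Nat.zero_le _
    have hmul : ind E g (i / n) * ind E g (i % n) ≠ 0 ↔ E g (i / n) ∧ E g (i % n) := by
      simp [not_or]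
    refine Tri.loopFree (by simp [Prog.maxCost]) ?_ ?_
    · simp only [Prog.Ok, Prog.exec, Expr.eval_less, Expr.eval_div, Expr.eval_mod, Expr.eval_reg,
        hx, r0, Expr.eval_add, Expr.eval_read, Expr.eval_one, Expr.eval_mul, Expr.eval_equal, r22,
        e1, e2, a7, a8, a3, a4, h8 _ hu, h8 _ hv, Store.setReg_reg, Store.setReg_arr,
        Nat.reduceEqDiff, if_false, hmul]
      by_cases h1 : i / n < i % n
      · by_cases h2 : E g (i / n) ∧ E g (i % n)
        · by_cases h3 : s.arr 7 (rankIn E (i / n)) = s.arr 7 (rankIn E (i % n))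
          · simp only [h1, h2, h3, G, if_true, ne_eq, one_ne_zero, not_false_eq_true,
              and_self] at b2 ⊢
            exact b2
          · simp only [h1, h2, h3, G, if_true, if_false, ne_eq, one_ne_zero, not_false_eq_true,
              not_true_eq_false, and_self] at b2 ⊢
            exact ⟨by omega, b2⟩
        · simp [h1, h2]
      · simp [h1]
    · simp only [Prog.exec, Expr.eval_less, Expr.eval_div, Expr.eval_mod, Expr.eval_reg,
        hx, r0, Expr.eval_add, Expr.eval_read, Expr.eval_one, Expr.eval_mul, Expr.eval_equal, r22,
        e1, e2, a7, a8, a3, a4, h8 _ hu, h8 _ hv, Store.setReg_reg, Store.setReg_arr,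
        Nat.reduceEqDiff, if_false, hmul]
      rw [Finset.sum_range_succ, Finset.sum_range_succ, ← hF, ← hG]
      by_cases h1 : i / n < i % n
      · by_cases h2 : E g (i / n) ∧ E g (i % n)
        · by_cases h3 : s.arr 7 (rankIn E (i / n)) = s.arr 7 (rankIn E (i % n))
          · simp [h1, h2, h3, F, G]
          · simp [h1, h2, h3, F, G]
        · simp [h1, h2, F, G]
      · simp [h1]
  · rw [h.2.1, h.2.2, sum_range_pairs, sum_range_pairs]
    exact ⟨rfl, rfl⟩

/-- Array `10` becomes the table of the splittings of the cluster of the vertex in register `22`: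
cell `q` is the least weight of a splitting that cuts `q` pairs. -/
def clusterProg : Prog :=
  .seq (fillCap 10) <| odoLoop 7 20 19 23 24 <| .seq splitProg <|
    .when (.less (.reg 25) (.reg 20)) <| .when (.less (.reg 26) (.read 10 (.reg 25))) <|
      .write 10 (.reg 25) (.reg 26)

/-- The table is exact for the strings tried so far. Strings that cut more than `R` pairs are
ignored, and repeated descriptions of one splitting do no harm. A string costs `O(n² + R)` steps. -/
theorem Tri.clusterProg {B n thr g W R : ℕ} {s : Store} {E : ℕ → ℕ → Prop} {Wk Wc : ℕ → ℕ → ℕ}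
    (hs : LeafCtx n thr E Wk Wc s) (hB : n * n * n ≤ B) (hWB : n * n * W ≤ B)
    (hRB : R + 1 ≤ B) (hthr : thr + 1 ≤ B)
    (hWk : ∀ u v, Wk u v ≤ W) (hWc : ∀ u v, Wc u v ≤ W)
    (h8 : ∀ v < n, s.arr 8 v = rankIn E v) (hg : s.reg 22 = g) (hgn : g < n)
    (h19 : s.reg 19 = R) (h20 : s.reg 20 = R + 1) (h7 : s.arr 7 = fun _ => 0) :
    Tri B clusterProg s ((R + 1) * 30 + (R + 1) ^ R * ((n * n + R + 1) * 100)) fun s' =>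
      s'.arr 7 = (fun _ => 0) ∧
      Table (s'.arr 10) (R + 1) (thr + 1) fun q y => ∃ c < (R + 1) ^ R,
        cutAt n E (digArr (R + 1) c) g = q ∧ weightAt n Wk Wc E (digArr (R + 1) c) g ≤ y := by
  refine Tri.mono (Tri.seq ((Tri.fillCap h20 hs.r4 hRB hthr).mono le_rfl fun s₁ hag₁ hfill _ =>
    Tri.odoLoop (β := R + 1) (ℓ := R) (T := n * n * 80 + 40) (fun c s' => Table (s'.arr 10) (R + 1)
      (thr + 1) fun q y => ∃ c' < c, cutAt n E (digArr (R + 1) c') g = q ∧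
        weightAt n Wk Wc E (digArr (R + 1) c') g ≤ y) (by decide) (by decide) (by decide)
      (by decide) (by decide) rfl rfl rfl rfl ((hag₁.reg 20 rfl).trans h20)
      ((hag₁.reg 19 rfl).trans h19) (by omega) hRB hRB ((hag₁.arr 7 rfl).trans h7) ?_ ?_ ?_))
      ?_ fun _ _ h => h
  · intro c s₂ s₃ hag h
    rw [hag.arr 10 rfl]
    exact h
  · intro r hr
    rw [hfill r hr]
    refine ⟨le_rfl, fun y hy => ⟨fun h => by omega, ?_⟩⟩
    rintro ⟨c', hc', -⟩
    omega
  · intro c s₂ hc h7₂ hag₂ hinv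
    have hs₂ := (hs.agree hag₁ (by decide) (by decide)).agree hag₂ (by decide) (by decide)
    refine Tri.mono (Tri.seq ((Tri.splitProg hs₂ hB hWB hWk hWc (by
      rw [hag₂.arr 8 rfl, hag₁.arr 8 rfl]; exact h8) (by
      rw [hag₂.reg 22 rfl, hag₁.reg 22 rfl]; exact hg) hgn).mono le_rfl fun s₃ hag₃ hq _ =>
        Tri.loopFree (T := 30) ?_ ?_ ?_)) (by omega) fun _ _ h => h
    · simp [Prog.maxCost]
    all_goals
      rw [h7₂] at hq
      obtain ⟨h25, h26⟩ := hq
      have h20₃ : s₃.reg 20 = R + 1 := by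
        rw [hag₃.reg 20 rfl, hag₂.reg 20 rfl, hag₁.reg 20 rfl, h20]
      have h10 : s₃.arr 10 = s₂.arr 10 := hag₃.arr 10 rfl
      have hcut : cutAt n E (digArr (R + 1) c) g = s₃.reg 25 := h25.symm
    · simp only [Prog.Ok, Expr.eval_less, Expr.eval_reg, Expr.eval_read, h20₃, h10]
      by_cases h1 : s₃.reg 25 < R + 1
      · by_cases h2 : s₃.reg 26 < s₂.arr 10 (s₃.reg 25)
        · have := (hinv _ h1).1
          simp only [h1, h2, if_true, ne_eq, one_ne_zero, not_false_eq_true]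
          omega
        · simp [h2]
      · simp [h1]
    · simp only [Prog.exec, Expr.eval_less, Expr.eval_reg, Expr.eval_read, h20₃, h10]
      have hsplit : ∀ q y, (∃ c' < c + 1, cutAt n E (digArr (R + 1) c') g = q ∧
          weightAt n Wk Wc E (digArr (R + 1) c') g ≤ y) ↔
          (∃ c' < c, cutAt n E (digArr (R + 1) c') g = q ∧
          weightAt n Wk Wc E (digArr (R + 1) c') g ≤ y) ∨ (s₃.reg 25 = q ∧ s₃.reg 26 ≤ y) := by
        intro q y
        rw [h25, h26]
        constructor
        · rintro ⟨c', hc', h⟩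
          rcases Nat.lt_succ_iff_lt_or_eq.1 hc' with h1 | rfl
          · exact Or.inl ⟨c', h1, h⟩
          · exact Or.inr h
        · rintro (⟨c', hc', h⟩ | h)
          · exact ⟨c', by omega, h⟩
          · exact ⟨c, by omega, h⟩
      intro q hq
      obtain ⟨i1, i2⟩ := hinv q hq
      dsimp only at i2
      by_cases h1 : s₃.reg 25 < R + 1
      · by_cases h2 : s₃.reg 26 < s₂.arr 10 (s₃.reg 25)
        · simp only [h1, h2, if_true, ne_eq, one_ne_zero, not_false_eq_true, Store.setArr_arr, h10]
          by_cases h3 : q = s₃.reg 25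
          · subst h3
            rw [Function.update_self]
            refine ⟨by omega, fun y hy => ?_⟩
            rw [hsplit, ← i2 y hy]
            constructor
            · exact fun h => Or.inr ⟨rfl, h⟩
            · rintro (h | h)
              · omega
              · exact h.2
          · rw [Function.update_of_ne h3]
            refine ⟨i1, fun y hy => ?_⟩
            rw [hsplit, ← i2 y hy]
            exact ⟨Or.inl, fun h => h.resolve_right fun h => h3 h.1.symm⟩
        · simp only [h1, h2, if_true, if_false, ne_eq, one_ne_zero, not_false_eq_true,
            not_true_eq_false, h10]
          refine ⟨i1, fun y hy => ?_⟩
          rw [hsplit, ← i2 y hy]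
          refine ⟨Or.inl, fun h => h.elim id ?_⟩
          rintro ⟨rfl, h⟩
          omega
      · simp only [h1, if_false, ne_eq, not_true_eq_false, h10]
        refine ⟨i1, fun y hy => ?_⟩
        rw [hsplit, ← i2 y hy]
        exact ⟨Or.inl, fun h => h.resolve_right fun h => h1 (by omega)⟩
  · have : (R + 1) ^ R * (n * n * 80 + 40 + 20 * R + 42) ≤
        (R + 1) ^ R * ((n * n + R + 1) * 100) := Nat.mul_le_mul_left _ (by omega)
    omega

/-- Register `21` becomes the weight of the pairs not related by the matrix in array `5`. -/
def offProg : Prog :=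
  .seq (.assign 21 0) <| forLoop 27 6 <|
    .when (.less (.reg 27 / .reg 0) (.reg 27 % .reg 0)) <| .when (.equal (.read 5 (.reg 27)) 0) <|
      .assign 21 (.reg 21 + .read 4 (.reg 27))

theorem Tri.offProg {B n thr W : ℕ} {s : Store} {E : ℕ → ℕ → Prop} {Wk Wc : ℕ → ℕ → ℕ}
    (hs : LeafCtx n thr E Wk Wc s) (hB : n * n * n ≤ B) (hWB : n * n * W ≤ B)
    (hWc : ∀ u v, Wc u v ≤ W) :
    Tri B offProg s (n * n * 50 + 10) fun s' => s'.reg 21 = weightOff n Wc E := by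
  classical
  have hn2 := sq_le_cube n
  let F : ℕ → ℕ → ℕ := fun u v => if E u v then 0 else Wc u v
  refine Tri.mono (Tri.seq (Tri.assign (by simp) fun _ => (Tri.forLoop (T := 40) (N := n * n)
    (fun i s' => s'.reg 21 = ∑ q ∈ Finset.range i, (if q / n < q % n then F (q / n) (q % n) else 0))
      rfl rfl (by decide) (by simp [hs.r6]) (by omega) (by simp) ?_).mono le_rfl
      fun s' _ h => ?_)) (by simp; omega) fun _ _ h => h
  · intro i s' hi hx hy hag hF
    have r0 : s'.reg 0 = n := by rw [hag.reg 0 rfl]; simp [hs.r0]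
    have a4 : s'.arr 4 i = Wc (i / n) (i % n) := by rw [hag.arr 4 rfl]; exact hs.m4 i hi
    have a5 : s'.arr 5 i = ind E (i / n) (i % n) := by rw [hag.arr 5 rfl]; exact hs.m5 i hi
    have b2 : s'.reg 21 + (if i / n < i % n then F (i / n) (i % n) else 0) ≤ B := by
      rw [hF, ← Finset.sum_range_succ]
      refine sum_le_of_le (n := n) (W := W) (fun q _ => ?_) (by omega) hWB
      simp only [F]
      split_ifs <;> first | exact hWc _ _ | exact Nat.zero_le _
    refine Tri.loopFree (by simp [Prog.maxCost]) ?_ ?_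
    · simp only [Prog.Ok, Expr.eval_less, Expr.eval_div, Expr.eval_mod, Expr.eval_reg,
        hx, r0, Expr.eval_add, Expr.eval_read, Expr.eval_zero, Expr.eval_equal, a4, a5,
        ind_ne_zero_iff]
      by_cases h1 : i / n < i % n
      · by_cases h2 : E (i / n) (i % n)
        · simp [h2]
        · simp only [h1, h2, F, if_true, if_false, ne_eq, one_ne_zero, not_false_eq_true] at b2 ⊢
          exact b2
      · simp [h1]
    · simp only [Prog.exec, Expr.eval_less, Expr.eval_div, Expr.eval_mod, Expr.eval_reg,
        hx, r0, Expr.eval_add, Expr.eval_read, Expr.eval_zero, Expr.eval_equal, a4, a5,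
        ind_ne_zero_iff]
      rw [Finset.sum_range_succ, ← hF]
      by_cases h1 : i / n < i % n
      · by_cases h2 : E (i / n) (i % n) <;> simp [h1, h2, F]
      · simp [h1]
  · rw [h.2, sum_range_pairs]
    rfl

/-- Set register `8` if array `9` (of length `reg 20`) has an entry at most `reg 4`. -/
def acceptProg : Prog :=
  forLoop 28 20 <| .when (.less (.read 9 (.reg 28)) (.reg 4 + 1)) (.assign 8 1)

theorem Tri.acceptProg {B t thr : ℕ} {s : Store} (ht : s.reg 20 = t) (hthr : s.reg 4 = thr)
    (htB : t ≤ B) (hB : 1 ≤ B) :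
    Tri B acceptProg s (t * 19 + 6) fun s' =>
      (s'.reg 8 ≠ 0 ↔ s.reg 8 ≠ 0 ∨ ∃ r < t, s.arr 9 r ≤ thr) := by
  refine (Tri.forLoop (T := 11) (N := t) (fun i s' =>
    (s'.reg 8 ≠ 0 ↔ s.reg 8 ≠ 0 ∨ ∃ r < i, s.arr 9 r ≤ thr)) rfl rfl (by decide) ht htB (by simp)
    ?_).mono le_rfl fun s' _ h => h.2
  intro i s' hi hx hy hag hinv
  have r4 : s'.reg 4 = thr := by rw [hag.reg 4 rfl, hthr]
  have a9 : s'.arr 9 = s.arr 9 := hag.arr 9 rfl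
  have hsplit : (∃ r < i + 1, s.arr 9 r ≤ thr) ↔ (∃ r < i, s.arr 9 r ≤ thr) ∨ s.arr 9 i ≤ thr := by
    constructor
    · rintro ⟨r, hr, h⟩
      rcases Nat.lt_succ_iff_lt_or_eq.1 hr with hr | rfl
      · exact Or.inl ⟨r, hr, h⟩
      · exact Or.inr h
    · rintro (⟨r, hr, h⟩ | h)
      · exact ⟨r, by omega, h⟩
      · exact ⟨i, by omega, h⟩
  refine Tri.loopFree (by simp [Prog.maxCost]) ?_ ?_
  · simp only [Prog.Ok, Expr.eval_one]
    split_ifs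
    exact hB
  · simp only [Prog.exec, Expr.eval_less, Expr.eval_read, Expr.eval_reg, hx, Expr.eval_add, r4,
      Expr.eval_one, a9]
    rw [hsplit, ← or_assoc, ← hinv]
    by_cases h : s.arr 9 i < thr + 1
    · simp [h, Nat.lt_succ_iff.1 h]
    · simp only [h, if_false, ne_eq, not_true_eq_false, Store.setReg_reg, Nat.reduceEqDiff]
      omega

/-- Decide whether the clusters of the matrix in array `5` can be split with at most
`reg 3 - reg 9` cut pairs such that the weight is at most `reg 4`. -/
def leafProg : Prog :=
  .seq (.assign 19 (.reg 3 - .reg 9)) <| .seq (.assign 20 (.reg 19 + 1)) <|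
  .seq (rankProg 8 (.read 5 (.reg 27))) <| .seq offProg <| .seq (fillCap 9) <|
  .seq (.when (.less (.reg 21) (.reg 4 + 1)) (.write 9 0 (.reg 21))) <|
  .seq (forLoop 22 0 (.when (.equal (.read 8 (.reg 22)) 0) (.seq clusterProg (convolve 9 10))))
    acceptProg

/-- Each of at most `n` clusters costs `(R + 1) ^ R` strings of `O(n² + R)` steps and a convolution
of length `R + 1`, where `R = K - L`. Register `8` is only ever set, never cleared, so it
accumulates a disjunction over all calls. -/
theorem Tri.leafProg {B n thr W K L : ℕ} {s : Store} {E : ℕ → ℕ → Prop} {Wk Wc : ℕ → ℕ → ℕ}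
    (hs : LeafCtx n thr E Wk Wc s) (hB : n * n * n ≤ B) (hWB : n * n * W ≤ B)
    (hKB : K + 1 ≤ B) (hthr : thr + 1 ≤ B)
    (hWk : ∀ u v, Wk u v ≤ W) (hWc : ∀ u v, Wc u v ≤ W)
    (h3 : s.reg 3 = K) (h9 : s.reg 9 = L) (h7 : s.arr 7 = fun _ => 0) :
    Tri B leafProg s ((n * n * n + 1) * (((K - L + 1) ^ (K - L) * (K - L + 1) +
      (K - L + 1) * (K - L + 1)) * 400)) fun s' => s'.arr 7 = (fun _ => 0) ∧
      (s'.reg 8 ≠ 0 ↔ s.reg 8 ≠ 0 ∨ ∃ c : ℕ → ℕ, (∀ g, c g < (K - L + 1) ^ (K - L)) ∧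
        ∑ g ∈ leaders n E, cutAt n E (digArr (K - L + 1) (c g)) g ≤ K - L ∧
        weightOff n Wc E +
          ∑ g ∈ leaders n E, weightAt n Wk Wc E (digArr (K - L + 1) (c g)) g ≤ thr) := by
  classical
  have hn2 := sq_le_cube n
  have hn1 := le_sq n
  obtain ⟨R, hR⟩ : ∃ R, K - L = R := ⟨_, rfl⟩
  have hRK : R ≤ K := by omega
  rw [hR]
  -- The meaning of the table once the leaders below `i` are treated. The pairs between clusters are
  -- cut in any case, and their weight enters at the beginning.
  let P : ℕ → ℕ → ℕ → Prop := fun i r y => ∃ c : ℕ → ℕ, (∀ g, c g < (R + 1) ^ R) ∧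
    ∑ g ∈ (leaders n E).filter (· < i), cutAt n E (digArr (R + 1) (c g)) g = r ∧
    weightOff n Wc E + ∑ g ∈ (leaders n E).filter (· < i),
      weightAt n Wk Wc E (digArr (R + 1) (c g)) g ≤ y
  have hP0 : ∀ r y, P 0 r y ↔ r = 0 ∧ weightOff n Wc E ≤ y := by
    intro r y
    simp only [P, not_lt_zero, Finset.filter_false, Finset.sum_empty, add_zero]
    exact ⟨fun ⟨c, _, h1, h2⟩ => ⟨h1.symm, h2⟩,
      fun ⟨h1, h2⟩ => ⟨fun _ => 0, fun _ => pow_pos (by omega) _, h1.symm, h2⟩⟩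
  have hfilter : ∀ i, i ∈ leaders n E →
      (leaders n E).filter (· < i + 1) = insert i ((leaders n E).filter (· < i)) := by
    intro i hi
    ext g
    simp only [Finset.mem_filter, Finset.mem_insert]
    constructor
    · rintro ⟨h1, h2⟩
      rcases Nat.lt_succ_iff_lt_or_eq.1 h2 with h | h
      · exact Or.inr ⟨h1, h⟩
      · exact Or.inl h
    · rintro (rfl | ⟨h1, h2⟩)
      · exact ⟨hi, by omega⟩
      · exact ⟨h1, by omega⟩
  have hfilter' : ∀ i, i ∉ leaders n E →
      (leaders n E).filter (· < i + 1) = (leaders n E).filter (· < i) := by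
    intro i hi
    refine Finset.filter_congr fun g hg => ?_
    have : g ≠ i := fun h => hi (h ▸ hg)
    omega
  -- Adding a cluster is a min-plus convolution because the code of the new leader is chosen
  -- independently of the earlier ones.
  have hPs : ∀ i ∈ leaders n E, ∀ r y, (∃ q ≤ r, ∃ y₁ y₂, y₁ + y₂ ≤ y ∧ P i (r - q) y₁ ∧
      ∃ c < (R + 1) ^ R, cutAt n E (digArr (R + 1) c) i = q ∧
        weightAt n Wk Wc E (digArr (R + 1) c) i ≤ y₂) ↔ P (i + 1) r y := by
    intro i hi r y
    have hni : i ∉ (leaders n E).filter (· < i) := by simp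
    simp only [P, hfilter i hi, Finset.sum_insert hni]
    constructor
    · rintro ⟨q, hq, y₁, y₂, hy, ⟨c, hc, h1, h2⟩, c', hc', h3, h4⟩
      have e : ∀ g ∈ (leaders n E).filter (· < i), Function.update c i c' g = c g := fun g hg =>
        Function.update_of_ne (by rintro rfl; exact hni hg) _ _
      refine ⟨Function.update c i c', fun g => ?_, ?_, ?_⟩
      · rw [Function.update_apply]; split_ifs
        · exact hc'
        · exact hc g
      · rw [Function.update_self, Finset.sum_congr rfl fun g hg => by rw [e g hg], h1, h3]
        omega
      · rw [Function.update_self,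
          Finset.sum_congr (g := fun g => weightAt n Wk Wc E (digArr (R + 1) (c g)) g) rfl
            fun g hg => by rw [e g hg]]
        omega
    · rintro ⟨c, hc, h1, h2⟩
      exact ⟨cutAt n E (digArr (R + 1) (c i)) i, by omega, _, _, by omega,
        ⟨c, hc, by omega, le_rfl⟩, c i, hc i, rfl, le_rfl⟩
  refine Tri.mono (Tri.seq (Tri.assign (by simp [h3, h9, hR]; omega) fun hag₁ => Tri.seq
    (Tri.assign (by simp [h3, h9, hR]; omega) fun hag₂ => ?_) (T₂ := (R + 1) ^ R * ((n * n + R + 1) * 100) * n +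
      n * ((R + 1) * 70 + (R + 1) * (R + 1) * 40 + 50) + n * n * 200 + (R + 1) * 40 + 200)))
      ?_ fun _ _ h => h
  · simp only [Expr.eval_sub, Expr.eval_reg, h3, h9, hR, Expr.eval_add, Expr.eval_one,
      Store.setReg_reg, if_true] at hag₁ hag₂ ⊢
    set s₂ := (s.setReg 19 R).setReg 20 (R + 1) with hs₂def
    have hs₂ : LeafCtx n thr E Wk Wc s₂ :=
      (hs.agree hag₁ (by decide) (by decide)).agree hag₂ (by decide) (by decide)
    have h19 : s₂.reg 19 = R := by simp [hs₂def]
    have h20 : s₂.reg 20 = R + 1 := by simp [hs₂def]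
    have h8₂ : s₂.reg 8 = s.reg 8 := by simp [hs₂def]
    have h7₂ : s₂.arr 7 = fun _ => 0 := by simp [hs₂def, h7]
    clear_value s₂
    clear hag₁ hag₂ h7
    refine Tri.mono (Tri.seq ((Tri.rankProg hs₂.toHasSize hB (E := E) (fun s' hag i hi hx => by
      rw [Expr.eval_read, Expr.eval_reg, hx, hag.arr 5 rfl, hs₂.m5 i hi]; simp)).mono le_rfl
      fun s₃ hag₃ h8 _ => Tri.seq ((Tri.offProg (hs₂.agree hag₃ (by decide) (by decide)) hB hWB
      hWc).mono le_rfl fun s₄ hag₄ h21 _ => Tri.seq ((Tri.fillCap (t := R + 1) (thr := thr)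
      ?_ ?_ (by omega) hthr).mono le_rfl fun s₅ hag₅ hfill _ => Tri.seq (T₁ := 10) (Q := _)
      (Tri.mono (Q := fun s₆ => Table (s₆.arr 9) (R + 1) (thr + 1) (P 0))
        (Tri.straight (p := .when _ _) ?_ ?_) (by simp [Prog.maxCost])
        fun s₆ hag₆ htab _ => Tri.seq (T₁ := n * ((R + 1) * 30 + (R + 1) ^ R *
        ((n * n + R + 1) * 100) + (R + 1) * ((R + 1) * 40 + 40) + 30) + 6) (T₂ := (R + 1) * 19 + 6)
        (Tri.mono (Q := fun s₇ => s₇.arr 7 = (fun _ => 0) ∧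
          Table (s₇.arr 9) (R + 1) (thr + 1) (P n)) ?_ le_rfl
        fun s₇ hag₇ hq _ => ?_)))))) ?_ fun _ _ h => h
    · rw [hag₄.reg 20 rfl, hag₃.reg 20 rfl, h20]
    · rw [hag₄.reg 4 rfl, hag₃.reg 4 rfl, hs₂.r4]
    · have r4 : s₅.reg 4 = thr := by rw [hag₅.reg 4 rfl, hag₄.reg 4 rfl, hag₃.reg 4 rfl, hs₂.r4]
      have r21 : s₅.reg 21 = weightOff n Wc E := by rw [hag₅.reg 21 rfl, h21]
      simp only [Prog.Ok, Expr.eval_less, Expr.eval_reg, Expr.eval_add, Expr.eval_one,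
        Expr.eval_zero, r4, r21]
      by_cases h : weightOff n Wc E < thr + 1
      · simp only [h, if_true, ne_eq, one_ne_zero, not_false_eq_true]; omega
      · simp [h]
    · have r4 : s₅.reg 4 = thr := by rw [hag₅.reg 4 rfl, hag₄.reg 4 rfl, hag₃.reg 4 rfl, hs₂.r4]
      have r21 : s₅.reg 21 = weightOff n Wc E := by rw [hag₅.reg 21 rfl, h21]
      simp only [Prog.exec, Expr.eval_less, Expr.eval_reg, Expr.eval_add, Expr.eval_one,
        Expr.eval_zero, r4, r21]
      intro r hr
      by_cases h : weightOff n Wc E < thr + 1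
      · simp only [h, if_true, ne_eq, one_ne_zero, not_false_eq_true, Store.setArr_arr, hP0]
        by_cases h0 : r = 0
        · subst h0
          rw [Function.update_self]
          exact ⟨by omega, fun y hy => by simp⟩
        · rw [Function.update_of_ne h0, hfill r hr]
          exact ⟨le_rfl, fun y hy => ⟨fun h => by omega, fun h => absurd h.1 h0⟩⟩
      · simp only [h, if_false, ne_eq, not_true_eq_false, hP0]
        rw [hfill r hr]
        exact ⟨le_rfl, fun y hy => ⟨fun h => by omega, fun h => by omega⟩⟩
    · have hs₆ : LeafCtx n thr E Wk Wc s₆ := (((hs₂.agree hag₃ (by decide) (by decide)).agree hag₄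
        (by decide) (by decide)).agree hag₅ (by decide) (by decide)).agree hag₆ (by decide)
        (by decide)
      have h20₆ : s₆.reg 20 = R + 1 := by
        rw [hag₆.reg 20 rfl, hag₅.reg 20 rfl, hag₄.reg 20 rfl, hag₃.reg 20 rfl, h20]
      have h19₆ : s₆.reg 19 = R := by
        rw [hag₆.reg 19 rfl, hag₅.reg 19 rfl, hag₄.reg 19 rfl, hag₃.reg 19 rfl, h19]
      have h7₆ : s₆.arr 7 = fun _ => 0 := by
        rw [hag₆.arr 7 rfl, hag₅.arr 7 rfl, hag₄.arr 7 rfl, hag₃.arr 7 rfl, h7₂]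
      have h8₆ : s₆.arr 8 = s₃.arr 8 := by rw [hag₆.arr 8 rfl, hag₅.arr 8 rfl, hag₄.arr 8 rfl]
      refine (Tri.forLoop (T := (R + 1) * 30 + (R + 1) ^ R * ((n * n + R + 1) * 100) +
        (R + 1) * ((R + 1) * 40 + 40) + 22) (N := n) (fun i s' => s'.arr 7 = (fun _ => 0) ∧
          Table (s'.arr 9) (R + 1) (thr + 1) (P i)) rfl rfl (by decide) hs₆.r0 (by omega)
          ⟨h7₆, htab⟩ ?_).mono (by simp [add_assoc]) fun s' _ h => h.2
      intro g s' hg hx hy hag ⟨h7', htab'⟩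
      have hs' := hs₆.agree hag (by decide) (by decide)
      have h8' : ∀ v < n, s'.arr 8 v = rankIn E v := by
        rw [hag.arr 8 rfl, h8₆]; exact h8
      refine Tri.mono (Tri.when (T := (R + 1) * 30 + (R + 1) ^ R * ((n * n + R + 1) * 100) +
        ((R + 1) * ((R + 1) * 40 + 40) + 6)) (fun h => ?_) (fun h => ?_)) (by simp; omega)
          fun _ _ h => h
      · have hlead : g ∈ leaders n E := by
          simp only [leaders, Finset.mem_filter, Finset.mem_range]
          refine ⟨hg, ?_⟩
          rw [← h8' g hg]
          simpa [hx] using h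
        refine Tri.seq ((Tri.clusterProg hs' hB hWB (by omega) hthr hWk hWc h8' hx hg
          ((hag.reg 19 rfl).trans h19₆) ((hag.reg 20 rfl).trans h20₆) h7').mono le_rfl
          fun s'' hag'' hq _ => ?_)
        have h20'' : s''.reg 20 = R + 1 := by rw [hag''.reg 20 rfl, hag.reg 20 rfl, h20₆]
        have h4'' : s''.reg 4 = thr := by rw [hag''.reg 4 rfl, hs'.r4]
        have htab'' : Table (s''.arr 9) (R + 1) (thr + 1) (P g) := by
          rw [hag''.arr 9 rfl]; exact htab'
        refine (Tri.convolve (by decide) h20'' h4'' (by omega) hthr htab'' hq.2).mono le_rfl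
          fun s₉ hag₉ h => ⟨?_, ?_⟩
        · simp only [Store.setReg_arr]
          rw [hag₉.arr 7 rfl]
          exact hq.1
        · exact h.congr fun r _ y _ => hPs g hlead r y
      · have hlead : g ∉ leaders n E := by
          simp only [leaders, Finset.mem_filter, Finset.mem_range, not_and]
          intro _
          rw [← h8' g hg]
          simpa [hx] using h
        refine ⟨h7', ?_⟩
        simp only [Store.setReg_arr, P, hfilter' g hlead]
        exact htab'
    · have h20₇ : s₇.reg 20 = R + 1 := by
        rw [hag₇.reg 20 rfl, hag₆.reg 20 rfl, hag₅.reg 20 rfl, hag₄.reg 20 rfl, hag₃.reg 20 rfl, h20]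
      have h4₇ : s₇.reg 4 = thr := by
        rw [hag₇.reg 4 rfl, hag₆.reg 4 rfl, hag₅.reg 4 rfl, hag₄.reg 4 rfl, hag₃.reg 4 rfl, hs₂.r4]
      have h8₇ : s₇.reg 8 = s.reg 8 := by
        rw [hag₇.reg 8 rfl, hag₆.reg 8 rfl, hag₅.reg 8 rfl, hag₄.reg 8 rfl, hag₃.reg 8 rfl, h8₂]
      refine (Tri.acceptProg h20₇ h4₇ (by omega) (by omega)).mono le_rfl
        fun s' hag h => ⟨(hag.arr 7 rfl).trans hq.1, h.trans (or_congr (by rw [h8₇]) ?_)⟩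
      have hall : (leaders n E).filter (· < n) = leaders n E := by
        refine Finset.filter_true_of_mem fun g hg => ?_
        simp only [leaders, Finset.mem_filter, Finset.mem_range] at hg
        exact hg.1
      constructor
      · rintro ⟨r, hr, hle⟩
        obtain ⟨c, hc, h1, h2⟩ := ((hq.2 r hr).2 thr (by omega)).1 hle
        rw [hall] at h1 h2
        exact ⟨c, hc, by omega, h2⟩
      · rintro ⟨c, hc, h1, h2⟩
        refine ⟨_, Nat.lt_succ_of_le h1, ((hq.2 _ (Nat.lt_succ_of_le h1)).2 thr (by omega)).2 ?_⟩
        refine ⟨c, hc, ?_, ?_⟩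
        · rw [hall]
        · rw [hall]; exact h2
    · simp
      nlinarith
  · simp
    have hpos : 0 < (R + 1) ^ R := pow_pos (by omega) _
    generalize (R + 1) ^ R = A at *
    obtain ⟨X, hX⟩ : ∃ X, X = n * n * n := ⟨_, rfl⟩
    -- What follows absorbs all terms into `n³` times the sum of `(R + 1) ^ R * (R + 1)` and `(R +
    -- 1) ^ 2`.
    have e1 : A * ((n * n + R + 1) * 100) * n = A * 100 * X + A * (R + 1) * 100 * n := by
      rw [hX]; ring
    have e2 : n ≤ X := by rw [hX]; omega
    have e3 : n * n ≤ X := by rw [hX]; omega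
    rw [← hX, e1]
    have e4 : A * (R + 1) * 100 * n ≤ A * (R + 1) * 100 * X := Nat.mul_le_mul_left _ e2
    have e5 : n * ((R + 1) * 70 + (R + 1) * (R + 1) * 40 + 50) ≤
      X * ((R + 1) * 70 + (R + 1) * (R + 1) * 40 + 50) := Nat.mul_le_mul_right _ e2
    have e6 : A * 100 * X ≤ A * (R + 1) * 100 * X := by
      refine Nat.mul_le_mul_right _ (Nat.mul_le_mul_right _ ?_)
      exact Nat.le_mul_of_pos_right _ (by omega)
    have e7 : R + 1 ≤ (R + 1) * (R + 1) := le_sq _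
    have e8 : X * (R + 1) ≤ X * ((R + 1) * (R + 1)) := Nat.mul_le_mul_left _ e7
    have e9 : X ≤ X * (R + 1) := Nat.le_mul_of_pos_right _ (by omega)
    have e10 : X * (R + 1) ≤ X * (A * (R + 1)) :=
      Nat.mul_le_mul_left _ (Nat.le_mul_of_pos_left _ hpos)
    have e11 : R + 1 ≤ A * (R + 1) := Nat.le_mul_of_pos_left _ hpos
    nlinarith

/-- Decide whether there is a cluster graph that differs from the matrix in array `2` on at most
`reg 3` pairs and has weight at most `reg 4`. -/
def coreProg : Prog :=
  .seq (.assign 11 (2 + 1)) <| .seq (.assign 10 (.reg 3 + 1)) <| forLoop 9 10 <|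
    odoLoop 6 11 9 12 13 <| .seq branchProg <| .when (.equal (.reg 15) 0) leafProg

/-- Up to a factor `O(n³)`, the running time of `coreProg`. -/
def coreTime (K : ℕ) : ℕ :=
  ∑ L ∈ Finset.range (K + 1), 3 ^ L * ((L + 2) * 300 +
    ((K - L + 1) ^ (K - L) * (K - L + 1) + (K - L + 1) * (K - L + 1)) * 400) + 20

/-- The loops try every `L ≤ K` and every string of `L` choices among three pairs; register `8`
collects whether some attempt succeeds. `exists_split_iff` interprets an attempt, and
`exists_cluster_iff` interprets their disjunction. -/
theorem Tri.coreProg {B n thr W K : ℕ} {s : Store} {E : ℕ → ℕ → Prop} {Wk Wc : ℕ → ℕ → ℕ}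
    (hs : HasSize n s) (hE : ReflSymm E) (h2 : IsMatrix n (s.arr 2) (ind E))
    (hm3 : IsMatrix n (s.arr 3) Wk) (hm4 : IsMatrix n (s.arr 4) Wc)
    (hB : n * n * n ≤ B) (hWB : n * n * W ≤ B)
    (hKB : K + 3 ≤ B) (hthr : thr + 1 ≤ B)
    (hWk : ∀ u v, Wk u v ≤ W) (hWc : ∀ u v, Wc u v ≤ W)
    (h3 : s.reg 3 = K) (h4 : s.reg 4 = thr) (h6 : s.arr 6 = fun _ => 0)
    (h7 : s.arr 7 = fun _ => 0) (h8 : s.reg 8 = 0)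
    (hmono : ∀ u v, u < v → v < n → ¬ E u v → Wc u v ≤ Wk u v) :
    Tri B coreProg s ((n * n * n + 3) * coreTime K) fun s' =>
      (s'.reg 8 ≠ 0 ↔ ∃ S, ReflSymm S ∧ TransOn n S ∧ distRel n E S ≤ K ∧
        weight n Wk Wc S ≤ thr) := by
  classical
  let Acc : ℕ → ℕ → Prop := fun L c => ∃ H, H = resolveSeq n E (fun i => digArr 3 c (i + 1)) L ∧
      TransOn n H ∧ ∃ S, ReflSymm S ∧ TransOn n S ∧ (∀ u v, u < n → v < n → S u v → H u v) ∧
        distRel n H S ≤ K - L ∧ weight n Wk Wc S ≤ thr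
  let TL : ℕ → ℕ := fun L => (n * n * n + 3) * (L + 2) * 150 + ((n * n * n + 1) *
    (((K - L + 1) ^ (K - L) * (K - L + 1) + (K - L + 1) * (K - L + 1)) * 400) + 5)
  refine Tri.mono (Tri.seq (Tri.assign (by simp; omega) fun hag₁ => Tri.seq (Tri.assign
    (by simp [h3]; omega) fun hag₂ => Tri.mono (Tri.forLoop_sum (N := K + 1)
      (T := fun L => 3 ^ L * (TL L + 20 * L + 42) + 4) (fun L s' => s'.arr 6 = (fun _ => 0) ∧
      s'.arr 7 = (fun _ => 0) ∧ (s'.reg 8 ≠ 0 ↔ ∃ L' < L, ∃ c < 3 ^ L', Acc L' c)) rfl rfl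
      (by decide) (by simp [h3]) (by omega) (by simp [h6, h7, h8]) ?_) le_rfl
      fun s' hag h => ?_))) ?_ fun _ _ h => h
  · intro L s' hL hx hy hag ⟨h6', h7', h8'⟩
    have hs' : HasSize n s' := ((hs.agree hag₁ (by decide)).agree hag₂ (by decide)).agree hag
      (by decide)
    have r11 : s'.reg 11 = 3 := by rw [hag.reg 11 rfl]; simp
    have r3 : s'.reg 3 = K := by rw [hag.reg 3 rfl]; simp [h3]
    have r4 : s'.reg 4 = thr := by rw [hag.reg 4 rfl]; simp [h4]
    have a2 : s'.arr 2 = s.arr 2 := by rw [hag.arr 2 rfl]; simp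
    have a3 : s'.arr 3 = s.arr 3 := by rw [hag.arr 3 rfl]; simp
    have a4 : s'.arr 4 = s.arr 4 := by rw [hag.arr 4 rfl]; simp
    clear hag hag₁ hag₂
    refine (Tri.odoLoop (β := 3) (ℓ := L) (T := TL L) (fun c s'' => s''.arr 7 = (fun _ => 0) ∧
      (s''.reg 8 ≠ 0 ↔ (∃ L' < L, ∃ c < 3 ^ L', Acc L' c) ∨ ∃ c' < c, Acc L c'))
      (by decide) (by decide) (by decide) (by decide) (by decide) rfl rfl rfl rfl r11 hx (by omega)
      (by omega) (by omega) h6' ?_ ?_ ?_).mono le_rfl fun s'' hag h => ⟨h.1, h.2.1, ?_⟩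
    · intro c s₁ s₂ hag h
      rw [hag.arr 7 rfl, hag.reg 8 rfl]
      exact h
    · simpa [h7'] using h8'
    · intro c s₁ hc h6₁ hag₁ ⟨h7₁, h8₁⟩
      have hs₁ := hs'.agree hag₁ (by decide)
      have hsplit : (∃ c' < c + 1, Acc L c') ↔ (∃ c' < c, Acc L c') ∨ Acc L c := by
        constructor
        · rintro ⟨c', hc', h⟩
          rcases Nat.lt_succ_iff_lt_or_eq.1 hc' with hr | rfl
          · exact Or.inl ⟨c', hr, h⟩
          · exact Or.inr h
        · rintro (⟨c', hr, h⟩ | h)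
          · exact ⟨c', by omega, h⟩
          · exact ⟨c, by omega, h⟩
      refine Tri.seq ((Tri.branchProg hs₁ hE (by rw [hag₁.arr 2 rfl, a2]; exact h2) hB
        ((hag₁.reg 9 rfl).trans hx) (by omega)).mono le_rfl fun s₂ hag₂ hq _ => ?_)
      rw [h6₁] at hq
      obtain ⟨hm5, h15⟩ := hq
      set H := resolveSeq n E (fun i => digArr 3 c (i + 1)) L with hH
      have hHr : ReflSymm H := hE.resolveSeq _ _
      have h7₂ : s₂.arr 7 = fun _ => 0 := by rw [hag₂.arr 7 rfl, h7₁]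
      have h8₂ : s₂.reg 8 = s₁.reg 8 := hag₂.reg 8 rfl
      refine (Tri.when (fun h => ?_) (fun h => ?_)).mono (T₁ := 3 + 1 + ((n * n * n + 1) *
        (((K - L + 1) ^ (K - L) * (K - L + 1) + (K - L + 1) * (K - L + 1)) * 400) + 1)) (by omega)
          fun _ _ h => h
      · have hT : TransOn n H := transOn_of_lastP3_eq (by simpa [h15] using h)
        have hctx : LeafCtx n thr H Wk Wc s₂ :=
          { toHasSize := hs₁.agree hag₂ (by decide)
            r4 := by rw [hag₂.reg 4 rfl, hag₁.reg 4 rfl, r4]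
            m3 := by rw [hag₂.arr 3 rfl, hag₁.arr 3 rfl, a3]; exact hm3
            m4 := by rw [hag₂.arr 4 rfl, hag₁.arr 4 rfl, a4]; exact hm4
            m5 := hm5 }
        refine (Tri.leafProg hctx hB hWB (by omega) hthr hWk hWc
          (by rw [hag₂.reg 3 rfl, hag₁.reg 3 rfl, r3]) (by rw [hag₂.reg 9 rfl, hag₁.reg 9 rfl, hx])
          h7₂).mono le_rfl fun s₃ hag₃ hq => ⟨hq.1, hq.2.trans ?_⟩
        rw [h8₂, h8₁, hsplit, ← or_assoc]
        refine or_congr Iff.rfl ?_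
        rw [exists_split_iff hHr hT]
        exact ⟨fun h => ⟨H, hH, hT, h⟩, fun ⟨H', e1, _, h⟩ => by
          rw [hH, ← e1]; exact h⟩
      · refine ⟨h7₂, ?_⟩
        rw [h8₂, h8₁, hsplit, ← or_assoc]
        refine ⟨Or.inl, fun h' => h'.resolve_right ?_⟩
        rintro ⟨H', e1, hT, -⟩
        rw [e1] at hT
        have := lastP3_eq_of_transOn hT
        rw [← hH, ← h15] at this
        simp [this] at h
    · have hsplit : (∃ L' < L + 1, ∃ c < 3 ^ L', Acc L' c) ↔
          (∃ L' < L, ∃ c < 3 ^ L', Acc L' c) ∨ ∃ c < 3 ^ L, Acc L c := by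
        constructor
        · rintro ⟨c', hc', hacc⟩
          rcases Nat.lt_succ_iff_lt_or_eq.1 hc' with hr | rfl
          · exact Or.inl ⟨c', hr, hacc⟩
          · exact Or.inr hacc
        · rintro (⟨c', hr, h⟩ | h)
          · exact ⟨c', by omega, h⟩
          · exact ⟨L, by omega, h⟩
      simp only [Store.setReg_reg, Nat.reduceEqDiff, if_false]
      rw [hsplit]
      exact h.2.2
  · rw [h.2.2.2, ← exists_cluster_iff hE Wk Wc K thr hmono]
    constructor
    · rintro ⟨L, hL, c, hc, h⟩
      exact ⟨L, by omega, c, hc, h⟩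
    · rintro ⟨L, hL, c, hc, h⟩
      exact ⟨L, by omega, c, hc, h⟩
  · simp only [Expr.cost_add, Expr.cost_two, Expr.cost_one, Expr.cost_reg, coreTime]
    have : ∑ L ∈ Finset.range (K + 1), (3 ^ L * (TL L + 20 * L + 42) + 4 + 8) ≤
        (n * n * n + 3) * ∑ L ∈ Finset.range (K + 1), 3 ^ L * ((L + 2) * 300 +
          ((K - L + 1) ^ (K - L) * (K - L + 1) + (K - L + 1) * (K - L + 1)) * 400) := by
      rw [Finset.mul_sum]
      refine Finset.sum_le_sum fun L _ => ?_
      simp only [TL]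
      obtain ⟨Y, hY⟩ : ∃ Y, Y = ((K - L + 1) ^ (K - L) * (K - L + 1) +
        (K - L + 1) * (K - L + 1)) * 400 := ⟨_, rfl⟩
      rw [← hY]
      obtain ⟨A, hA⟩ : ∃ A, A = 3 ^ L := ⟨_, rfl⟩
      have hp : 1 ≤ A := hA ▸ Nat.one_le_pow _ _ (by omega)
      rw [← hA]
      obtain ⟨X, hX⟩ : ∃ X, X = n * n * n := ⟨_, rfl⟩
      rw [← hX]
      calc A * ((X + 3) * (L + 2) * 150 + ((X + 1) * Y + 5) + 20 * L + 42) + 4 + 8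
          ≤ A * ((X + 3) * (L + 2) * 150 + ((X + 1) * Y + 5) + 20 * L + 42) + A * 12 := by omega
        _ = A * ((X + 3) * (L + 2) * 150 + ((X + 1) * Y + 5) + 20 * L + 54) := by ring
        _ ≤ A * ((X + 3) * ((L + 2) * 300 + Y)) := by
          refine Nat.mul_le_mul_left _ ?_
          nlinarith [Nat.zero_le (X * L)]
        _ = (X + 3) * (A * ((L + 2) * 300 + Y)) := by ring
    rw [mul_add]
    omega

/-! ### Running times -/

/-- `(1 + a / d) ^ (d + a) ≤ exp (a (d + a) / d) ≤ exp (a (a + 1))`, and `e < 3`. Thus a shift of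
the base by a constant costs only a constant factor. -/
theorem add_pow_le_mul_pow (a : ℕ) {d : ℕ} (hd : 0 < d) :
    (d + a) ^ (d + a) ≤ 3 ^ (a * (a + 1)) * d ^ (d + a) := by
  have hd' : (0 : ℝ) < d := by exact_mod_cast hd
  have h1 : ((d : ℝ) + a) = d * (a / d + 1) := by field_simp; ring
  have h2 : (a / d + 1 : ℝ) ^ (d + a) ≤ 3 ^ (a * (a + 1)) := by
    calc (a / d + 1 : ℝ) ^ (d + a) ≤ (Real.exp (a / d)) ^ (d + a) :=
          pow_le_pow_left₀ (by positivity) (Real.add_one_le_exp _) _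
      _ = Real.exp ((d + a : ℕ) * (a / d)) := by rw [← Real.exp_nat_mul]
      _ ≤ Real.exp ((a * (a + 1) : ℕ) * 1) := by
          refine Real.exp_le_exp.2 ?_
          have h3 : (1 : ℝ) ≤ d := by exact_mod_cast hd
          rw [mul_one, ← mul_div_assoc, div_le_iff₀ hd']
          push_cast
          nlinarith [mul_nonneg (mul_nonneg (Nat.cast_nonneg (α := ℝ) a)
            (Nat.cast_nonneg (α := ℝ) a)) (sub_nonneg.2 h3)]
      _ = (Real.exp 1) ^ (a * (a + 1)) := by rw [← Real.exp_nat_mul]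
      _ ≤ 3 ^ (a * (a + 1)) :=
          pow_le_pow_left₀ (Real.exp_pos _).le (Real.exp_one_lt_d9.le.trans (by norm_num)) _
  have h3 : ((d : ℝ) + a) ^ (d + a) ≤ 3 ^ (a * (a + 1)) * d ^ (d + a) := by
    rw [h1, mul_pow, mul_comm]
    exact mul_le_mul_of_nonneg_right h2 (by positivity)
  exact_mod_cast h3

theorem add_pow_le_mul_max_pow (a : ℕ) :
    ∃ C, 0 < C ∧ ∀ d, (d + a) ^ (d + a) ≤ C * max d 1 ^ (d + a) := by
  -- The summand `a ^ a` serves `d = 0`, where `max d 1 = 1`.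
  refine ⟨3 ^ (a * (a + 1)) + a ^ a, by positivity, fun d => ?_⟩
  rcases Nat.eq_zero_or_pos d with rfl | hd
  · simp
  · rw [max_eq_left hd, add_mul]
    exact (add_pow_le_mul_pow a hd).trans (Nat.le_add_right _ _)

theorem succ_pow_succ_step (K : ℕ) :
    (K + 2) * (K + 1) ^ (K + 1) ≤ (K + 2) ^ (K + 2) := by
  rw [pow_succ' (K + 2)]
  exact Nat.mul_le_mul_left _ (Nat.pow_le_pow_left (by omega) _)

/-- Increasing `K` multiplies the old sum by 3 and adds a term of at most `2 (K + 2) ^ (K + 2)`,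
while the right-hand side grows by a factor of at least `K + 2`. From `K = 4` on this factor is at
least 6, which absorbs both; smaller cases are computed. -/
theorem sum_three_pow_mul_le (K : ℕ) : ∑ L ∈ Finset.range (K + 1), 3 ^ L *
    ((K - L + 1) ^ (K - L) * (K - L + 1) + (K - L + 1) * (K - L + 1)) ≤
      100 * (K + 1) ^ (K + 1) := by
  have hf : ∀ R : ℕ, (R + 1) ^ R * (R + 1) + (R + 1) * (R + 1) ≤ 2 * (R + 1) ^ (R + 1) := by
    intro R
    rcases R with _ | R
    · simp
    · have : (R + 1 + 1) ^ 2 ≤ (R + 1 + 1) ^ (R + 1 + 1) := Nat.pow_le_pow_right (by omega) (by omega)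
      rw [pow_succ (R + 1 + 1) (R + 1)] at *
      nlinarith
  by_cases hK : K < 4
  · interval_cases K <;> simp [Finset.sum_range_succ]
  · obtain ⟨j, rfl⟩ : ∃ j, K = j + 4 := ⟨K - 4, by omega⟩
    clear hK
    induction j with
    | zero => simp [Finset.sum_range_succ]
    | succ j ih =>
      rw [Finset.sum_range_succ']
      have hsum : ∑ k ∈ Finset.range (j + 1 + 4), 3 ^ (k + 1) *
          ((j + 1 + 4 - (k + 1) + 1) ^ (j + 1 + 4 - (k + 1)) * (j + 1 + 4 - (k + 1) + 1) +
            (j + 1 + 4 - (k + 1) + 1) * (j + 1 + 4 - (k + 1) + 1)) =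
          3 * ∑ L ∈ Finset.range (j + 4 + 1), 3 ^ L * ((j + 4 - L + 1) ^ (j + 4 - L) *
            (j + 4 - L + 1) + (j + 4 - L + 1) * (j + 4 - L + 1)) := by
        rw [Finset.mul_sum, show j + 1 + 4 = j + 4 + 1 by ring]
        refine Finset.sum_congr rfl fun k _ => ?_
        rw [Nat.add_sub_add_right, pow_succ']
        ring
      rw [hsum, show j + 1 + 4 = j + 4 + 1 by ring]
      have h1 := hf (j + 4 + 1)
      have h2 : (j + 4 + 1 + 1) * (j + 4 + 1) ^ (j + 4 + 1) ≤ (j + 4 + 1 + 1) ^ (j + 4 + 1 + 1) :=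
        succ_pow_succ_step (j + 4)
      have h3 : 6 * (j + 4 + 1) ^ (j + 4 + 1) ≤ (j + 4 + 1 + 1) * (j + 4 + 1) ^ (j + 4 + 1) :=
        Nat.mul_le_mul_right _ (by omega)
      simp only [pow_zero, one_mul, Nat.sub_zero]
      generalize (j + 4 + 1 + 1) ^ (j + 4 + 1 + 1) = Z at *
      generalize (j + 4 + 1) ^ (j + 4 + 1) = A at *
      omega

/-- From `K = 3` on, one step multiplies the left side by at most 5 and the right side by at least
5. -/
theorem three_pow_mul_le (K : ℕ) : 3 ^ K * (K + 2) ≤ 10 * (K + 1) ^ (K + 1) := by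
  by_cases hK : K < 3
  · interval_cases K <;> simp
  · obtain ⟨j, rfl⟩ : ∃ j, K = j + 3 := ⟨K - 3, by omega⟩
    clear hK
    induction j with
    | zero => simp
    | succ j ih =>
      have h2 : (j + 3 + 1 + 1) * (j + 3 + 1) ^ (j + 3 + 1) ≤ (j + 3 + 1 + 1) ^ (j + 3 + 1 + 1) :=
        succ_pow_succ_step (j + 3)
      have h4 : 5 * (j + 3 + 1) ^ (j + 3 + 1) ≤ (j + 3 + 1 + 1) * (j + 3 + 1) ^ (j + 3 + 1) :=
        Nat.mul_le_mul_right _ (by omega)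
      rw [show j + 1 + 3 = j + 3 + 1 by ring, pow_succ']
      have h3 : 3 * 3 ^ (j + 3) * (j + 3 + 1 + 2) ≤ 5 * (3 ^ (j + 3) * (j + 3 + 2)) := by
        nlinarith [Nat.zero_le (3 ^ (j + 3) * j), Nat.zero_le (3 ^ (j + 3))]
      linarith

theorem sum_three_pow_le (K : ℕ) :
    ∑ L ∈ Finset.range (K + 1), 3 ^ L * (L + 2) ≤ 2 * (3 ^ K * (K + 2)) := by
  induction K with
  | zero => simp
  | succ K ih =>
    rw [Finset.sum_range_succ, pow_succ']
    nlinarith [Nat.zero_le (3 ^ K * K), Nat.zero_le (3 ^ K)]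

theorem exists_coreTime_le : ∃ C, 0 < C ∧ ∀ K, coreTime K ≤ C * max K 1 ^ (K + 1) := by
  obtain ⟨C, hC, h⟩ := add_pow_le_mul_max_pow 1
  -- The three parts contribute `300 * 2 * 10`, `400 * 100` and `20` times `(K + 1) ^ (K + 1)`.
  refine ⟨50000 * C, by omega, fun K => ?_⟩
  have h1 := sum_three_pow_mul_le K
  have h2 := three_pow_mul_le K
  have h3 := sum_three_pow_le K
  have h4 := h K
  have h5 : 1 ≤ (K + 1) ^ (K + 1) := Nat.one_le_pow _ _ (by omega)
  have h6 : coreTime K = 300 * ∑ L ∈ Finset.range (K + 1), 3 ^ L * (L + 2) +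
      400 * ∑ L ∈ Finset.range (K + 1), 3 ^ L *
        ((K - L + 1) ^ (K - L) * (K - L + 1) + (K - L + 1) * (K - L + 1)) + 20 := by
    rw [coreTime, Finset.mul_sum, Finset.mul_sum, ← Finset.sum_add_distrib]
    congr 1
    refine Finset.sum_congr rfl fun L _ => by ring
  rw [h6, mul_assoc]
  omega

/-- For `K ≥ 1`, from `K ≤ 2 ^ K` one gets `2 ^ (K (K + 1))`, and `K + 1 ≤ 2 K`. -/
theorem max_pow_le_four_pow (K : ℕ) : max K 1 ^ (K + 1) ≤ 4 ^ (K ^ 2) := by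
  rcases Nat.eq_zero_or_pos K with rfl | hK
  · simp
  · rw [max_eq_left hK]
    calc K ^ (K + 1) ≤ (2 ^ K) ^ (K + 1) := Nat.pow_le_pow_left Nat.lt_two_pow_self.le _
      _ = 2 ^ (K * (K + 1)) := by rw [← pow_mul]
      _ ≤ 2 ^ (2 * K ^ 2) := Nat.pow_le_pow_right (by omega) (by nlinarith)
      _ = 4 ^ (K ^ 2) := by rw [pow_mul]; norm_num

theorem cube_add_le (n : ℕ) : n * n * n + 3 ≤ 4 * max n 1 ^ 3 := by
  rcases Nat.eq_zero_or_pos n with rfl | hn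
  · simp
  · rw [max_eq_left hn]
    have : 0 < n ^ 3 := by positivity
    nlinarith

/-- Used to see that the parameter dependence in the running times is computable. -/
theorem primrec_pow : Primrec₂ ((· ^ ·) : ℕ → ℕ → ℕ) := by
  have h : Primrec₂ fun a b : ℕ => Nat.rec (motive := fun _ => ℕ) 1 (fun _ y => y * a) b :=
    Primrec.nat_rec' Primrec.snd (Primrec.const 1)
      (Primrec.nat_mul.comp (Primrec.snd.comp Primrec.snd)
        (Primrec.fst.comp Primrec.fst)).to₂
  refine h.of_eq fun a b => ?_
  induction b with
  | zero => rfl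
  | succ b ih => simp only at ih ⊢; rw [ih, pow_succ]

/-- The encoding contains two `n × n` matrices and separators, so `max n 1` is at most the size of
the instance. -/
theorem DecidesInTime.isFPT {p : Prog} {L : Instance → Prop} {param : Instance → ℕ} {f : ℕ → ℕ}
    (hf : Primrec f)
    (h : DecidesInTime p L fun I => f (param I) * max I.n 1 ^ 3) : IsFPT L param := by
  refine ⟨p, f, 3, hf.to_comp, ?_⟩
  obtain ⟨c, h⟩ := h
  refine ⟨c, fun I => ?_⟩
  obtain ⟨s, t, h1, h2, h3⟩ := h I
  refine ⟨s, t, h1, h2.trans (Nat.mul_le_mul_left _ (Nat.pow_le_pow_left ?_ _)), h3⟩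
  simp only [Instance.size]
  have := le_sq I.n
  have : I.n ^ 2 = I.n * I.n := sq _
  omega

/-! ### Graphs as relations on natural numbers -/

def adjRel {n : ℕ} (G : SimpleGraph (Fin n)) (u v : ℕ) : Prop :=
  ∃ (hu : u < n) (hv : v < n), G.Adj ⟨u, hu⟩ ⟨v, hv⟩

/-- The reflexive closure of adjacency. -/
def relOf {n : ℕ} (G : SimpleGraph (Fin n)) (u v : ℕ) : Prop := u = v ∨ adjRel G u v

theorem adjRel_iff {n : ℕ} {G : SimpleGraph (Fin n)} {a b : Fin n} :
    adjRel G a b ↔ G.Adj a b := ⟨fun ⟨_, _, h⟩ => h, fun h => ⟨a.2, b.2, h⟩⟩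

theorem relOf_coe_iff {n : ℕ} {G : SimpleGraph (Fin n)} {a b : Fin n} :
    relOf G a b ↔ a = b ∨ G.Adj a b := by rw [relOf, adjRel_iff, Fin.val_inj]

theorem adjRel_symm {n : ℕ} {G : SimpleGraph (Fin n)} {u v : ℕ} (h : adjRel G u v) :
    adjRel G v u := by obtain ⟨hu, hv, h⟩ := h; exact ⟨hv, hu, h.symm⟩

theorem adjRel_ne {n : ℕ} {G : SimpleGraph (Fin n)} {u v : ℕ} (h : adjRel G u v) : u ≠ v := by
  rintro rfl; obtain ⟨_, _, h⟩ := h; exact G.loopless.irrefl _ h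

theorem reflSymm_relOf {n : ℕ} (G : SimpleGraph (Fin n)) : ReflSymm (relOf G) where
  refl _ := Or.inl rfl
  symm h := h.imp Eq.symm adjRel_symm

theorem relOf_iff_adjRel {n : ℕ} {G : SimpleGraph (Fin n)} {p : ℕ × ℕ} (hp : p ∈ pairs n) :
    relOf G p.1 p.2 ↔ adjRel G p.1 p.2 := by
  rw [relOf, or_iff_right (mem_pairs.1 hp).1.ne]

theorem IsClusterGraph.transOn {n : ℕ} {G : SimpleGraph (Fin n)} (h : IsClusterGraph G) :
    TransOn n (relOf G) := by
  intro u v w hu hv hw huv hvw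
  rcases huv with rfl | ⟨_, _, huv⟩
  · exact hvw
  rcases hvw with rfl | ⟨_, _, hvw⟩
  · exact Or.inr ⟨_, _, huv⟩
  by_cases huw : u = w
  · exact Or.inl huw
  · refine Or.inr ⟨hu, hw, by_contra fun hcon => h ⟨u, hu⟩ ⟨v, hv⟩ ⟨w, hw⟩ ⟨huv, hvw, ?_, hcon⟩⟩
    simpa using huw

def graphOf (n : ℕ) (S : ℕ → ℕ → Prop) : SimpleGraph (Fin n) :=
  SimpleGraph.fromRel fun a b => S a b

theorem graphOf_adj {n : ℕ} {S : ℕ → ℕ → Prop} (hS : ReflSymm S) {a b : Fin n} :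
    (graphOf n S).Adj a b ↔ a ≠ b ∧ S a b := by
  rw [graphOf, SimpleGraph.fromRel_adj, or_iff_left_of_imp hS.symm]

theorem relOf_graphOf {n : ℕ} {S : ℕ → ℕ → Prop} (hS : ReflSymm S) {u v : ℕ} (hu : u < n)
    (hv : v < n) : relOf (graphOf n S) u v ↔ S u v := by
  have h : relOf (graphOf n S) (⟨u, hu⟩ : Fin n) (⟨v, hv⟩ : Fin n) ↔ _ := relOf_coe_iff
  rw [graphOf_adj hS] at h
  refine h.trans ⟨?_, fun h => ?_⟩
  · rintro (h | h)
    · rw [Fin.mk.injEq] at h; exact h ▸ hS.refl u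
    · exact h.2
  · by_cases huv : (⟨u, hu⟩ : Fin n) = ⟨v, hv⟩
    · exact Or.inl huv
    · exact Or.inr ⟨huv, h⟩

theorem isClusterGraph_graphOf {n : ℕ} {S : ℕ → ℕ → Prop} (hS : ReflSymm S) (ht : TransOn n S) :
    IsClusterGraph (graphOf n S) := by
  rintro u v w ⟨h1, h2, h3, h4⟩
  rw [graphOf_adj hS] at h1 h2 h4
  exact h4 ⟨h3, ht u.2 v.2 w.2 h1.2 h2.2⟩

theorem distRel_congr {n : ℕ} {E E' F F' : ℕ → ℕ → Prop}
    (h : ∀ u v, u < n → v < n → (E u v ↔ F u v)) (h' : ∀ u v, u < n → v < n → (E' u v ↔ F' u v)) :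
    distRel n E E' = distRel n F F' := by
  classical
  rw [distRel, distRel]
  congr 1
  refine Finset.filter_congr fun p hp => ?_
  have := mem_pairs.1 hp
  rw [h _ _ (by omega) (by omega), h' _ _ (by omega) (by omega)]

theorem distRel_comm (n : ℕ) (E E' : ℕ → ℕ → Prop) : distRel n E E' = distRel n E' E := by
  classical
  rw [distRel, distRel]
  congr 1
  exact Finset.filter_congr fun p _ => not_congr iff_comm

open Classical in
-- Each unordered pair of distinct vertices is represented by its increasing ordering; `hA` excludes
-- loops.
theorem ncard_sym2_eq {n : ℕ} {A : Set (Sym2 (Fin n))} (hA : ∀ a, s(a, a) ∉ A) :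
    A.ncard = ((pairs n).filter fun p =>
      ∃ (hu : p.1 < n) (hv : p.2 < n), s((⟨p.1, hu⟩ : Fin n), ⟨p.2, hv⟩) ∈ A).card := by
  rw [Set.ncard_eq_toFinset_card']
  symm
  refine Finset.card_bij (fun p hp => s((⟨p.1, ?_⟩ : Fin n), ⟨p.2, ?_⟩)) ?_ ?_ ?_
  · exact (Finset.mem_filter.1 hp).2.1
  · exact (Finset.mem_filter.1 hp).2.2.1
  · intro p hp
    obtain ⟨_, _, _, h⟩ := Finset.mem_filter.1 hp
    exact Set.mem_toFinset.2 h
  · intro p hp q hq h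
    have h1 := (mem_pairs.1 (Finset.mem_filter.1 hp).1).1
    have h2 := (mem_pairs.1 (Finset.mem_filter.1 hq).1).1
    simp only [Sym2.eq_iff, Fin.mk.injEq] at h
    ext <;> omega
  · intro e he
    rw [Set.mem_toFinset] at he
    induction e using Sym2.ind with
    | _ a b =>
      rcases lt_trichotomy a.1 b.1 with h | h | h
      · exact ⟨(a.1, b.1), Finset.mem_filter.2 ⟨mem_pairs.2 ⟨h, b.2⟩, a.2, b.2, he⟩, rfl⟩
      · exact absurd he (Fin.ext h ▸ hA a)
      · exact ⟨(b.1, a.1), Finset.mem_filter.2 ⟨mem_pairs.2 ⟨h, a.2⟩, b.2, a.2, Sym2.eq_swap ▸ he⟩,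
          Sym2.eq_swap⟩

theorem edgeDist_eq {n : ℕ} (G G' : SimpleGraph (Fin n)) :
    edgeDist G G' = distRel n (relOf G) (relOf G') := by
  classical
  rw [edgeDist, ncard_sym2_eq, distRel]
  · congr 1
    refine Finset.filter_congr fun p hp => ?_
    rw [relOf_iff_adjRel hp, relOf_iff_adjRel hp]
    have hp' := mem_pairs.1 hp
    have hu : p.1 < n := by omega
    have hv : p.2 < n := by omega
    simp only [adjRel, hu, hv, exists_true_left, Set.mem_symmDiff, SimpleGraph.mem_edgeSet]
    tauto
  · intro a h
    rcases h with h | h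
    · exact G.loopless.irrefl _ h.1
    · exact G'.loopless.irrefl _ h.1

theorem edgeSet_subset_iff {n : ℕ} (G G' : SimpleGraph (Fin n)) :
    G.edgeSet ⊆ G'.edgeSet ↔ ∀ p ∈ pairs n, relOf G p.1 p.2 → relOf G' p.1 p.2 := by
  rw [SimpleGraph.edgeSet_subset_edgeSet]
  constructor
  · rintro h p hp (h1 | ⟨hu, hv, h1⟩)
    · exact Or.inl h1
    · exact Or.inr ⟨hu, hv, h h1⟩
  · intro h a b hab
    rw [← adjRel_iff] at hab ⊢
    rcases lt_trichotomy a.1 b.1 with h1 | h1 | h1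
    · exact (relOf_iff_adjRel (mem_pairs.2 ⟨h1, b.2⟩)).1
        (h (a, b) (mem_pairs.2 ⟨h1, b.2⟩) (Or.inr hab))
    · exact absurd h1 (adjRel_ne hab)
    · exact adjRel_symm ((relOf_iff_adjRel (mem_pairs.2 ⟨h1, a.2⟩)).1
        (h (b, a) (mem_pairs.2 ⟨h1, a.2⟩) (Or.inr (adjRel_symm hab))))

theorem isMatrix_adjArray {n : ℕ} (G : SimpleGraph (Fin n)) :
    IsMatrix n (adjArray G) (ind (adjRel G)) := by
  intro p hp
  have h1 := div_lt_of_lt_sq hp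
  have h2 := mod_lt_of_lt_sq hp
  unfold adjArray ind
  congr 1
  refine propext ⟨?_, ?_⟩
  · rintro ⟨u, v, h, rfl⟩
    rw [cell_div v.2, cell_mod v.2]
    exact adjRel_iff.2 h
  · rintro ⟨hu, hv, h⟩
    exact ⟨_, _, h, (by simpa [mul_comm] using (Nat.div_add_mod p n).symm)⟩

/-- Cluster graphs amount to equivalence relations. -/
theorem exists_isClusterGraph_iff {n : ℕ} {P : (ℕ → ℕ → Prop) → Prop}
    (hP : ∀ S T : ℕ → ℕ → Prop, (∀ u v, u < n → v < n → (S u v ↔ T u v)) → P S → P T) :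
    (∃ G : SimpleGraph (Fin n), IsClusterGraph G ∧ P (relOf G)) ↔
      ∃ S, ReflSymm S ∧ TransOn n S ∧ P S := by
  constructor
  · rintro ⟨G, h1, h2⟩
    exact ⟨relOf G, reflSymm_relOf G, h1.transOn, h2⟩
  · rintro ⟨S, h1, h2, h3⟩
    exact ⟨graphOf n S, isClusterGraph_graphOf h1 h2,
      hP S _ (fun u v hu hv => (relOf_graphOf h1 hu hv).symm) h3⟩

theorem deletionEdge_iff (I : Instance) : DeletionEdge I ↔ ∃ S, ReflSymm S ∧ TransOn I.n S ∧
    (∀ p ∈ pairs I.n, S p.1 p.2 → relOf I.G p.1 p.2) ∧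
      distRel I.n (relOf I.G) S ≤ I.k ∧ distRel I.n S (relOf I.Gc) ≤ I.d := by
  rw [← exists_isClusterGraph_iff]
  · simp only [DeletionEdge, edgeSet_subset_iff, edgeDist_eq]
  · rintro S T h ⟨h1, h2, h3⟩
    rw [distRel_congr (fun _ _ _ _ => Iff.rfl) h] at h2
    rw [distRel_congr h (fun _ _ _ _ => Iff.rfl)] at h3
    refine ⟨fun p hp hT => h1 p hp ((h _ _ ?_ ?_).2 hT), h2, h3⟩ <;>
    have := mem_pairs.1 hp <;> omega

/-- The number of related pairs. -/
noncomputable def numPairs (n : ℕ) (E : ℕ → ℕ → Prop) : ℕ := ∑ p ∈ pairs n, ind E p.1 p.2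

theorem distRel_add_numPairs {n : ℕ} {E E' : ℕ → ℕ → Prop}
    (h : ∀ p ∈ pairs n, E p.1 p.2 → E' p.1 p.2) :
    numPairs n E + distRel n E E' = numPairs n E' := by
  classical
  rw [distRel, Finset.card_filter, numPairs, numPairs, ← Finset.sum_add_distrib]
  refine Finset.sum_congr rfl fun p hp => ?_
  have := h p hp
  unfold ind
  by_cases h1 : E p.1 p.2 <;> by_cases h2 : E' p.1 p.2 <;> simp_all

theorem numPairs_congr {n : ℕ} {E E' : ℕ → ℕ → Prop}
    (h : ∀ u v, u < n → v < n → (E u v ↔ E' u v)) : numPairs n E = numPairs n E' := by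
  refine Finset.sum_congr rfl fun p hp => ?_
  have := mem_pairs.1 hp
  unfold ind
  rw [h _ _ (by omega) (by omega)]

theorem numPairs_relOf {n : ℕ} (G : SimpleGraph (Fin n)) :
    numPairs n (relOf G) = numPairs n (adjRel G) := by
  refine Finset.sum_congr rfl fun p hp => ?_
  unfold ind
  rw [relOf_iff_adjRel hp]

theorem numPairs_le (n : ℕ) (E : ℕ → ℕ → Prop) : numPairs n E ≤ n * n := by
  unfold numPairs
  rw [← sum_range_pairs n (ind E)]
  refine (Finset.sum_le_card_nsmul _ _ 1 fun p _ => ?_).trans (by simp)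
  split
  · exact ind_le _ _ _
  · omega

/-- For a supergraph the distance to `G` is the difference of the edge numbers, so the budget turns
into a bound on the number of edges of the solution. -/
theorem edgeDist_le_iff {n k : ℕ} {G : SimpleGraph (Fin n)} {S : ℕ → ℕ → Prop}
    (h : ∀ p ∈ pairs n, relOf G p.1 p.2 → S p.1 p.2) :
    distRel n (relOf G) S ≤ k ↔ numPairs n S ≤ k + numPairs n (adjRel G) := by
  have := distRel_add_numPairs h
  rw [numPairs_relOf] at this
  omega

theorem completionEdge_iff (I : Instance) : CompletionEdge I ↔ ∃ S, ReflSymm S ∧ TransOn I.n S ∧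
    (∀ p ∈ pairs I.n, relOf I.G p.1 p.2 → S p.1 p.2) ∧
      numPairs I.n S ≤ I.k + numPairs I.n (adjRel I.G) ∧ distRel I.n (relOf I.Gc) S ≤ I.d := by
  rw [← exists_isClusterGraph_iff]
  · simp only [CompletionEdge, edgeSet_subset_iff, edgeDist_eq, distRel_comm I.n (relOf I.Gc)]
    refine exists_congr fun G' => and_congr_right fun _ => and_congr_right fun h => ?_
    rw [edgeDist_le_iff h]
  · rintro S T h ⟨h1, h2, h3⟩
    rw [numPairs_congr h] at h2
    rw [distRel_congr (fun _ _ _ _ => Iff.rfl) h] at h3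
    refine ⟨fun p hp hT => (h _ _ ?_ ?_).1 (h1 p hp hT), h2, h3⟩ <;>
    have := mem_pairs.1 hp <;> omega

/-! ### The programs for edge distances -/

/-- Cells `p < n * n` of the arrays `2`, `3`, `4` become the values of the given expressions, which
read `p` from register `10`. -/
def fillMatrices (e₂ e₃ e₄ : Expr) : Prog :=
  forLoop 10 6 (.seq (.write 2 (.reg 10) e₂) (.seq (.write 3 (.reg 10) e₃)
    (.write 4 (.reg 10) e₄)))

/-- The three expressions are evaluated between writes to the arrays `2`, `3`, `4`. They must
therefore have the prescribed values in every memory reachable by the program, not only at the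
start. -/
theorem Tri.fillMatrices {B n : ℕ} {e₂ e₃ e₄ : Expr} {s : Store} {W₂ W₃ W₄ : ℕ → ℕ → ℕ}
    (hs : HasSize n s) (hB : n * n ≤ B)
    (he : ∀ s', Agree (DynCluster.fillMatrices e₂ e₃ e₄) s s' → ∀ p < n * n, s'.reg 10 = p →
      e₂.eval s' = W₂ (p / n) (p % n) ∧ e₃.eval s' = W₃ (p / n) (p % n) ∧
        e₄.eval s' = W₄ (p / n) (p % n))
    (h₂ : ∀ u v, u < n → v < n → W₂ u v ≤ B) (h₃ : ∀ u v, u < n → v < n → W₃ u v ≤ B)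
    (h₄ : ∀ u v, u < n → v < n → W₄ u v ≤ B) :
    Tri B (fillMatrices e₂ e₃ e₄) s (n * n * (e₂.cost + e₃.cost + e₄.cost + 14) + 6) fun s' =>
      IsMatrix n (s'.arr 2) W₂ ∧ IsMatrix n (s'.arr 3) W₃ ∧ IsMatrix n (s'.arr 4) W₄ := by
  refine (Tri.forLoop (T := e₂.cost + e₃.cost + e₄.cost + 6) (N := n * n) (fun i s' => ∀ p < i,
    s'.arr 2 p = W₂ (p / n) (p % n) ∧ s'.arr 3 p = W₃ (p / n) (p % n) ∧
      s'.arr 4 p = W₄ (p / n) (p % n)) rfl rfl (by decide) hs.r6 hB (by simp) ?_).mono le_rfl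
    fun s' _ h => ⟨fun p hp => (h.2 p hp).1, fun p hp => (h.2 p hp).2.1,
      fun p hp => (h.2 p hp).2.2⟩
  intro i s' hi hx _ hag hinv
  have hd := div_lt_of_lt_sq hi
  have hm := mod_lt_of_lt_sq hi
  have hag' : ∀ {s₁ s₂ : Store} {e : Expr} {a : ℕ}, a = 2 ∨ a = 3 ∨ a = 4 →
      Agree (.write a (.reg 10) e) s₁ s₂ → Agree (DynCluster.fillMatrices e₂ e₃ e₄) s s₁ →
      Agree (DynCluster.fillMatrices e₂ e₃ e₄) s s₂ := by
    intro s₁ s₂ e a ha h h'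
    refine h'.trans (h.mono (fun _ _ => rfl) fun x hx => ?_)
    simp only [DynCluster.fillMatrices, DynCluster.forLoop, Prog.writesArr,
      Bool.or_eq_false_iff, beq_eq_false_iff_ne] at hx ⊢
    rcases ha with rfl | rfl | rfl <;> tauto
  have E₁ := he s' hag i hi hx
  refine Tri.mono (Tri.seq (Tri.write (by simp; omega) (by rw [E₁.1]; exact h₂ _ _ hd hm) ?_))
    (T₁ := ((Expr.reg 10).cost + e₂.cost + 1) + (((Expr.reg 10).cost + e₃.cost + 1) +
      ((Expr.reg 10).cost + e₄.cost + 1)))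
    (by simp; omega) fun _ _ h => h
  intro hag₁
  have E₂ := he _ (hag' (Or.inl rfl) hag₁ hag) i hi (by simpa using hx)
  refine Tri.seq (Tri.write (by simp; omega) (by rw [E₂.2.1]; exact h₃ _ _ hd hm) ?_)
  intro hag₂
  have E₃ := he _ (hag' (Or.inr (Or.inl rfl)) hag₂ (hag' (Or.inl rfl) hag₁ hag)) i hi
    (by simpa using hx)
  refine Tri.write (by simp; omega) (by rw [E₃.2.2]; exact h₄ _ _ hd hm) ?_
  intro p hp
  rw [E₁.1] at E₂ E₃ ⊢
  rw [E₂.2.1] at E₃ ⊢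
  rw [E₃.2.2]
  by_cases hpi : p = i
  · subst hpi; simp [hx]
  · have := hinv p (by omega)
    simpa [hx, hpi] using this

/-- Set up the matrices, solve the common problem, and return the answer. -/
def solveWith (e₂ e₃ e₄ : Expr) : Prog :=
  .seq (fillMatrices e₂ e₃ e₄) (.seq coreProg (.ite (.reg 8) (.assign 0 1) (.assign 0 0)))

theorem Tri.solveWith {B n K thr W : ℕ} {e₂ e₃ e₄ : Expr} {s : Store} {E : ℕ → ℕ → Prop}
    {Wk Wc : ℕ → ℕ → ℕ} (hs : HasSize n s) (hE : ReflSymm E)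
    (he : ∀ s', Agree (DynCluster.fillMatrices e₂ e₃ e₄) s s' → ∀ p < n * n, s'.reg 10 = p →
      e₂.eval s' = ind E (p / n) (p % n) ∧ e₃.eval s' = Wk (p / n) (p % n) ∧
        e₄.eval s' = Wc (p / n) (p % n))
    (hB : n * n * n ≤ B) (hW : W ≤ B) (hWB : n * n * W ≤ B) (hKB : K + 3 ≤ B) (hthr : thr + 1 ≤ B)
    (hWk : ∀ u v, Wk u v ≤ W) (hWc : ∀ u v, Wc u v ≤ W) (h3 : s.reg 3 = K) (h4 : s.reg 4 = thr)
    (h6 : s.arr 6 = fun _ => 0) (h7 : s.arr 7 = fun _ => 0) (h8 : s.reg 8 = 0)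
    (hmono : ∀ u v, u < v → v < n → ¬ E u v → Wc u v ≤ Wk u v) :
    Tri B (solveWith e₂ e₃ e₄) s
      ((n * n * n + 3) * ((e₂.cost + e₃.cost + e₄.cost + 20) * coreTime K)) fun s' =>
        (s'.reg 0 ≠ 0 ↔ ∃ S, ReflSymm S ∧ TransOn n S ∧ distRel n E S ≤ K ∧
          weight n Wk Wc S ≤ thr) := by
  have hn := sq_le_cube n
  have hcore : 20 ≤ coreTime K := by rw [coreTime]; omega
  refine Tri.mono (Tri.seq ((Tri.fillMatrices hs (by omega) he
    (fun u v _ _ => (ind_le _ _ _).trans (by omega)) (fun u v _ _ => (hWk u v).trans hW)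
    (fun u v _ _ => (hWc u v).trans hW)).mono le_rfl fun s₁ hag₁ ⟨m2, m3, m4⟩ _ =>
    Tri.seq ((Tri.coreProg (hs.agree hag₁ (by simp [DynCluster.fillMatrices, DynCluster.forLoop,
      Prog.writesReg])) hE m2 m3 m4 hB hWB hKB hthr hWk hWc ((hag₁.reg 3 rfl).trans h3)
      ((hag₁.reg 4 rfl).trans h4) ((hag₁.arr 6 rfl).trans h6) ((hag₁.arr 7 rfl).trans h7)
      ((hag₁.reg 8 rfl).trans h8) hmono).mono le_rfl fun s₂ _ h _ => ?_)))
    (T₁ := n * n * (e₂.cost + e₃.cost + e₄.cost + 14) + 6 +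
      ((n * n * n + 3) * coreTime K + 4)) ?_ fun _ _ h => h
  · refine (Tri.ite (T := 2) (fun h8 => Tri.assign (by simp; omega) ?_)
      fun h8 => Tri.assign (by simp) ?_).mono (by simp) fun _ _ h => h
    · simpa using h.1 (by simpa using h8)
    · simpa using fun h' => h.2 h' (by simpa using h8)
  · obtain ⟨c, hc⟩ : ∃ c, e₂.cost + e₃.cost + e₄.cost = c := ⟨_, rfl⟩
    rw [hc]
    have h1 : n * n * (c + 14) ≤ n * n * n * (c + 14) := Nat.mul_le_mul_right _ hn
    have h2 : (n * n * n + 3) * ((c + 20) * 1) ≤ (n * n * n + 3) * ((c + 19) * coreTime K) :=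
      Nat.mul_le_mul_left _ (by nlinarith)
    nlinarith

theorem init_reg (I : Instance) (x : ℕ) (hx : 2 < x) : I.init.reg x = 0 := by
  simp only [Instance.init]
  rw [if_neg (by omega), if_neg (by omega), if_neg (by omega)]

theorem init_arr (I : Instance) (a : ℕ) (ha : 1 < a) : I.init.arr a = fun _ => 0 := by
  funext i
  simp only [Instance.init]
  rw [if_neg (by omega), if_neg (by omega)]

/-- One exponent serves all three problems. Up to `X ^ 4` would suffice here; the larger exponent
leaves room for the constant factor in the threshold of the matching problem. -/
theorem word_bounds (n k d : ℕ) :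
    ∃ X, X = n + k + d + 2 ∧ n * n * n ≤ X ^ 6 ∧ n * n * (d + 1) ≤ X ^ 6 ∧ d + 3 ≤ X ^ 6 ∧
      k + n * n + 2 ≤ X ^ 6 ∧ n * n * (k + n * n + 1) ≤ X ^ 6 := by
  refine ⟨_, rfl, ?_⟩
  obtain ⟨X, hX⟩ : ∃ X, X = n + k + d + 2 := ⟨_, rfl⟩
  rw [← hX]
  have h1 : 1 ≤ X := by omega
  have h3 : X ^ 3 ≤ X ^ 6 := Nat.pow_le_pow_right h1 (by omega)
  have h2 : X ^ 2 ≤ X ^ 6 := Nat.pow_le_pow_right h1 (by omega)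
  have h4 : X ^ 4 ≤ X ^ 6 := Nat.pow_le_pow_right h1 (by omega)
  have hn : n ≤ X := by omega
  have hnn : n * n ≤ X ^ 2 := by rw [sq]; exact Nat.mul_le_mul hn hn
  have e : k + n * n + 2 ≤ X ^ 2 := by subst hX; nlinarith
  refine ⟨le_trans ?_ h3, le_trans ?_ h3, le_trans ?_ h2, e.trans h2, le_trans ?_ h4⟩
  · rw [pow_succ]; exact Nat.mul_le_mul hnn hn
  · rw [pow_succ]; exact Nat.mul_le_mul hnn (by omega)
  · subst hX; nlinarith
  · rw [pow_add X 2 2]; exact Nat.mul_le_mul hnn (by omega)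

/-- `K` and `D` are kept apart because Completion runs the core with what remains of `d` after the
unavoidable differences, whereas its bound is stated in `d`. -/
theorem exists_time_le (c : ℕ) : ∃ C, ∀ n K D, K ≤ D →
    n * n * c + c + (n * n * n + 3) * (c * coreTime K) ≤
      C * max D 1 ^ (D + 1) * max n 1 ^ 3 := by
  obtain ⟨C, hC, h⟩ := exists_coreTime_le
  refine ⟨8 * c * C, fun n K D hKD => ?_⟩
  have h1 := cube_add_le n
  have h2 := sq_le_cube n
  have h3 := h K
  have h4 : max K 1 ^ (K + 1) ≤ max D 1 ^ (D + 1) :=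
    (Nat.pow_le_pow_left (max_le_max hKD le_rfl) _).trans
      (Nat.pow_le_pow_right (by omega) (by omega))
  have hcore : 1 ≤ coreTime K := by rw [coreTime]; omega
  obtain ⟨X, hX⟩ : ∃ X, X = n * n * n := ⟨_, rfl⟩
  rw [← hX] at h1 h2 ⊢
  calc n * n * c + c + (X + 3) * (c * coreTime K)
      ≤ (X + 3) * (c * coreTime K) + (X + 3) * (c * coreTime K) := by
        have : (X + 3) * (c * 1) ≤ (X + 3) * (c * coreTime K) :=
          Nat.mul_le_mul_left _ (Nat.mul_le_mul_left _ hcore)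
        have : n * n * c ≤ X * c := Nat.mul_le_mul_right _ h2
        nlinarith
    _ = (X + 3) * (2 * c * coreTime K) := by ring
    _ ≤ (4 * max n 1 ^ 3) * (2 * c * (C * max D 1 ^ (D + 1))) :=
        Nat.mul_le_mul h1 (Nat.mul_le_mul_left _ (h3.trans (Nat.mul_le_mul_left _ h4)))
    _ = _ := by ring

/-! ### Deletion with the edge distance -/

def deletionEdgeProg : Prog :=
  .seq (.seq (.assign 6 (.reg 0 * .reg 0)) (.seq (.assign 7 (.reg 6 * .reg 0))
    (.seq (.assign 3 (.reg 1)) (.assign 4 (.reg 2))))) <|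
  solveWith (.equal (.reg 10 / .reg 0) (.reg 10 % .reg 0) + .read 0 (.reg 10))
    (.read 0 (.reg 10) * (1 - .read 1 (.reg 10)) + (1 - .read 0 (.reg 10)) * (.reg 2 + 1))
    (.read 1 (.reg 10))

open Classical in
-- Joining a non-edge of `G` alone costs `d + 1`, which enforces `S ⊆ G`. For such `S`, a kept pair
-- costs 1 if it is missing in `Gc` and a cut pair costs 1 if it is present there: the weight is the
-- distance to `Gc`.
theorem weight_deletion_le_iff {n d : ℕ} {G Gc : SimpleGraph (Fin n)} {S : ℕ → ℕ → Prop} :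
    weight n (fun u v => if adjRel G u v then 1 - ind (adjRel Gc) u v else d + 1)
        (ind (adjRel Gc)) S ≤ d ↔
      (∀ p ∈ pairs n, S p.1 p.2 → relOf G p.1 p.2) ∧ distRel n S (relOf Gc) ≤ d := by
  have key : (∀ p ∈ pairs n, S p.1 p.2 → relOf G p.1 p.2) →
      weight n (fun u v => if adjRel G u v then 1 - ind (adjRel Gc) u v else d + 1)
        (ind (adjRel Gc)) S = distRel n S (relOf Gc) := by
    intro h
    rw [weight, distRel, Finset.card_filter]
    refine Finset.sum_congr rfl fun p hp => ?_
    have h' := h p hp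
    rw [relOf_iff_adjRel hp] at h' ⊢
    unfold ind
    by_cases h1 : S p.1 p.2 <;> by_cases h2 : adjRel Gc p.1 p.2 <;> simp_all
  constructor
  · intro h
    have hsub : ∀ p ∈ pairs n, S p.1 p.2 → relOf G p.1 p.2 := by
      intro p hp hS
      by_contra hcon
      rw [relOf_iff_adjRel hp] at hcon
      have := (Finset.single_le_sum (f := fun p => if S p.1 p.2 then
        (if adjRel G p.1 p.2 then 1 - ind (adjRel Gc) p.1 p.2 else d + 1)
        else ind (adjRel Gc) p.1 p.2) (fun _ _ => Nat.zero_le _) hp).trans h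
      simp only [hS, hcon, if_true, if_false] at this
      omega
    exact ⟨hsub, (key hsub) ▸ h⟩
  · rintro ⟨h1, h2⟩
    rwa [key h1]

theorem eval_relOf {n p : ℕ} (G : SimpleGraph (Fin n)) :
    (if p / n = p % n then 1 else 0) + ind (adjRel G) (p / n) (p % n) =
      ind (relOf G) (p / n) (p % n) := by
  by_cases h : p / n = p % n
  · have h' : ¬ adjRel G (p / n) (p % n) := fun h' => adjRel_ne h' h
    rw [if_pos h, ind_eq_zero h', ind_eq_one (Or.inl h)]
  · rw [if_neg h, zero_add]
    unfold ind relOf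
    congr 1
    simp only [h, false_or]

theorem exists_decides_deletionEdge : ∃ C, DecidesInTime deletionEdgeProg DeletionEdge
    fun I => C * max I.k 1 ^ (I.k + 1) * max I.n 1 ^ 3 := by
  classical
  obtain ⟨C, hC⟩ := exists_time_le 60
  refine ⟨C, 6, fun I => ?_⟩
  obtain ⟨X, hX, b1, b2, b3, b4, b5⟩ := word_bounds I.n I.k I.d
  -- With `k` and `d` exchanged, the same bounds also show that `k + 3` fits into a word.
  obtain ⟨X', hX', b1', b2', b3', b4', b5'⟩ := word_bounds I.n I.d I.k
  obtain rfl : X' = X := by omega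
  rw [← hX]
  generalize X' ^ 6 = B at *
  have hm0 : IsMatrix I.n (I.init.arr 0) (ind (adjRel I.G)) := isMatrix_adjArray I.G
  have hm1 : IsMatrix I.n (I.init.arr 1) (ind (adjRel I.Gc)) := isMatrix_adjArray I.Gc
  have hr0 : I.init.reg 0 = I.n := rfl
  have hr1 : I.init.reg 1 = I.k := rfl
  have hr2 : I.init.reg 2 = I.d := rfl
  have hn2 := sq_le_cube I.n
  have hmain : Tri B deletionEdgeProg I.init (20 + (I.n * I.n * I.n + 3) * (60 * coreTime I.k))
      fun s => (s.reg 0 ≠ 0 ↔ DeletionEdge I) := by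
    refine Tri.seq (Tri.loopFree (by simp [Prog.maxCost]) ?_ ?_)
    · simp [Prog.Ok, Prog.exec, hr0, hr1, hr2]
      omega
    intro hag
    refine (Tri.solveWith (n := I.n) (K := I.k) (thr := I.d) (W := I.d + 1) (E := relOf I.G)
      (Wk := fun u v => if adjRel I.G u v then 1 - ind (adjRel I.Gc) u v else I.d + 1)
      (Wc := ind (adjRel I.Gc)) ⟨?_, ?_, ?_⟩ (reflSymm_relOf _) ?_ b1 (by omega) b2 b3' (by omega)
      ?_ ?_ ?_ ?_ ?_ ?_ ?_ ?_).mono ?_ fun s _ h => ?_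
    · simp [Prog.exec, hr0]
    · simp [Prog.exec, hr0]
    · simp [Prog.exec, hr0]
    · intro s' hag' p hp h10
      have r0 : s'.reg 0 = I.n := by rw [hag'.reg 0 rfl]; simp [Prog.exec, hr0]
      have r2 : s'.reg 2 = I.d := by rw [hag'.reg 2 rfl]; simp [Prog.exec, hr2]
      have a0 : s'.arr 0 p = ind (adjRel I.G) (p / I.n) (p % I.n) := by
        rw [hag'.arr 0 rfl]; exact hm0 p hp
      have a1 : s'.arr 1 p = ind (adjRel I.Gc) (p / I.n) (p % I.n) := by
        rw [hag'.arr 1 rfl]; exact hm1 p hp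
      refine ⟨?_, ?_, ?_⟩
      · simp only [Expr.eval_add, Expr.eval_equal, Expr.eval_div, Expr.eval_mod, Expr.eval_reg,
          Expr.eval_read, h10, r0, a0]
        exact eval_relOf _
      · simp only [Expr.eval_add, Expr.eval_mul, Expr.eval_sub, Expr.eval_one, Expr.eval_reg,
          Expr.eval_read, h10, r2, a0, a1]
        by_cases h : adjRel I.G (p / I.n) (p % I.n)
        · rw [ind_eq_one h]; simp [h]
        · rw [ind_eq_zero h]; simp [h]
      · simp only [Expr.eval_reg, Expr.eval_read, h10, a1]
    · intro u v
      have := ind_le (adjRel I.Gc) u v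
      split <;> omega
    · intro u v
      exact (ind_le _ _ _).trans (by omega)
    · simp [Prog.exec, hr1]
    · simp [Prog.exec, hr2]
    · rw [hag.arr 6 rfl, init_arr I 6 (by omega)]
    · rw [hag.arr 7 rfl, init_arr I 7 (by omega)]
    · rw [hag.reg 8 rfl, init_reg I 8 (by omega)]
    -- Outside `G` a cut costs at most 1, and keeping costs `d + 1`.
    · intro u v _ _ h
      have h' : ¬ adjRel I.G u v := fun h' => h (Or.inr h')
      have := ind_le (adjRel I.Gc) u v
      simp only [h', if_false]
      omega
    · refine Nat.mul_le_mul_left _ (Nat.mul_le_mul_right _ ?_)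
      simp
    · rw [h, deletionEdge_iff]
      refine exists_congr fun S => and_congr_right fun _ => and_congr_right fun _ => ?_
      rw [weight_deletion_le_iff]
      tauto
  obtain ⟨s, t, h1, h2, h3⟩ := hmain
  refine ⟨s, t, h1, h2.trans (le_trans ?_ (hC I.n I.k I.k le_rfl)), h3⟩
  omega


/-- Register `40` counts the edges of `G`, register `41` those that are not in `Gc`. -/
def countEdges : Prog :=
  forLoop 10 6 <| .when (.less (.reg 10 / .reg 0) (.reg 10 % .reg 0)) <|
    .seq (.assign 40 (.reg 40 + .read 0 (.reg 10)))
      (.assign 41 (.reg 41 + .read 0 (.reg 10) * (1 - .read 1 (.reg 10))))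

theorem Tri.countEdges {B n : ℕ} {s : Store} {E E' : ℕ → ℕ → Prop} (hs : HasSize n s)
    (hB : n * n ≤ B) (h0 : IsMatrix n (s.arr 0) (ind E)) (h1 : IsMatrix n (s.arr 1) (ind E'))
    (h40 : s.reg 40 = 0) (h41 : s.reg 41 = 0) :
    Tri B countEdges s (n * n * 40 + 6) fun s' => s'.reg 40 = numPairs n E ∧
      s'.reg 41 = numPairs n (fun u v => E u v ∧ ¬ E' u v) := by
  classical
  have hcard : ∀ (i : ℕ) (F : ℕ → ℕ → Prop), ∑ p ∈ Finset.range i,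
      (if p / n < p % n then ind F (p / n) (p % n) else 0) ≤ i := by
    intro i F
    refine (Finset.sum_le_card_nsmul _ _ 1 fun p _ => ?_).trans (by simp)
    split
    · exact ind_le _ _ _
    · omega
  refine (Tri.forLoop (T := 32) (N := n * n) (fun i s' =>
    s'.reg 40 = ∑ p ∈ Finset.range i, (if p / n < p % n then ind E (p / n) (p % n) else 0) ∧
    s'.reg 41 = ∑ p ∈ Finset.range i, (if p / n < p % n then
      ind (fun u v => E u v ∧ ¬ E' u v) (p / n) (p % n) else 0)) rfl rfl (by decide) hs.r6 hB
    (by simp [h40, h41]) ?_).mono (by omega) fun s' _ h => ?_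
  · intro i s' hi hx _ hag ⟨e1, e2⟩
    have r0 : s'.reg 0 = n := (hag.reg 0 rfl).trans hs.r0
    have a0 : s'.arr 0 i = ind E (i / n) (i % n) := by rw [hag.arr 0 rfl]; exact h0 i hi
    have a1 : s'.arr 1 i = ind E' (i / n) (i % n) := by rw [hag.arr 1 rfl]; exact h1 i hi
    have l1 := hcard i E
    have l2 := hcard i fun u v => E u v ∧ ¬ E' u v
    rw [← e1] at l1
    rw [← e2] at l2
    have k1 := ind_le E (i / n) (i % n)
    have k2 : ind E (i / n) (i % n) * (1 - ind E' (i / n) (i % n)) =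
        ind (fun u v => E u v ∧ ¬ E' u v) (i / n) (i % n) := by
      unfold ind
      by_cases h1 : E (i / n) (i % n) <;> by_cases h2 : E' (i / n) (i % n) <;> simp [h1, h2]
    have k3 := ind_le (fun u v => E u v ∧ ¬ E' u v) (i / n) (i % n)
    refine Tri.loopFree (by simp [Prog.maxCost]) ?_ ?_
    · by_cases hlt : i / n < i % n
      · simp [Prog.Ok, Prog.exec, hx, r0, a0, a1, hlt, k2]
        omega
      · simp [Prog.Ok, hx, r0, hlt]
    · rw [Finset.sum_range_succ, Finset.sum_range_succ]
      by_cases hlt : i / n < i % n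
      · simp [Prog.exec, hx, r0, a0, a1, hlt, k2, e1, e2]
      · simp [Prog.exec, hx, r0, hlt, e1, e2]
  · rw [h.2.1, h.2.2, sum_range_pairs, sum_range_pairs n (ind fun u v => E u v ∧ ¬ E' u v)]
    exact ⟨rfl, rfl⟩

/-! ### Completion with the edge distance -/

def completionEdgeProg : Prog :=
  .seq (.seq (.assign 6 (.reg 0 * .reg 0)) (.assign 7 (.reg 6 * .reg 0))) <|
  .seq countEdges <|
  .ite (.less (.reg 41) (.reg 2 + 1))
    (.seq (.seq (.assign 4 (.reg 1 + .reg 40)) (.assign 3 (.reg 2 - .reg 41))) <|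
      solveWith (.less 0 (.equal (.reg 10 / .reg 0) (.reg 10 % .reg 0) + .read 0 (.reg 10) +
        .read 1 (.reg 10))) 1 (.read 0 (.reg 10) * (.reg 4 + 1)))
    (.assign 0 0)

/-- A pair of `G \ Gc` lies in `S` and contributes one difference whatever `S` is; on all other
pairs `Gc` and `G ∪ Gc` coincide. Branching can thus start from `G ∪ Gc` with the remaining distance
as its budget. -/
theorem distRel_union {n : ℕ} {G Gc : SimpleGraph (Fin n)} {S : ℕ → ℕ → Prop}
    (h : ∀ p ∈ pairs n, relOf G p.1 p.2 → S p.1 p.2) :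
    distRel n (relOf Gc) S = numPairs n (fun u v => adjRel G u v ∧ ¬ adjRel Gc u v) +
      distRel n (fun u v => relOf G u v ∨ relOf Gc u v) S := by
  classical
  rw [distRel, distRel, Finset.card_filter, Finset.card_filter, numPairs,
    ← Finset.sum_add_distrib]
  refine Finset.sum_congr rfl fun p hp => ?_
  have h' := h p hp
  simp only [relOf_iff_adjRel hp] at h' ⊢
  unfold ind
  by_cases h1 : S p.1 p.2 <;> by_cases h2 : adjRel Gc p.1 p.2 <;>
    by_cases h3 : adjRel G p.1 p.2 <;> simp_all

/-- Cutting an edge of `G` alone exceeds `t`, which enforces `G ⊆ S`; every kept pair counts 1. -/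
theorem weight_completion_le_iff {n t : ℕ} {G : SimpleGraph (Fin n)} {S : ℕ → ℕ → Prop} :
    weight n (fun _ _ => 1) (fun u v => ind (adjRel G) u v * (t + 1)) S ≤ t ↔
      (∀ p ∈ pairs n, relOf G p.1 p.2 → S p.1 p.2) ∧ numPairs n S ≤ t := by
  classical
  have key : (∀ p ∈ pairs n, relOf G p.1 p.2 → S p.1 p.2) →
      weight n (fun _ _ => 1) (fun u v => ind (adjRel G) u v * (t + 1)) S = numPairs n S := by
    intro h
    rw [weight, numPairs]
    refine Finset.sum_congr rfl fun p hp => ?_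
    have h' := h p hp
    rw [relOf_iff_adjRel hp] at h'
    unfold ind
    by_cases h1 : S p.1 p.2 <;> simp_all
  constructor
  · intro h
    have hsub : ∀ p ∈ pairs n, relOf G p.1 p.2 → S p.1 p.2 := by
      intro p hp hG
      by_contra hcon
      rw [relOf_iff_adjRel hp] at hG
      have := (Finset.single_le_sum (f := fun p => if S p.1 p.2 then 1 else
        ind (adjRel G) p.1 p.2 * (t + 1)) (fun _ _ => Nat.zero_le _) hp).trans h
      simp only [hcon, ind_eq_one hG, if_false] at this
      omega
    exact ⟨hsub, (key hsub) ▸ h⟩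
  · rintro ⟨h1, h2⟩
    rwa [key h1]

theorem eval_union {n p : ℕ} (G Gc : SimpleGraph (Fin n)) :
    (if 0 < (if p / n = p % n then 1 else 0) + ind (adjRel G) (p / n) (p % n) +
      ind (adjRel Gc) (p / n) (p % n) then 1 else 0) =
      ind (fun u v => relOf G u v ∨ relOf Gc u v) (p / n) (p % n) := by
  classical
  rw [eval_relOf]
  by_cases h : relOf G (p / n) (p % n)
  · rw [ind_eq_one h, ind_eq_one (E := fun u v => relOf G u v ∨ relOf Gc u v) (Or.inl h),
      if_pos (by omega)]
  · by_cases h' : adjRel Gc (p / n) (p % n)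
    · rw [ind_eq_one h', ind_eq_one (E := fun u v => relOf G u v ∨ relOf Gc u v)
        (Or.inr (Or.inr h')), if_pos (by omega)]
    · rw [ind_eq_zero h, ind_eq_zero h', ind_eq_zero (E := fun u v => relOf G u v ∨ relOf Gc u v),
        if_neg (by omega)]
      rintro (h1 | h1 | h1)
      · exact h h1
      · exact h (Or.inl h1)
      · exact h' h1

theorem exists_decides_completionEdge : ∃ C, DecidesInTime completionEdgeProg CompletionEdge
    fun I => C * max I.d 1 ^ (I.d + 1) * max I.n 1 ^ 3 := by
  classical
  obtain ⟨C, hC⟩ := exists_time_le 60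
  refine ⟨C, 6, fun I => ?_⟩
  obtain ⟨X, hX, b1, b2, b3, b4, b5⟩ := word_bounds I.n I.k I.d
  rw [← hX]
  generalize X ^ 6 = B at *
  have hm0 : IsMatrix I.n (I.init.arr 0) (ind (adjRel I.G)) := isMatrix_adjArray I.G
  have hm1 : IsMatrix I.n (I.init.arr 1) (ind (adjRel I.Gc)) := isMatrix_adjArray I.Gc
  have hr0 : I.init.reg 0 = I.n := rfl
  have hr1 : I.init.reg 1 = I.k := rfl
  have hr2 : I.init.reg 2 = I.d := rfl
  have hn2 := sq_le_cube I.n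
  obtain ⟨q, hq⟩ : ∃ q, q = numPairs I.n fun u v => adjRel I.G u v ∧ ¬ adjRel I.Gc u v := ⟨_, rfl⟩
  have hnum := numPairs_le I.n (adjRel I.G)
  have hmain : Tri B completionEdgeProg I.init (10 + (I.n * I.n * 40 + 6 +
      (6 + (15 + (I.n * I.n * I.n + 3) * (60 * coreTime (I.d - q))))))
      fun s => (s.reg 0 ≠ 0 ↔ CompletionEdge I) := by
    refine Tri.seq (Tri.loopFree (by simp [Prog.maxCost]) ?_ ?_)
    · simp [Prog.Ok, Prog.exec, hr0]
      omega
    intro hag₁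
    refine Tri.seq ((Tri.countEdges (n := I.n) (E := adjRel I.G) (E' := adjRel I.Gc)
      ⟨by simp [Prog.exec, hr0], by simp [Prog.exec, hr0], by simp [Prog.exec, hr0]⟩ (by omega)
      ?_ ?_ ?_ ?_).mono le_rfl ?_)
    · rw [hag₁.arr 0 rfl]; exact hm0
    · rw [hag₁.arr 1 rfl]; exact hm1
    · rw [hag₁.reg 40 rfl, init_reg I _ (by omega)]
    · rw [hag₁.reg 41 rfl, init_reg I _ (by omega)]
    rintro s₂ hag₂ ⟨e40, e41⟩ -
    rw [← hq] at e41
    have hs₂ : HasSize I.n s₂ :=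
      ⟨by rw [hag₂.reg 0 rfl]; simp [Prog.exec, hr0], by rw [hag₂.reg 6 rfl]; simp [Prog.exec, hr0],
        by rw [hag₂.reg 7 rfl]; simp [Prog.exec, hr0]⟩
    have r2 : s₂.reg 2 = I.d := by rw [hag₂.reg 2 rfl]; simp [Prog.exec, hr2]
    have r1 : s₂.reg 1 = I.k := by rw [hag₂.reg 1 rfl]; simp [Prog.exec, hr1]
    refine (Tri.ite (T := 15 + (I.n * I.n * I.n + 3) * (60 * coreTime (I.d - q)))
      (fun h => ?_) fun h => Tri.mono (Tri.assign (by simp) ?_)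
      (T₁ := 2) (by omega) fun _ _ h => h).mono (by simp) fun _ _ h => h
    · have hle : q ≤ I.d := by simp [e41, r2] at h; omega
      refine Tri.mono (Tri.seq (T₂ := (I.n * I.n * I.n + 3) * (60 * coreTime (I.d - q)))
        (Tri.loopFree (T := 15) (by simp [Prog.maxCost]) ?_ ?_)) le_rfl fun _ _ h => h
      · simp [Prog.Ok, Prog.exec, r1, e40, r2, e41]
        omega
      intro hag₃
      refine (Tri.solveWith (n := I.n) (K := I.d - q) (thr := I.k + numPairs I.n (adjRel I.G))
        (W := I.k + numPairs I.n (adjRel I.G) + 1)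
        (E := fun u v => relOf I.G u v ∨ relOf I.Gc u v) (Wk := fun _ _ => 1)
        (Wc := fun u v => ind (adjRel I.G) u v * (I.k + numPairs I.n (adjRel I.G) + 1))
        ⟨?_, ?_, ?_⟩ ⟨fun u => Or.inl (Or.inl rfl), fun h => h.imp (reflSymm_relOf _).symm
          (reflSymm_relOf _).symm⟩ ?_ b1 (by omega)
        (le_trans (Nat.mul_le_mul_left _ (by omega)) b5) (by omega) (by omega)
        ?_ ?_ ?_ ?_ ?_ ?_ ?_ ?_).mono ?_ fun s _ h => ?_
      · simp [Prog.exec, hs₂.r0]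
      · simp [Prog.exec, hs₂.r6]
      · simp [Prog.exec, hs₂.r7]
      · intro s' hag' p hp h10
        have r0 : s'.reg 0 = I.n := by rw [hag'.reg 0 rfl]; simp [Prog.exec, hs₂.r0]
        have r4 : s'.reg 4 = I.k + numPairs I.n (adjRel I.G) := by
          rw [hag'.reg 4 rfl]; simp [Prog.exec, r1, e40]
        have a0 : s'.arr 0 p = ind (adjRel I.G) (p / I.n) (p % I.n) := by
          rw [hag'.arr 0 rfl, hag₃.arr 0 rfl, hag₂.arr 0 rfl, hag₁.arr 0 rfl]; exact hm0 p hp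
        have a1 : s'.arr 1 p = ind (adjRel I.Gc) (p / I.n) (p % I.n) := by
          rw [hag'.arr 1 rfl, hag₃.arr 1 rfl, hag₂.arr 1 rfl, hag₁.arr 1 rfl]; exact hm1 p hp
        refine ⟨?_, rfl, ?_⟩
        · simp only [Expr.eval_add, Expr.eval_equal, Expr.eval_div, Expr.eval_mod, Expr.eval_reg,
            Expr.eval_read, Expr.eval_less, Expr.eval_zero, h10, r0, a0, a1]
          exact eval_union _ _
        · simp only [Expr.eval_add, Expr.eval_mul, Expr.eval_one, Expr.eval_reg,
            Expr.eval_read, h10, r4, a0]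
      · intro u v
        omega
      · intro u v
        exact (Nat.mul_le_mul_right _ (ind_le _ _ _)).trans (by omega)
      · simp [Prog.exec, r2, e41]
      · simp [Prog.exec, r1, e40]
      · rw [hag₃.arr 6 rfl, hag₂.arr 6 rfl, hag₁.arr 6 rfl, init_arr I 6 (by omega)]
      · rw [hag₃.arr 7 rfl, hag₂.arr 7 rfl, hag₁.arr 7 rfl, init_arr I 7 (by omega)]
      · rw [hag₃.reg 8 rfl, hag₂.reg 8 rfl, hag₁.reg 8 rfl, init_reg I 8 (by omega)]
      · intro u v _ _ h
        have h' : ¬ adjRel I.G u v := fun h' => h (Or.inl (Or.inr h'))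
        simp [ind_eq_zero h']
      · refine Nat.mul_le_mul_left _ (Nat.mul_le_mul_right _ ?_)
        simp
      · rw [h, completionEdge_iff]
        refine exists_congr fun S => and_congr_right fun _ => and_congr_right fun _ => ?_
        rw [weight_completion_le_iff]
        constructor
        · rintro ⟨h1, h2, h3⟩
          refine ⟨h2, h3, ?_⟩
          rw [distRel_union h2, ← hq]
          omega
        · rintro ⟨h1, h2, h3⟩
          rw [distRel_union h1, ← hq] at h3
          exact ⟨by omega, h1, h2⟩
    -- The unavoidable differences already exceed `d`.
    · have hlt : I.d < q := by simp [e41, r2] at h; omega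
      simp only [Expr.eval_zero, Store.setReg_reg, if_true, ne_eq, not_true_eq_false, false_iff]
      rw [completionEdge_iff]
      rintro ⟨S, -, -, h1, h2, h3⟩
      rw [distRel_union h1, ← hq] at h3
      omega
  obtain ⟨s, t, h1, h2, h3⟩ := hmain
  refine ⟨s, t, h1, h2.trans (le_trans ?_ (hC I.n (I.d - q) I.d (by omega))), h3⟩
  omega

section

/-! ### The matching-based distance -/

section

variable {V : Type*} [Fintype V] {G₁ G₂ : SimpleGraph V}

open Classical in
/-- The weight of a matching counts the vertices whose two clusters are matched. -/
theorem sum_overlap (M : Finset (G₁.ConnectedComponent × G₂.ConnectedComponent)) :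
    ∑ e ∈ M, overlap e = (Finset.univ.filter fun v : V =>
      (G₁.connectedComponentMk v, G₂.connectedComponentMk v) ∈ M).card := by
  have hmaps : Set.MapsTo (fun v => (G₁.connectedComponentMk v, G₂.connectedComponentMk v))
      (Finset.univ.filter fun v : V =>
        (G₁.connectedComponentMk v, G₂.connectedComponentMk v) ∈ M) M :=
    fun v hv => (Finset.mem_filter.1 hv).2
  rw [Finset.card_eq_sum_card_fiberwise hmaps]
  refine Finset.sum_congr rfl fun e he => ?_
  rw [overlap, Set.ncard_eq_toFinset_card']
  congr 1
  ext v
  simp only [Set.mem_toFinset, Set.mem_inter_iff, SimpleGraph.ConnectedComponent.mem_supp_iff,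
    Finset.mem_filter, Finset.mem_univ, true_and]
  constructor
  · rintro ⟨h1, h2⟩
    have : (G₁.connectedComponentMk v, G₂.connectedComponentMk v) = e := Prod.ext h1 h2
    exact ⟨this ▸ he, this⟩
  · rintro ⟨-, rfl⟩
    exact ⟨rfl, rfl⟩

open Classical in
-- The vertices split into those whose two clusters are matched and the rest, so the distance is the
-- least possible number of the rest. This removes the supremum and the truncated subtraction; the
-- supremum is attained since there are finitely many matchings.
theorem matchingDist_le_iff {d : ℕ} : matchingDist G₁ G₂ ≤ d ↔
    ∃ M : Finset (G₁.ConnectedComponent × G₂.ConnectedComponent), IsPairMatching M ∧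
      (Finset.univ.filter fun v : V =>
        (G₁.connectedComponentMk v, G₂.connectedComponentMk v) ∉ M).card ≤ d := by
  have hcard : ∀ M : Finset (G₁.ConnectedComponent × G₂.ConnectedComponent),
      (∑ e ∈ M, overlap e) + (Finset.univ.filter fun v : V =>
        (G₁.connectedComponentMk v, G₂.connectedComponentMk v) ∉ M).card = Nat.card V := by
    intro M
    rw [sum_overlap, Finset.card_filter_add_card_filter_not, Nat.card_eq_fintype_card,
      Finset.card_univ]
  have : Finite G₁.ConnectedComponent := Quot.finite _
  have : Finite G₂.ConnectedComponent := Quot.finite _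
  have : Fintype G₁.ConnectedComponent := Fintype.ofFinite _
  have : Fintype G₂.ConnectedComponent := Fintype.ofFinite _
  have : Nonempty {M : Finset (G₁.ConnectedComponent × G₂.ConnectedComponent) //
    IsPairMatching M} := ⟨⟨∅, by simp [IsPairMatching]⟩⟩
  rw [matchingDist, maxMatchingWeight]
  constructor
  · intro h
    obtain ⟨M, hM⟩ := exists_eq_ciSup_of_finite
      (f := fun M : {M : Finset (G₁.ConnectedComponent × G₂.ConnectedComponent) //
        IsPairMatching M} => ∑ e ∈ M.1, overlap e)
    refine ⟨M.1, M.2, ?_⟩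
    rw [← hM] at h
    have := hcard M.1
    omega
  · rintro ⟨M, hM, h⟩
    have h1 := le_ciSup (Set.finite_range
      (fun M : {M : Finset (G₁.ConnectedComponent × G₂.ConnectedComponent) //
        IsPairMatching M} => ∑ e ∈ M.1, overlap e)).bddAbove ⟨M, hM⟩
    have := hcard M
    dsimp only at h1
    omega

end

/-- In a cluster graph a walk collapses to a single edge or to equality. -/
theorem IsClusterGraph.mk_eq_iff {n : ℕ} {G : SimpleGraph (Fin n)} (h : IsClusterGraph G)
    {a b : Fin n} : G.connectedComponentMk a = G.connectedComponentMk b ↔ relOf G a b := by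
  rw [SimpleGraph.ConnectedComponent.eq, relOf_coe_iff]
  constructor
  · rintro ⟨w⟩
    induction w with
    | nil => exact Or.inl rfl
    | cons hab _ ih =>
      have := h.transOn (Fin.is_lt _) (Fin.is_lt _) (Fin.is_lt _)
        (relOf_coe_iff.2 (Or.inr hab)) (relOf_coe_iff.2 ih)
      exact relOf_coe_iff.1 this
  · rintro (rfl | h)
    · exact SimpleGraph.Reachable.refl _
    · exact h.reachable

/-! ### Merging components -/

/-- `f` labels the connected components of the graph `E` by representatives. -/
structure IsLabeling (n : ℕ) (E : ℕ → ℕ → Prop) (f : ℕ → ℕ) : Prop where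
  lt : ∀ v < n, f v < n
  idem : ∀ v < n, f (f v) = f v
  eq : ∀ u v, u < n → v < n → E u v → f u = f v
  rel : ∀ S, ReflSymm S → TransOn n S → (∀ u v, u < n → v < n → E u v → S u v) →
    ∀ u v, u < n → v < n → f u = f v → S u v

theorem IsLabeling.eq_iff_relOf {n : ℕ} {G : SimpleGraph (Fin n)} {f : ℕ → ℕ}
    (hf : IsLabeling n (adjRel G) f) (hG : IsClusterGraph G) {u v : ℕ} (hu : u < n) (hv : v < n) :
    f u = f v ↔ relOf G u v := by
  refine ⟨hf.rel _ (reflSymm_relOf G) hG.transOn (fun _ _ _ _ h => Or.inr h) u v hu hv, ?_⟩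
  rintro (rfl | h)
  · rfl
  · exact hf.eq u v hu hv h

/-- The clusters that arise when each component `x` is put into the group `φ x`, group `0`
consisting of separate components. -/
def finalRel (lab φ : ℕ → ℕ) (u v : ℕ) : Prop :=
  lab u = lab v ∨ φ (lab u) = φ (lab v) ∧ φ (lab u) ≠ 0

theorem reflSymm_finalRel (lab φ : ℕ → ℕ) : ReflSymm (finalRel lab φ) where
  refl _ := Or.inl rfl
  symm h := h.imp Eq.symm fun ⟨h, h'⟩ => ⟨h.symm, h ▸ h'⟩

theorem finalRel_trans {lab φ : ℕ → ℕ} {u v w : ℕ} (h : finalRel lab φ u v)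
    (h' : finalRel lab φ v w) : finalRel lab φ u w := by
  unfold finalRel at *
  rcases h with h | h
  · rwa [h]
  · rcases h' with h' | h'
    · rw [← h']; exact Or.inr h
    · exact Or.inr ⟨h.1.trans h'.1, h.2⟩

/-- The number of vertices outside the group of their label in `gl`. -/
def misplaced (n : ℕ) (lab gl φ : ℕ → ℕ) : ℕ :=
  ((Finset.range n).filter fun v => φ (lab v) ≠ gl v + 1).card

/-- The number of related ordered pairs. -/
noncomputable def numOrdered (n : ℕ) (S : ℕ → ℕ → Prop) : ℕ :=
  ∑ u ∈ Finset.range n, ∑ v ∈ Finset.range n, ind S u v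

/-- Ordered pairs including the diagonal are counted because their number is the sum of the squared
cluster sizes, which is what the knapsack program can add up. -/
theorem numOrdered_eq {n : ℕ} {S : ℕ → ℕ → Prop} (hS : ReflSymm S) :
    numOrdered n S = 2 * numPairs n S + n := by
  have hsymm : ∀ u v, ind S u v = ind S v u := fun u v => by
    unfold ind
    congr 1
    exact propext ⟨hS.symm, hS.symm⟩
  have hsplit : ∀ p : ℕ × ℕ, ind S p.1 p.2 = (if p.1 < p.2 then ind S p.1 p.2 else 0) +
      (if p.2 < p.1 then ind S p.2 p.1 else 0) + if p.1 = p.2 then 1 else 0 := by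
    rintro ⟨u, v⟩
    rcases lt_trichotomy u v with h | h | h
    · simp [h, h.ne, not_lt_of_gt h]
    · simp [h, ind_eq_one (hS.refl v)]
    · simp [h, h.ne', not_lt_of_gt h, hsymm u v]
  have h1 : numPairs n S = ∑ u ∈ Finset.range n, ∑ v ∈ Finset.range n,
      if u < v then ind S u v else 0 := by
    rw [numPairs, pairs, Finset.sum_filter, Finset.sum_product]
  have h2 : numPairs n S = ∑ u ∈ Finset.range n, ∑ v ∈ Finset.range n,
      if v < u then ind S v u else 0 := by
    rw [h1, Finset.sum_comm]
  have h3 : ∑ u ∈ Finset.range n, ∑ v ∈ Finset.range n, (if u = v then 1 else 0) = n := by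
    rw [Finset.sum_congr rfl fun u hu => Finset.sum_ite_eq (Finset.range n) u _]
    rw [Finset.sum_congr rfl fun u hu => if_pos hu]
    simp
  calc numOrdered n S = ∑ u ∈ Finset.range n, ∑ v ∈ Finset.range n,
        ((if u < v then ind S u v else 0) + (if v < u then ind S v u else 0) +
          if u = v then 1 else 0) :=
        Finset.sum_congr rfl fun u _ => Finset.sum_congr rfl fun v _ => hsplit (u, v)
    _ = _ := by
        simp only [Finset.sum_add_distrib]
        rw [← h1, ← h2, h3]
        ring

theorem numPairs_mono {n : ℕ} {S S' : ℕ → ℕ → Prop}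
    (h : ∀ u v, u < n → v < n → S u v → S' u v) : numPairs n S ≤ numPairs n S' := by
  refine Finset.sum_le_sum fun p hp => ?_
  have := mem_pairs.1 hp
  by_cases h1 : S p.1 p.2
  · rw [ind_eq_one h1, ind_eq_one (h _ _ (by omega) (by omega) h1)]
  · rw [ind_eq_zero h1]; omega

theorem card_fin_filter {n : ℕ} (P : ℕ → Prop) [DecidablePred P] :
    (Finset.univ.filter fun v : Fin n => P v).card = ((Finset.range n).filter P).card := by
  refine Finset.card_bij (fun v _ => v.1) ?_ ?_ ?_
  · intro v hv; simpa using hv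
  · intro v _ w _ h; exact Fin.ext h
  · intro v hv
    simp only [Finset.mem_filter, Finset.mem_range] at hv
    exact ⟨⟨v, hv.1⟩, by simpa using hv.2, rfl⟩

/-- A solution with a matching assigns to each component the cluster of `Gc` matched with its own
cluster. Conversely, an assignment merges the components of each group, and matching the merged
groups with their clusters of `Gc` accounts for all vertices that are not misplaced. -/
theorem completionMatching_iff (I : Instance) {lab gl : ℕ → ℕ}
    (hlab : IsLabeling I.n (adjRel I.G) lab) (hgl : IsLabeling I.n (adjRel I.Gc) gl) :
    CompletionMatching I ↔ ∃ φ : ℕ → ℕ, misplaced I.n lab gl φ ≤ I.d ∧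
      numOrdered I.n (finalRel lab φ) ≤ 2 * (I.k + numPairs I.n (adjRel I.G)) + I.n := by
  classical
  constructor
  · rintro ⟨G', h1, h2, h3, h4⟩
    rw [matchingDist_le_iff] at h4
    obtain ⟨M, hM, h4⟩ := h4
    rw [edgeSet_subset_iff] at h2
    rw [edgeDist_eq, edgeDist_le_iff h2] at h3
    -- The cluster of `x` in `G'` is matched with the cluster of `w` in `Gc`. Labels are shifted by
    -- one in `φ` to keep `0` for "separate".
    let mt : ℕ → ℕ → Prop := fun x w => ∃ (hx : x < I.n) (hw : w < I.n),
      (G'.connectedComponentMk ⟨x, hx⟩, I.Gc.connectedComponentMk ⟨w, hw⟩) ∈ M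
    have hmt : ∀ x w w', mt x w → mt x w' → gl w = gl w' := by
      rintro x w w' ⟨hx, hw, h⟩ ⟨_, hw', h'⟩
      have := hM _ h _ h' (Or.inl rfl)
      exact (hgl.eq_iff_relOf I.isCluster_Gc hw hw').2
        (I.isCluster_Gc.mk_eq_iff.1 (Prod.ext_iff.1 this).2)
    let φ : ℕ → ℕ := fun x => if h : ∃ w, mt x w then gl h.choose + 1 else 0
    have hφ : ∀ x w, mt x w → φ x = gl w + 1 := by
      intro x w h
      have hex : ∃ w, mt x w := ⟨w, h⟩
      simp only [φ, dif_pos hex]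
      rw [hmt x _ _ hex.choose_spec h]
    have hG' : ∀ u v, u < I.n → v < I.n → adjRel I.G u v → relOf G' u v := by
      intro u v hu hv h
      rcases lt_trichotomy u v with hlt | rfl | hlt
      · exact h2 (u, v) (mem_pairs.2 ⟨hlt, hv⟩) (Or.inr h)
      · exact Or.inl rfl
      · exact (reflSymm_relOf G').symm
          (h2 (v, u) (mem_pairs.2 ⟨hlt, hu⟩) (Or.inr (adjRel_symm h)))
    have hrel : ∀ u v, u < I.n → v < I.n → lab u = lab v → relOf G' u v :=
      hlab.rel _ (reflSymm_relOf G') h1.transOn hG'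
    refine ⟨φ, le_trans ?_ h4, ?_⟩
    · rw [misplaced, ← card_fin_filter fun v => φ (lab v) ≠ gl v + 1]
      refine Finset.card_le_card fun v hv => ?_
      simp only [Finset.mem_filter, Finset.mem_univ, true_and] at hv ⊢
      contrapose! hv
      refine hφ _ _ ⟨hlab.lt v v.2, v.2, ?_⟩
      have : G'.connectedComponentMk ⟨lab v, hlab.lt v v.2⟩ = G'.connectedComponentMk v :=
        h1.mk_eq_iff.2 (hrel _ _ (hlab.lt v v.2) v.2 (hlab.idem v v.2))
      rw [this]
      exact hv
    · rw [numOrdered_eq (reflSymm_finalRel lab φ)]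
      -- Two components in the same group have their `G'`-clusters matched with the same cluster of
      -- `Gc`, hence lie in the same `G'`-cluster. Undoing the other merges of `G'` only saves
      -- edges.
      have : numPairs I.n (finalRel lab φ) ≤ numPairs I.n (relOf G') := by
        refine numPairs_mono fun u v hu hv h => ?_
        rcases h with h | ⟨h, h'⟩
        · exact hrel u v hu hv h
        · have hex : ∀ x, φ x ≠ 0 → ∃ w, mt x w := fun x hx => by
            by_contra hcon
            exact hx (dif_neg hcon)
          obtain ⟨w, hw⟩ := hex _ h'
          obtain ⟨w', hw'⟩ := hex _ (h ▸ h')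
          rw [hφ _ _ hw, hφ _ _ hw'] at h
          obtain ⟨hx, hwn, hw⟩ := hw
          obtain ⟨hx', hwn', hw'⟩ := hw'
          have e2 : I.Gc.connectedComponentMk ⟨w, hwn⟩ = I.Gc.connectedComponentMk ⟨w', hwn'⟩ :=
            I.isCluster_Gc.mk_eq_iff.2 ((hgl.eq_iff_relOf I.isCluster_Gc hwn hwn').1 (by omega))
          have := (Prod.ext_iff.1 (hM _ hw _ hw' (Or.inr e2))).1
          have e3 : relOf G' (lab u) (lab v) := h1.mk_eq_iff.1 this
          exact h1.transOn hu hx hv (hrel _ _ hu hx (hlab.idem u hu).symm)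
            (h1.transOn hx hx' hv e3 (hrel _ _ hx' hv (hlab.idem v hv)))
      omega
  · rintro ⟨φ, h1, h2⟩
    have hS := reflSymm_finalRel lab φ
    have ht : TransOn I.n (finalRel lab φ) := fun u v w _ _ _ h h' => finalRel_trans h h'
    have hcl := isClusterGraph_graphOf hS ht
    have hsub : ∀ p ∈ pairs I.n, relOf I.G p.1 p.2 →
        relOf (graphOf I.n (finalRel lab φ)) p.1 p.2 := by
      intro p hp h
      have hp' := mem_pairs.1 hp
      rw [relOf_graphOf hS (by omega) (by omega)]
      exact Or.inl (hlab.eq _ _ (by omega) (by omega) ((relOf_iff_adjRel hp).1 h))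
    refine ⟨graphOf I.n (finalRel lab φ), hcl, (edgeSet_subset_iff _ _).2 hsub, ?_, ?_⟩
    · rw [edgeDist_eq, edgeDist_le_iff hsub,
        numPairs_congr (E' := finalRel lab φ) fun u v hu hv => relOf_graphOf hS hu hv]
      rw [numOrdered_eq hS] at h2
      omega
    · rw [matchingDist_le_iff]
      -- The matching consists of the pairs of clusters of the correctly placed vertices. It is a
      -- matching because a nonzero group determines the cluster of `Gc` and vice versa.
      refine ⟨(Finset.univ.filter fun v : Fin I.n => φ (lab v) = gl v + 1).image fun v =>
        ((graphOf I.n (finalRel lab φ)).connectedComponentMk v, I.Gc.connectedComponentMk v),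
        ?_, le_trans ?_ h1⟩
      · simp only [IsPairMatching, Finset.mem_image, Finset.mem_filter, Finset.mem_univ, true_and]
        rintro _ ⟨v, hv, rfl⟩ _ ⟨w, hw, rfl⟩ h
        dsimp only at h
        rw [hcl.mk_eq_iff, I.isCluster_Gc.mk_eq_iff, relOf_graphOf hS v.2 w.2,
          ← hgl.eq_iff_relOf I.isCluster_Gc v.2 w.2] at h
        rw [Prod.mk.injEq, hcl.mk_eq_iff, I.isCluster_Gc.mk_eq_iff, relOf_graphOf hS v.2 w.2,
          ← hgl.eq_iff_relOf I.isCluster_Gc v.2 w.2]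
        rcases h with (h | h) | h
        · exact ⟨Or.inl h, by rw [h] at hv; omega⟩
        · exact ⟨Or.inr h, by omega⟩
        · exact ⟨Or.inr ⟨by omega, by omega⟩, h⟩
      · rw [misplaced, ← card_fin_filter fun v => φ (lab v) ≠ gl v + 1]
        refine Finset.card_le_card fun v hv => ?_
        simp only [Finset.mem_filter, Finset.mem_univ, true_and] at hv ⊢
        exact fun h => hv (Finset.mem_image_of_mem _ (by simpa using h))

end

section

/-! ### Searching for an assignment of the components to groups -/

/-- The sum of the values of the `v < n` with key `x`. -/
def tally (n : ℕ) (key val : ℕ → ℕ) (x : ℕ) : ℕ :=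
  ∑ v ∈ Finset.range n, if key v = x then val v else 0

/-- Double counting by keys; it turns sums over components or groups into sums over vertices, where
identities can be checked vertex by vertex. -/
theorem sum_tally_mul {n m : ℕ} {key val : ℕ → ℕ} (hkey : ∀ v < n, key v < m) (g : ℕ → ℕ) :
    ∑ x ∈ Finset.range m, tally n key val x * g x = ∑ v ∈ Finset.range n, val v * g (key v) := by
  simp only [tally, Finset.sum_mul, ite_mul, zero_mul]
  rw [Finset.sum_comm]
  refine Finset.sum_congr rfl fun v hv => ?_
  rw [Finset.sum_ite_eq, if_pos (Finset.mem_range.2 (hkey v (Finset.mem_range.1 hv)))]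

theorem tally_eq_zero_iff {n : ℕ} {key val : ℕ → ℕ} {x : ℕ} :
    tally n key val x = 0 ↔ ∀ v < n, key v = x → val v = 0 := by
  simp [tally, Finset.sum_eq_zero_iff]

theorem tally_one_le (n : ℕ) (key val : ℕ → ℕ) (x : ℕ) (hval : ∀ v < n, val v ≤ 1) :
    tally n key val x ≤ n := by
  refine (Finset.sum_le_card_nsmul _ _ 1 fun v hv => ?_).trans (by simp)
  have := hval v (Finset.mem_range.1 hv)
  split <;> omega

/-- The size of the component labelled `x`. -/
def compSize (n : ℕ) (lab : ℕ → ℕ) (x : ℕ) : ℕ := tally n lab (fun _ => 1) x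

/-- The number of vertices in the component `x` with another label in `gl` than `x`. -/
def impurity (n : ℕ) (lab gl : ℕ → ℕ) (x : ℕ) : ℕ :=
  tally n lab (fun v => 1 - if gl v = gl (lab v) then 1 else 0) x

/-- The size of group `D + 1`. -/
def groupSize (n : ℕ) (lab φ : ℕ → ℕ) (D : ℕ) : ℕ :=
  tally n (fun v => φ (lab v)) (fun _ => 1) (D + 1)

/-- The contribution of the separate components to the number of ordered pairs. -/
def separateWeight (n : ℕ) (lab φ : ℕ → ℕ) : ℕ :=
  ∑ v ∈ Finset.range n, if φ (lab v) = 0 then compSize n lab (lab v) else 0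

/-- A vertex is related to its whole group, or only to its component if that is separate. Summing
over vertices yields the squares of the sizes. -/
theorem numOrdered_finalRel {n : ℕ} {lab φ : ℕ → ℕ} (hφ : ∀ v < n, φ (lab v) ≤ n) :
    numOrdered n (finalRel lab φ) = separateWeight n lab φ +
      ∑ D ∈ Finset.range n, groupSize n lab φ D * groupSize n lab φ D := by
  have h1 : ∀ u, ∑ v ∈ Finset.range n, ind (finalRel lab φ) u v =
      (if φ (lab u) = 0 then compSize n lab (lab u) else 0) +
        if φ (lab u) = 0 then 0 else groupSize n lab φ (φ (lab u) - 1) := by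
    intro u
    by_cases h : φ (lab u) = 0
    · rw [if_pos h, if_pos h, add_zero]
      refine Finset.sum_congr rfl fun v _ => ?_
      unfold ind finalRel
      simp only [h, ne_eq, not_true_eq_false, and_false, or_false, eq_comm]
    · rw [if_neg h, if_neg h, zero_add]
      refine Finset.sum_congr rfl fun v _ => ?_
      unfold ind finalRel
      rw [show φ (lab u) - 1 + 1 = φ (lab u) by omega]
      have : (lab u = lab v ∨ φ (lab u) = φ (lab v) ∧ φ (lab u) ≠ 0) ↔ φ (lab v) = φ (lab u) :=
        ⟨fun h' => h'.elim (fun h' => h' ▸ rfl) fun h' => h'.1.symm, fun h' => Or.inr ⟨h'.symm, h⟩⟩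
      simp only [this]
  have h2 : ∑ u ∈ Finset.range n,
      (if φ (lab u) = 0 then 0 else groupSize n lab φ (φ (lab u) - 1)) =
      ∑ D ∈ Finset.range n, groupSize n lab φ D * groupSize n lab φ D := by
    have := sum_tally_mul (n := n) (m := n + 1) (key := fun v => φ (lab v)) (val := fun _ => 1)
      (fun v hv => by have := hφ v hv; omega)
      (fun x => if x = 0 then 0 else groupSize n lab φ (x - 1))
    simp only [one_mul] at this
    rw [← this, Finset.sum_range_succ']
    simp [groupSize]
  rw [numOrdered, Finset.sum_congr rfl fun u _ => h1 u, Finset.sum_add_distrib, h2]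
  rfl

/-! ### Making some components separate -/

section Remove

variable {n : ℕ} {lab gl tgt : ℕ → ℕ} {R : ℕ → Prop} [DecidablePred R]

/-- By `hR` all vertices of a removed component were correctly placed, so each becomes a new
misplaced vertex. -/
theorem misplaced_remove (hlt : ∀ v < n, lab v < n)
    (hR : ∀ v < n, R (lab v) → tgt (lab v) = gl v + 1) :
    misplaced n lab gl (fun x => if R x then 0 else tgt x) = misplaced n lab gl tgt +
      ∑ x ∈ Finset.range n, if R x then compSize n lab x else 0 := by
  have h1 := sum_tally_mul (n := n) (val := fun _ => 1) hlt fun x => if R x then 1 else 0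
  simp only [mul_ite, mul_one, mul_zero] at h1
  change ∑ x ∈ Finset.range n, (if R x then compSize n lab x else 0) = _ at h1
  rw [h1, misplaced, misplaced, Finset.card_filter, Finset.card_filter, ← Finset.sum_add_distrib]
  refine Finset.sum_congr rfl fun v hv => ?_
  have := hR v (Finset.mem_range.1 hv)
  by_cases h : R (lab v) <;> simp_all

theorem groupSize_remove (hlt : ∀ v < n, lab v < n) (D : ℕ) :
    groupSize n lab (fun x => if R x then 0 else tgt x) D +
      ∑ x ∈ Finset.range n, (if R x ∧ tgt x = D + 1 then compSize n lab x else 0) =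
        groupSize n lab tgt D := by
  have h1 := sum_tally_mul (n := n) (val := fun _ => 1) hlt
    fun x => if R x ∧ tgt x = D + 1 then 1 else 0
  simp only [mul_ite, mul_one, mul_zero] at h1
  change ∑ x ∈ Finset.range n, (if R x ∧ tgt x = D + 1 then compSize n lab x else 0) = _ at h1
  rw [h1, groupSize, groupSize, tally, tally, ← Finset.sum_add_distrib]
  refine Finset.sum_congr rfl fun v _ => ?_
  by_cases h : R (lab v) <;> simp [h]

/-- A removed component of size `s` contributes `s * s`. The sum is arranged by groups because the
dynamic program proceeds group by group. -/
theorem separateWeight_remove (hlt : ∀ v < n, lab v < n) (ht : ∀ v < n, tgt (lab v) ≤ n)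
    (hR : ∀ v < n, R (lab v) → tgt (lab v) ≠ 0) :
    separateWeight n lab (fun x => if R x then 0 else tgt x) = separateWeight n lab tgt +
      ∑ D ∈ Finset.range n, ∑ x ∈ Finset.range n,
        if R x ∧ tgt x = D + 1 then compSize n lab x * compSize n lab x else 0 := by
  have h1 := sum_tally_mul (n := n) (val := fun _ => 1) hlt
    fun x => if R x then compSize n lab x else 0
  have h2 : ∑ D ∈ Finset.range n, ∑ x ∈ Finset.range n,
      (if R x ∧ tgt x = D + 1 then compSize n lab x * compSize n lab x else 0) =
      ∑ v ∈ Finset.range n, if R (lab v) then compSize n lab (lab v) else 0 := by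
    simp only [one_mul] at h1
    rw [← h1, Finset.sum_comm]
    refine Finset.sum_congr rfl fun x hx => ?_
    change _ = compSize n lab x * _
    by_cases h0 : compSize n lab x = 0
    · simp [h0]
    · obtain ⟨v, hv, rfl⟩ : ∃ v < n, lab v = x := by
        by_contra! hcon
        exact h0 (tally_eq_zero_iff.2 fun v hv h => absurd h (hcon v hv))
      by_cases h : R (lab v)
      · have e1 := hR v hv h
        have e2 := ht v hv
        rw [Finset.sum_eq_single (tgt (lab v) - 1)]
        · rw [if_pos ⟨h, by omega⟩, if_pos h]
        · intro D _ hD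
          rw [if_neg fun h' => hD (by omega)]
        · intro h'
          rw [Finset.mem_range] at h'
          omega
      · simp [h]
  rw [h2, separateWeight, separateWeight, ← Finset.sum_add_distrib]
  refine Finset.sum_congr rfl fun v hv => ?_
  have := hR v (Finset.mem_range.1 hv)
  by_cases h : R (lab v) <;> simp_all

end Remove

/-- The component `x` has a single label in `gl`. -/
def IsPure (n : ℕ) (lab gl : ℕ → ℕ) (x : ℕ) : Prop := lab x = x ∧ impurity n lab gl x = 0

/-- `dig` selects the vertex `v` of its component. -/
def Selects (n : ℕ) (lab gl dig : ℕ → ℕ) (v : ℕ) : Prop :=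
  if impurity n lab gl (lab v) = 0 then v = lab v else
    dig (rankIn (fun u _ => impurity n lab gl u ≠ 0) (lab v) + 1) =
      rankIn (fun u w => lab u = lab w) v + 1

open Classical in
/-- The group of each component: that of its selected vertex, if any. -/
noncomputable def target (n : ℕ) (lab gl dig : ℕ → ℕ) : ℕ → ℕ :=
  tally n lab fun v => if Selects n lab gl dig v then gl v + 1 else 0

/-! ### Normal forms of assignments and their codes -/

section Target

variable {n : ℕ} {lab gl dig : ℕ → ℕ}

theorem gl_eq_of_impurity_eq {x v : ℕ} (h : impurity n lab gl x = 0) (hv : v < n)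
    (hx : lab v = x) : gl v = gl x := by
  by_contra hcon
  have := tally_eq_zero_iff.1 h v hv hx
  rw [hx, if_neg hcon] at this
  omega

theorem reflSymm_lab (lab : ℕ → ℕ) : ReflSymm fun u w => lab u = lab w := ⟨fun _ => rfl, Eq.symm⟩

/-- At most one term of the tally defining `target` is nonzero, so that a sum can play the role of a
choice. -/
theorem Selects.unique {v w : ℕ} (hv : v < n) (hw : w < n) (h : lab v = lab w)
    (h1 : Selects n lab gl dig v) (h2 : Selects n lab gl dig w) : v = w := by
  unfold Selects at h1 h2
  rw [← h] at h2
  split at h1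
  · rename_i h0
    rw [if_pos h0] at h2
    rw [h1, ← h2]
  · rename_i h0
    rw [if_neg h0] at h2
    exact rankIn_inj (reflSymm_lab lab) (fun _ _ _ _ _ _ h h' => h.trans h') hv hw h (by omega)

theorem target_eq {v : ℕ} (hv : v < n) (h : Selects n lab gl dig v) :
    target n lab gl dig (lab v) = gl v + 1 := by
  classical
  rw [target, tally, Finset.sum_eq_single v]
  · rw [if_pos rfl, if_pos h]
  · intro w hw hne
    by_cases hl : lab w = lab v
    · rw [if_pos hl, if_neg fun h' => hne (h'.unique (Finset.mem_range.1 hw) hv hl h)]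
    · rw [if_neg hl]
  · intro h'
    exact absurd (Finset.mem_range.2 hv) h'

theorem target_eq_zero {x : ℕ} (h : ∀ v < n, lab v = x → ¬ Selects n lab gl dig v) :
    target n lab gl dig x = 0 := by
  classical
  exact tally_eq_zero_iff.2 fun v hv hx => if_neg (h v hv hx)

theorem target_le (hgl : ∀ v < n, gl v < n) (x : ℕ) : target n lab gl dig x ≤ n := by
  by_cases h : ∀ v < n, lab v = x → ¬ Selects n lab gl dig v
  · rw [target_eq_zero h]; omega
  · push Not at h
    obtain ⟨v, hv, rfl, h⟩ := h
    rw [target_eq hv h]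
    exact hgl v hv

theorem target_of_isPure {x : ℕ} (hx : x < n) (h : IsPure n lab gl x) :
    target n lab gl dig x = gl x + 1 := by
  have := target_eq (lab := lab) (gl := gl) (dig := dig) hx (by
    unfold Selects
    rw [h.1, if_pos h.2])
  rwa [h.1] at this

theorem misplaced_congr {φ ψ : ℕ → ℕ} (h : ∀ v < n, φ (lab v) = ψ (lab v)) :
    misplaced n lab gl φ = misplaced n lab gl ψ := by
  unfold misplaced
  congr 1
  exact Finset.filter_congr fun v hv => by rw [h v (Finset.mem_range.1 hv)]

theorem numOrdered_mono {S S' : ℕ → ℕ → Prop}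
    (h : ∀ u v, u < n → v < n → S u v → S' u v) : numOrdered n S ≤ numOrdered n S' := by
  refine Finset.sum_le_sum fun u hu => Finset.sum_le_sum fun v hv => ?_
  rw [Finset.mem_range] at hu hv
  by_cases h1 : S u v
  · rw [ind_eq_one h1, ind_eq_one (h _ _ hu hv h1)]
  · rw [ind_eq_zero h1]; omega

/-- Every component may be put into the group of one of its own vertices, or be separate. -/
theorem exists_normal {d t : ℕ} {φ : ℕ → ℕ} (h1 : misplaced n lab gl φ ≤ d)
    (h2 : numOrdered n (finalRel lab φ) ≤ t) :
    ∃ ψ : ℕ → ℕ, misplaced n lab gl ψ ≤ d ∧ numOrdered n (finalRel lab ψ) ≤ t ∧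
      ∀ x, ψ x ≠ 0 → ∃ v < n, lab v = x ∧ ψ x = gl v + 1 := by
  classical
  -- A component in a group to which none of its vertices belongs has all its vertices misplaced
  -- already. Making it separate misplaces no further vertex and only removes related pairs.
  refine ⟨fun x => if ∃ v < n, lab v = x ∧ φ x = gl v + 1 then φ x else 0, le_trans ?_ h1,
    le_trans (numOrdered_mono fun u v _ _ h => ?_) h2, fun x hx => ?_⟩
  · refine Finset.card_le_card fun v hv => ?_
    rw [Finset.mem_filter, Finset.mem_range] at hv ⊢
    refine ⟨hv.1, fun h => hv.2 ?_⟩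
    dsimp only
    rw [if_pos ⟨v, hv.1, rfl, h⟩, h]
  · rcases h with h | ⟨h, h'⟩
    · exact Or.inl h
    · have e1 := (ite_ne_right_iff.1 h').1
      have e2 := (ite_ne_right_iff.1 (h ▸ h')).1
      dsimp only at h h'
      rw [if_pos e1] at h'
      rw [if_pos e1, if_pos e2] at h
      exact Or.inr ⟨h, h'⟩
  · have e := (ite_ne_right_iff.1 hx).1
    simpa only [if_pos e] using e

/-- An assignment in normal form is found by choosing digits for the impure components and
removing pure ones. -/
theorem exists_digits {d : ℕ} {ψ : ℕ → ℕ} (hlt : ∀ v < n, lab v < n)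
    (hid : ∀ v < n, lab (lab v) = lab v) (h1 : misplaced n lab gl ψ ≤ d)
    (hψ : ∀ x, ψ x ≠ 0 → ∃ v < n, lab v = x ∧ ψ x = gl v + 1) :
    ∃ c < (d + 2) ^ d, ∃ Rm : ℕ → Prop, ∀ v < n, ψ (lab v) =
      open Classical in if IsPure n lab gl (lab v) ∧ Rm (lab v) then 0 else
        target n lab gl (digArr (d + 2) c) (lab v) := by
  classical
  set rk := rankIn fun u _ => impurity n lab gl u ≠ 0 with hrk
  set idx := rankIn fun u w => lab u = lab w with hidx
  -- An impure component has two vertices in different clusters of `Gc`, so at least one is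
  -- misplaced; different components give different vertices.
  have himp : ((Finset.range n).filter fun x => impurity n lab gl x ≠ 0).card ≤ d := by
    refine le_trans (le_trans (Finset.card_le_card (t := Finset.image lab _) fun x hx => ?_)
      Finset.card_image_le) h1
    · rw [Finset.mem_filter, Finset.mem_range] at hx
      have h2 := hx.2
      rw [impurity, Ne, tally_eq_zero_iff] at h2
      push Not at h2
      obtain ⟨v, hv, rfl, h2⟩ := h2
      have h3 : gl v ≠ gl (lab v) := fun h => h2 (by rw [if_pos h])
      rw [Finset.mem_image]
      by_cases h4 : ψ (lab v) = gl v + 1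
      · exact ⟨lab v, by simp [hlt v hv, hid v hv, h4, h3], hid v hv⟩
      · exact ⟨v, by simp [hv, h4], rfl⟩
  have hrk_lt : ∀ x < n, impurity n lab gl x ≠ 0 → rk x < d := by
    intro x hx h0
    refine lt_of_lt_of_le (Finset.card_lt_card ⟨fun y hy => ?_, fun hcon => ?_⟩) himp
    · simp only [Finset.mem_filter, Finset.mem_range] at hy ⊢
      exact ⟨by omega, hy.2⟩
    · have := hcon (show x ∈ _ by simp [hx, h0])
      simp at this
  have hrk_mono : ∀ x y, x < y → impurity n lab gl x ≠ 0 → rk x < rk y := by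
    intro x y hxy h0
    refine Finset.card_lt_card ⟨fun z hz => ?_, fun hcon => ?_⟩
    · simp only [Finset.mem_filter, Finset.mem_range] at hz ⊢
      exact ⟨by omega, hz.2⟩
    · have := hcon (show x ∈ _ by simp [hxy, h0])
      simp at this
  have hrk_inj : ∀ x y, impurity n lab gl x ≠ 0 → impurity n lab gl y ≠ 0 → rk x = rk y →
      x = y := by
    intro x y hx hy h
    rcases lt_trichotomy x y with h' | h' | h'
    · have := hrk_mono x y h' hx; omega
    · exact h'
    · have := hrk_mono y x h' hy; omega
  -- Digit `0` means separate, digit `i + 1` the group of the vertex with index `i` in the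
  -- component. For the first vertex belonging to the chosen group, all earlier vertices of the
  -- component are misplaced, so `i ≤ d`.
  have hdelta : ∀ x, ∃ δ, δ < d + 2 ∧ ((ψ x = 0 ∧ δ = 0) ∨
      ∃ v < n, lab v = x ∧ ψ x = gl v + 1 ∧ δ = idx v + 1) := by
    intro x
    by_cases h0 : ψ x = 0
    · exact ⟨0, by omega, Or.inl ⟨h0, rfl⟩⟩
    · have hex := hψ x h0
      obtain ⟨hv, hx, hg⟩ := Nat.find_spec hex
      refine ⟨_, ?_, Or.inr ⟨_, hv, hx, hg, rfl⟩⟩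
      have : idx (Nat.find hex) ≤ misplaced n lab gl ψ := by
        refine Finset.card_le_card fun u hu => ?_
        simp only [Finset.mem_filter, Finset.mem_range] at hu ⊢
        refine ⟨by omega, fun h => Nat.find_min hex hu.1 ⟨by omega, hu.2.trans hx, ?_⟩⟩
        rw [← h, hu.2, hx]
      omega
  choose δ hδ hδ' using hdelta
  obtain ⟨c, hc, hdig⟩ := exists_digArr (b := d + 2) (by omega) d
    (fun i => if h : ∃ x, x < n ∧ impurity n lab gl x ≠ 0 ∧ rk x = i then δ h.choose else 0)
    (fun i _ => by split; exacts [hδ _, by omega])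
  -- The components to remove are the separate ones; this only matters for pure components, since
  -- the digits take care of the impure ones.
  refine ⟨c, hc, fun x => ψ x = 0, fun w hw => ?_⟩
  have hxn := hlt w hw
  have hxx := hid w hw
  generalize lab w = x at *
  by_cases h0 : impurity n lab gl x = 0
  · have hp : IsPure n lab gl x := ⟨hxx, h0⟩
    by_cases hz : ψ x = 0
    · rw [if_pos ⟨hp, hz⟩, hz]
    · obtain ⟨v, hv, hx, hg⟩ := hψ x hz
      rw [if_neg fun h => hz h.2, target_of_isPure hxn hp, hg, gl_eq_of_impurity_eq h0 hv hx]
  · rw [if_neg fun h => h0 h.1.2]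
    have hex : ∃ y, y < n ∧ impurity n lab gl y ≠ 0 ∧ rk y = rk x := ⟨x, hxn, h0, rfl⟩
    have hd := hdig (rk x) (hrk_lt x hxn h0)
    rw [dif_pos hex, hrk_inj _ _ hex.choose_spec.2.1 h0 hex.choose_spec.2.2] at hd
    rcases hδ' x with ⟨e1, e2⟩ | ⟨v, hv, rfl, e1, e2⟩
    · rw [e1, target_eq_zero]
      intro v hv hx hsel
      unfold Selects at hsel
      rw [hx, if_neg h0, ← hrk, hd, e2] at hsel
      omega
    · rw [e1, target_eq hv]
      unfold Selects
      rw [if_neg h0, ← hrk, hd, e2]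

open Classical in
/-- The sum over the chosen `x < i`. -/
noncomputable def chosen (cond Rm : ℕ → Prop) (f : ℕ → ℕ) (i : ℕ) : ℕ :=
  ∑ x ∈ Finset.range i, if cond x ∧ Rm x then f x else 0

/-- The contribution of the removed pure components to group `D + 1`. -/
noncomputable def removed (n : ℕ) (lab gl tgt : ℕ → ℕ) (Rm : ℕ → Prop) (f : ℕ → ℕ) (D : ℕ) : ℕ :=
  chosen (fun x => IsPure n lab gl x ∧ tgt x = D + 1) Rm f n

/-- Some set of pure components of total size `r` can be removed from their groups. -/
def Removable (n : ℕ) (lab gl tgt : ℕ → ℕ) (t r : ℕ) : Prop :=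
  ∃ Rm : ℕ → Prop,
    ∑ D ∈ Finset.range n, removed n lab gl tgt Rm (compSize n lab) D = r ∧
    separateWeight n lab tgt + ∑ D ∈ Finset.range n,
      (removed n lab gl tgt Rm (fun x => compSize n lab x * compSize n lab x) D +
        (groupSize n lab tgt D - removed n lab gl tgt Rm (compSize n lab) D) *
          (groupSize n lab tgt D - removed n lab gl tgt Rm (compSize n lab) D)) ≤ t

open Classical in
-- Both quantities are sums over groups in terms of what is removed from each group: its total size
-- and its sum of squares. This is the form that a convolution over groups can optimise.
theorem removable_aux (hlt : ∀ v < n, lab v < n)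
    (hgl : ∀ v < n, gl v < n) (Rm : ℕ → Prop) :
    (misplaced n lab gl (fun x => if IsPure n lab gl x ∧ Rm x then 0 else
      target n lab gl dig x) = misplaced n lab gl (target n lab gl dig) +
        ∑ D ∈ Finset.range n, removed n lab gl (target n lab gl dig) Rm (compSize n lab) D) ∧
    numOrdered n (finalRel lab (fun x => if IsPure n lab gl x ∧ Rm x then 0 else
      target n lab gl dig x)) = separateWeight n lab (target n lab gl dig) +
        ∑ D ∈ Finset.range n, (removed n lab gl (target n lab gl dig) Rm
          (fun x => compSize n lab x * compSize n lab x) D +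
        (groupSize n lab (target n lab gl dig) D -
          removed n lab gl (target n lab gl dig) Rm (compSize n lab) D) *
          (groupSize n lab (target n lab gl dig) D -
          removed n lab gl (target n lab gl dig) Rm (compSize n lab) D)) := by
  set tgt := target n lab gl dig with htgt
  have hR : ∀ v < n, IsPure n lab gl (lab v) ∧ Rm (lab v) → tgt (lab v) = gl v + 1 := by
    intro v hv h
    rw [htgt, target_of_isPure (hlt v hv) h.1, gl_eq_of_impurity_eq h.1.2 hv rfl]
  have hle : ∀ x, tgt x ≤ n := target_le hgl
  have hrem : ∀ (f : ℕ → ℕ) D, removed n lab gl tgt Rm f D = ∑ x ∈ Finset.range n,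
      if (IsPure n lab gl x ∧ Rm x) ∧ tgt x = D + 1 then f x else 0 := by
    intro f D
    rw [removed, chosen]
    refine Finset.sum_congr rfl fun x _ => ?_
    congr 1
    exact propext (by tauto)
  constructor
  · rw [misplaced_remove hlt hR]
    congr 1
    simp only [removed, chosen]
    rw [Finset.sum_comm]
    refine Finset.sum_congr rfl fun x hx => ?_
    rw [Finset.mem_range] at hx
    by_cases h : IsPure n lab gl x ∧ Rm x
    · have e := target_of_isPure (dig := dig) hx h.1
      rw [← htgt] at e
      have := hgl x hx
      rw [if_pos h, Finset.sum_eq_single (gl x)]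
      · rw [if_pos ⟨⟨h.1, e⟩, h.2⟩]
      · intro D _ hD
        rw [if_neg fun h' => hD (by omega)]
      · intro h'
        rw [Finset.mem_range] at h'
        omega
    · rw [if_neg h]
      exact (Finset.sum_eq_zero fun D _ => if_neg fun h' => h ⟨h'.1.1, h'.2⟩).symm
  · rw [numOrdered_finalRel fun v _ => by split <;> [omega; exact hle _],
      separateWeight_remove hlt (fun v _ => hle _) (fun v hv h => by rw [hR v hv h]; omega),
      add_assoc, ← Finset.sum_add_distrib]
    congr 1
    refine Finset.sum_congr rfl fun D _ => ?_
    have := groupSize_remove (R := fun x => IsPure n lab gl x ∧ Rm x) (tgt := tgt) hlt D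
    rw [← hrem] at this ⊢
    rw [← this, Nat.add_sub_cancel]

/-- Only the impure components are enumerated. The slack left in `d` by the digits is the total size
`r` of pure components that may still be separated. -/
theorem exists_assignment_iff {d t : ℕ} (hlt : ∀ v < n, lab v < n)
    (hid : ∀ v < n, lab (lab v) = lab v) (hgl : ∀ v < n, gl v < n) :
    (∃ φ : ℕ → ℕ, misplaced n lab gl φ ≤ d ∧ numOrdered n (finalRel lab φ) ≤ t) ↔
      ∃ c < (d + 2) ^ d, misplaced n lab gl (target n lab gl (digArr (d + 2) c)) ≤ d ∧
        ∃ r < d - misplaced n lab gl (target n lab gl (digArr (d + 2) c)) + 1,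
          Removable n lab gl (target n lab gl (digArr (d + 2) c)) t r := by
  classical
  constructor
  · rintro ⟨φ, h1, h2⟩
    obtain ⟨ψ, h1, h2, hψ⟩ := exists_normal h1 h2
    obtain ⟨c, hc, Rm, h⟩ := exists_digits hlt hid h1 hψ
    obtain ⟨e1, e2⟩ := removable_aux (dig := digArr (d + 2) c) hlt hgl Rm
    have e3 : misplaced n lab gl ψ = _ := misplaced_congr (ψ := fun x =>
      if IsPure n lab gl x ∧ Rm x then 0 else target n lab gl (digArr (d + 2) c) x) h
    have e4 : numOrdered n (finalRel lab fun x => if IsPure n lab gl x ∧ Rm x then 0 else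
        target n lab gl (digArr (d + 2) c) x) ≤ t := by
      refine (numOrdered_mono fun u v hu hv h' => ?_).trans h2
      unfold finalRel at h' ⊢
      dsimp only at h'
      rwa [← h u hu, ← h v hv] at h'
    rw [e1] at e3
    rw [e2] at e4
    exact ⟨c, hc, by omega, _, by omega, Rm, rfl, e4⟩
  · rintro ⟨c, -, h1, r, hr, Rm, h2, h3⟩
    obtain ⟨e1, e2⟩ := removable_aux (dig := digArr (d + 2) c) hlt hgl Rm
    exact ⟨_, by rw [e1]; omega, by rw [e2]; exact h3⟩

end Target

end

/-! ### Programs for labels and tallies -/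

/-- Array `b` becomes a labeling of the connected components of the graph in array `a`. -/
def mergeLabels (a b : ℕ) : Prog :=
  .seq (forLoop 37 0 (.write b (.reg 37) (.reg 37))) <|
  forLoop 37 6 <| .when (.read a (.reg 37)) <|
    .seq (.seq (.assign 38 (.read b (.reg 37 / .reg 0))) (.assign 39 (.read b (.reg 37 % .reg 0)))) <|
    forLoop 36 0 (.when (.equal (.read b (.reg 36)) (.reg 38)) (.write b (.reg 36) (.reg 39)))

/-- `f` labels the components of the graph with the first `i` pairs of `E`. -/
structure IsPartialLabeling (n : ℕ) (E : ℕ → ℕ → Prop) (i : ℕ) (f : ℕ → ℕ) : Prop where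
  lt : ∀ v < n, f v < n
  idem : ∀ v < n, f (f v) = f v
  eq : ∀ p < i, E (p / n) (p % n) → f (p / n) = f (p % n)
  rel : ∀ S, ReflSymm S → TransOn n S → (∀ u v, u < n → v < n → E u v → S u v) →
    ∀ u v, u < n → v < n → f u = f v → S u v

theorem IsPartialLabeling.isLabeling {n : ℕ} {E : ℕ → ℕ → Prop} {f : ℕ → ℕ}
    (h : IsPartialLabeling n E (n * n) f) : IsLabeling n E f where
  lt := h.lt
  idem := h.idem
  eq u v hu hv huv := by
    have := h.eq (u * n + v) (cell_lt hu hv)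
    rw [cell_div hv, cell_mod hv] at this
    exact this huv
  rel := h.rel

/-- Redirecting one class of labels to another joins exactly two classes. The joined vertices are
related in every equivalence relation containing `E`, via the new edge, so the minimality clause
`rel` survives. -/
theorem IsPartialLabeling.merge {n i : ℕ} {E : ℕ → ℕ → Prop} {f f' : ℕ → ℕ}
    (h : IsPartialLabeling n E i f) (hi : i < n * n) (hE : E (i / n) (i % n))
    (hf' : ∀ w < n, f' w = if f w = f (i / n) then f (i % n) else f w) :
    IsPartialLabeling n E (i + 1) f' := by
  have hu := div_lt_of_lt_sq hi
  have hv := mod_lt_of_lt_sq hi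
  have hlt : ∀ v < n, f' v < n := by
    intro w hw
    rw [hf' w hw]
    split
    exacts [h.lt _ hv, h.lt _ hw]
  refine ⟨hlt, ?_, ?_, ?_⟩
  · intro w hw
    rw [hf' _ (hlt w hw), hf' w hw]
    by_cases h1 : f w = f (i / n)
    · rw [if_pos h1, h.idem _ hv]
      split <;> rfl
    · rw [if_neg h1, h.idem _ hw, if_neg h1]
  · intro p hp hEp
    have hpn : p < n * n := by omega
    rw [hf' _ (div_lt_of_lt_sq hpn), hf' _ (mod_lt_of_lt_sq hpn)]
    rcases Nat.lt_succ_iff_lt_or_eq.1 hp with hp | rfl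
    · rw [h.eq p hp hEp]
    · rw [if_pos rfl]
      split <;> rfl
  · intro S hS ht hES u v hun hvn huv
    rw [hf' u hun, hf' v hvn] at huv
    have hrel := h.rel S hS ht hES
    have hS' := hES _ _ hu hv hE
    by_cases h1 : f u = f (i / n) <;> by_cases h2 : f v = f (i / n)
    · exact hrel u v hun hvn (h1.trans h2.symm)
    · rw [if_pos h1, if_neg h2] at huv
      exact ht hun hu hvn (hrel _ _ hun hu h1) (ht hu hv hvn hS' (hrel _ _ hv hvn huv))
    · rw [if_neg h1, if_pos h2] at huv
      exact ht hun hv hvn (hrel _ _ hun hv huv)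
        (ht hv hu hvn (hS.symm hS') (hrel _ _ hu hvn h2.symm))
    · rw [if_neg h1, if_neg h2] at huv
      exact hrel u v hun hvn huv

theorem Tri.mergeLabels {B n a b : ℕ} {s : Store} {E : ℕ → ℕ → Prop} (hs : HasSize n s)
    (hab : a ≠ b) (hB : n * n * n ≤ B) (hm : IsMatrix n (s.arr a) (ind E)) :
    Tri B (mergeLabels a b) s ((n * n * n + 1) * 100) fun s' => IsLabeling n E (s'.arr b) := by
  have hn2 := sq_le_cube n
  have hn1 := le_sq n
  have hinit : Tri B (DynCluster.forLoop 37 0 (.write b (.reg 37) (.reg 37))) s (n * 11 + 6)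
      fun s' => ∀ v < n, s'.arr b v = v := by
    refine (Tri.forLoop (T := 3) (N := n) (fun i s' => ∀ p < i, s'.arr b p = p) rfl rfl
      (by decide) hs.r0 (by omega) (by simp) ?_).mono (by omega) fun s' _ h => h.2
    intro i s' hi hx hy hag hinv
    refine Tri.loopFree (by simp [Prog.maxCost]) ?_ ?_
    · simp only [Prog.Ok, Expr.eval_reg, hx]
      omega
    · simp only [Prog.exec, Expr.eval_reg, hx, Store.setReg_arr, Store.setArr_arr, if_true]
      intro p hp
      by_cases hpi : p = i
      · simp [hpi]
      · rw [Function.update_of_ne hpi]; exact hinv p (by omega)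
  refine Tri.mono (Tri.seq (hinit.mono le_rfl fun s₁ hag₁ h0 _ =>
    (Tri.forLoop (T := n * 17 + 28) (N := n * n) (fun i s' => IsPartialLabeling n E i (s'.arr b))
      rfl rfl (by decide) ((hag₁.reg 6 rfl).trans hs.r6) (by omega) ?_ ?_).mono
      le_rfl fun s' _ h => h.2.isLabeling)) ?_ fun _ _ h => h
  · refine ⟨fun v hv => ?_, fun v hv => ?_, by simp, fun S hS _ _ u v hu hv huv => ?_⟩
    · simpa [h0 v hv] using hv
    · simp [h0 v hv]
    · simp only [Store.setReg_arr, h0 u hu, h0 v hv] at huv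
      exact huv ▸ hS.refl u
  · intro i s' hi hx _ hag hinv
    have hu := div_lt_of_lt_sq hi
    have hv := mod_lt_of_lt_sq hi
    have r0 : s'.reg 0 = n := by rw [hag.reg 0 rfl, hag₁.reg 0 rfl, hs.r0]
    have ha : s'.arr a i = ind E (i / n) (i % n) := by
      rw [hag.arr a (by simp [DynCluster.forLoop, Prog.writesArr, hab]),
        hag₁.arr a (by simp [DynCluster.forLoop, Prog.writesArr, hab])]
      exact hm i hi
    refine (Tri.when (T := 10 + (n * 17 + 6)) (fun h => ?_) fun h => ?_).mono (by simp; omega)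
      fun _ _ h => h
    · have hE : E (i / n) (i % n) := by
        by_contra hcon
        simp [hx, ha, ind_eq_zero hcon] at h
      have l1 := hinv.lt _ hu
      have l2 := hinv.lt _ hv
      refine Tri.seq (Tri.loopFree (by simp [Prog.maxCost]) ?_ ?_)
      · simp [Prog.Ok, Prog.exec, hx, r0]
        omega
      intro hag₂
      have h0' : ((Prog.seq (.assign 38 (.read b (.reg 37 / .reg 0)))
        (.assign 39 (.read b (.reg 37 % .reg 0)))).exec s').arr b = s'.arr b := rfl
      have r38 : ((Prog.seq (.assign 38 (.read b (.reg 37 / .reg 0)))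
        (.assign 39 (.read b (.reg 37 % .reg 0)))).exec s').reg 38 = s'.arr b (i / n) := by
        simp [Prog.exec, hx, r0]
      have r39 : ((Prog.seq (.assign 38 (.read b (.reg 37 / .reg 0)))
        (.assign 39 (.read b (.reg 37 % .reg 0)))).exec s').reg 39 = s'.arr b (i % n) := by
        simp [Prog.exec, hx, r0]
      -- Cells from `j` on still hold their old labels. The two labels were saved in registers
      -- beforehand because the array entries they come from may change during the pass.
      refine (Tri.forLoop (T := 9) (N := n) (fun j s'' => (∀ w < n, s''.arr b w =
        if w < j ∧ s'.arr b w = s'.arr b (i / n) then s'.arr b (i % n) else s'.arr b w))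
        rfl rfl (by decide) (by simp [Prog.exec, r0]) (by omega) ?_ ?_).mono le_rfl
        fun s'' _ h => hinv.merge hi hE fun w hw => ?_
      · intro w _
        simp [h0']
      · intro j s'' hj h36 _ hag₃ hinv₃
        have r38' : s''.reg 38 = s'.arr b (i / n) := (hag₃.reg 38 rfl).trans r38
        have r39' : s''.reg 39 = s'.arr b (i % n) := (hag₃.reg 39 rfl).trans r39
        have hj' : s''.arr b j = s'.arr b j := by
          rw [hinv₃ j hj, if_neg (by omega)]
        refine Tri.loopFree (by simp [Prog.maxCost]) ?_ ?_
        · simp only [Prog.Ok, Expr.eval_equal, Expr.eval_read, Expr.eval_reg, h36, hj', r38', r39']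
          split_ifs <;> simp_all; omega
        · simp only [Prog.exec, Expr.eval_equal, Expr.eval_read, Expr.eval_reg, h36, hj', r38',
            r39']
          intro w hw
          by_cases hc : s'.arr b j = s'.arr b (i / n)
          · simp only [hc, if_true, ne_eq, one_ne_zero, not_false_eq_true, Store.setReg_arr,
              Store.setArr_arr]
            by_cases hwj : w = j
            · subst hwj
              rw [Function.update_self, if_pos ⟨by omega, hc⟩]
            · rw [Function.update_of_ne hwj, hinv₃ w hw]
              congr 1
              exact propext (and_congr_left' (by omega))
          · simp only [hc, if_false, ne_eq, not_true_eq_false, Store.setReg_arr]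
            rw [hinv₃ w hw]
            by_cases hwj : w = j
            · subst hwj
              simp [hc]
            · congr 1
              exact propext (and_congr_left' (by omega))
      · rw [Store.setReg_arr, h.2 w hw]
        simp [hw]
    · have hE : ¬ E (i / n) (i % n) := by
        intro hcon
        simp [hx, ha, ind_eq_one hcon] at h
      refine ⟨hinv.lt, hinv.idem, fun p hp hp' => ?_, hinv.rel⟩
      rcases Nat.lt_succ_iff_lt_or_eq.1 hp with hp | rfl
      · exact hinv.eq p hp hp'
      · exact absurd hp' hE
  · nlinarith [Nat.zero_le (n * n * n)]

/-- Cell `x ≤ n` of array `a` becomes the sum of the values of all `v < n` with key `x`; key and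
value read `v` from register `25`. -/
def tallyProg (a : ℕ) (key val : Expr) : Prog :=
  .seq (.assign 26 (.reg 0 + 1)) <| .seq (forLoop 25 26 (.write a (.reg 25) 0)) <|
    forLoop 25 0 (.write a key (.read a key + val))

/-- Keys run up to `n` inclusive, so `n + 1` cells are cleared: group numbers are labels shifted by
one. The bound `hV` on the final sums bounds all partial sums too. -/
theorem Tri.tallyProg {B n a : ℕ} {key val : Expr} {s : Store} {K V : ℕ → ℕ} (h0 : s.reg 0 = n)
    (hB : n + 1 ≤ B)
    (he : ∀ s', Agree (tallyProg a key val) s s' → ∀ v < n, s'.reg 25 = v →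
      key.eval s' = K v ∧ val.eval s' = V v)
    (hK : ∀ v < n, K v ≤ n) (hV : ∀ x, tally n K V x ≤ B) :
    Tri B (tallyProg a key val) s ((n + 1) * (2 * key.cost + val.cost + 40)) fun s' =>
      ∀ x ≤ n, s'.arr a x = tally n K V x := by
  refine Tri.mono (Tri.seq (Tri.assign (by simp [h0, hB]) fun hag₀ => Tri.seq
    (T₁ := (n + 1) * 11 + 6) ((Tri.forLoop (T := 3) (N := n + 1) (fun i s' => ∀ p < i, s'.arr a p = 0)
      rfl rfl (by decide) (by simp [h0]) (by omega) (by simp) ?_).mono (by omega)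
      fun s₁ hag₁ hz _ => (Tri.forLoop (T := 2 * key.cost + val.cost + 3) (N := n)
        (fun i s' => ∀ x ≤ n, s'.arr a x = tally i K V x) rfl rfl (by decide) ?_ (by omega)
        ?_ ?_).mono le_rfl fun s' _ h => h.2))) ?_ fun _ _ h => h
  · intro i s' hi hx hy hag hinv
    refine Tri.loopFree (by simp [Prog.maxCost]) ?_ ?_
    · simp only [Prog.Ok, Expr.eval_reg, Expr.eval_zero, hx]
      omega
    · simp only [Prog.exec, Expr.eval_reg, Expr.eval_zero, hx, Store.setReg_arr,
        Store.setArr_arr, if_true]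
      intro p hp
      by_cases hpi : p = i
      · simp [hpi]
      · rw [Function.update_of_ne hpi]; exact hinv p (by omega)
  · rw [hag₁.reg 0 rfl]
    simp [h0]
  · intro x hx
    simp [hz.2 x (by omega), tally]
  · intro i s' hi hx _ hag hinv
    have hag' : Agree (DynCluster.tallyProg a key val) s s' :=
      (hag₀.mono (fun x hx => by
        simp only [DynCluster.tallyProg, Prog.writesReg, Bool.or_eq_false_iff] at hx; exact hx.1)
        (fun x _ => rfl)).trans
      ((hag₁.mono (fun x hx => by
        simp only [DynCluster.tallyProg, Prog.writesReg, Bool.or_eq_false_iff] at hx; exact hx.2.1)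
        (fun x hx => by
        simp only [DynCluster.tallyProg, Prog.writesArr, Bool.or_eq_false_iff] at hx
        exact hx.2.1)).trans
      (hag.mono (fun x hx => by
        simp only [DynCluster.tallyProg, Prog.writesReg, Bool.or_eq_false_iff] at hx; exact hx.2.2)
        (fun x hx => by
        simp only [DynCluster.tallyProg, Prog.writesArr, Bool.or_eq_false_iff] at hx
        exact hx.2.2)))
    obtain ⟨e1, e2⟩ := he s' hag' i hi hx
    have hKi := hK i hi
    have hstep : tally i K V (K i) + V i ≤ B := by
      refine le_trans ?_ (hV (K i))
      have : tally (i + 1) K V (K i) ≤ tally n K V (K i) :=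
        Finset.sum_le_sum_of_subset (Finset.range_mono hi)
      rw [tally, Finset.sum_range_succ, if_pos rfl] at this
      exact this
    refine Tri.loopFree (by simp [Prog.maxCost]; omega) ?_ ?_
    · simp only [Prog.Ok, Expr.eval_add, Expr.eval_read, e1, e2, hinv _ hKi]
      exact ⟨by omega, hstep⟩
    · simp only [Prog.exec, Expr.eval_add, Expr.eval_read, e1, e2, hinv _ hKi, Store.setReg_arr,
        Store.setArr_arr, if_true]
      intro x hxn
      have hsucc : tally (i + 1) K V x = tally i K V x + if K i = x then V i else 0 :=
        Finset.sum_range_succ _ _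
      rw [hsucc, Function.update_apply]
      by_cases hxi : x = K i
      · rw [if_pos hxi, if_pos hxi.symm, hxi]
      · rw [if_neg hxi, if_neg (Ne.symm hxi), add_zero, hinv x hxn]
  · simp only [Expr.cost_add, Expr.cost_reg, Expr.cost_one]
    generalize 2 * key.cost + val.cost = c
    nlinarith [Nat.zero_le (n * c)]

/-! ### The dynamic program for the removal of pure components -/

/-- Some chosen items have total size `r` and total squared size at most `y`. -/
def ItemSum (cond : ℕ → Prop) (sz : ℕ → ℕ) (i r y : ℕ) : Prop :=
  ∃ Rm : ℕ → Prop, chosen cond Rm sz i = r ∧ chosen cond Rm (fun x => sz x * sz x) i ≤ y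

theorem chosen_congr {cond Rm Rm' : ℕ → Prop} {f : ℕ → ℕ} {i : ℕ}
    (h : ∀ x < i, cond x → (Rm x ↔ Rm' x)) : chosen cond Rm f i = chosen cond Rm' f i := by
  classical
  refine Finset.sum_congr rfl fun x hx => ?_
  congr 1
  exact propext (and_congr_right fun hc => h x (Finset.mem_range.1 hx) hc)

open Classical in
theorem chosen_succ (cond Rm : ℕ → Prop) (f : ℕ → ℕ) (i : ℕ) :
    chosen cond Rm f (i + 1) = chosen cond Rm f i + if cond i ∧ Rm i then f i else 0 :=
  Finset.sum_range_succ _ _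

theorem itemSum_zero {cond : ℕ → Prop} {sz : ℕ → ℕ} {r y : ℕ} :
    ItemSum cond sz 0 r y ↔ r = 0 :=
  ⟨fun ⟨_, h, _⟩ => h.symm, fun h => ⟨fun _ => True, h.symm, Nat.zero_le _⟩⟩

theorem itemSum_succ_of_not {cond : ℕ → Prop} {sz : ℕ → ℕ} {i r y : ℕ} (h : ¬ cond i) :
    ItemSum cond sz (i + 1) r y ↔ ItemSum cond sz i r y := by
  unfold ItemSum
  refine exists_congr fun Rm => ?_
  rw [chosen_succ, chosen_succ, if_neg fun h' => h h'.1, if_neg fun h' => h h'.1, add_zero,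
    add_zero]

/-- The knapsack recursion as a convolution with the row of a single item: `q = 0` leaves the item
in its group, `q = sz i` removes it at the cost of its square. -/
theorem itemSum_succ {cond : ℕ → Prop} {sz : ℕ → ℕ} {i r y : ℕ} (h : cond i) :
    ItemSum cond sz (i + 1) r y ↔ ∃ q ≤ r, ∃ y₁ y₂, y₁ + y₂ ≤ y ∧
      ItemSum cond sz i (r - q) y₁ ∧ (q = 0 ∨ q = sz i ∧ sz i * sz i ≤ y₂) := by
  classical
  constructor
  · rintro ⟨Rm, h1, h2⟩
    rw [chosen_succ] at h1 h2
    by_cases hR : Rm i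
    · rw [if_pos ⟨h, hR⟩] at h1 h2
      exact ⟨sz i, by omega, _, _, h2, ⟨Rm, by omega, le_rfl⟩, Or.inr ⟨rfl, le_rfl⟩⟩
    · rw [if_neg fun h' => hR h'.2] at h1 h2
      exact ⟨0, by omega, y, 0, le_rfl, ⟨Rm, by omega, h2⟩, Or.inl rfl⟩
  · rintro ⟨q, hq, y₁, y₂, hy, ⟨Rm, h1, h2⟩, hor⟩
    have hc : ∀ (b : Prop) (f : ℕ → ℕ), chosen cond (fun x => if x = i then b else Rm x) f i =
        chosen cond Rm f i := fun b f => chosen_congr fun x hx _ => by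
      rw [if_neg (by omega)]
    rcases hor with rfl | ⟨rfl, h3⟩
    · refine ⟨fun x => if x = i then False else Rm x, ?_, ?_⟩ <;>
      rw [chosen_succ, hc, if_neg (by simp)] <;> omega
    · refine ⟨fun x => if x = i then True else Rm x, ?_, ?_⟩ <;>
      rw [chosen_succ, hc, if_pos (by simp [h])] <;> omega

/-- The removable sets of the first `i` groups. -/
def GroupSum (n : ℕ) (cond : ℕ → ℕ → Prop) (sz S : ℕ → ℕ) (base i r y : ℕ) : Prop :=
  ∃ Rm : ℕ → Prop, ∑ D ∈ Finset.range i, chosen (cond D) Rm sz n = r ∧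
    base + ∑ D ∈ Finset.range i, (chosen (cond D) Rm (fun x => sz x * sz x) n +
      (S D - chosen (cond D) Rm sz n) * (S D - chosen (cond D) Rm sz n)) ≤ y

theorem groupSum_zero {n : ℕ} {cond : ℕ → ℕ → Prop} {sz S : ℕ → ℕ} {base r y : ℕ} :
    GroupSum n cond sz S base 0 r y ↔ r = 0 ∧ base ≤ y :=
  ⟨fun ⟨_, h1, h2⟩ => ⟨h1.symm, h2⟩, fun h => ⟨fun _ => True, h.1.symm, h.2⟩⟩

/-- By `hcond` no item belongs to two groups, so the choices in the different groups can be glued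
together. -/
theorem groupSum_succ {n : ℕ} {cond : ℕ → ℕ → Prop} {sz S : ℕ → ℕ} {base i r y : ℕ}
    (hcond : ∀ D D' x, cond D x → cond D' x → D = D') :
    GroupSum n cond sz S base (i + 1) r y ↔ ∃ q ≤ r, ∃ y₁ y₂, y₁ + y₂ ≤ y ∧
      GroupSum n cond sz S base i (r - q) y₁ ∧
        ∃ y₃, ItemSum (cond i) sz n q y₃ ∧ y₃ + (S i - q) * (S i - q) ≤ y₂ := by
  classical
  constructor
  · rintro ⟨Rm, h1, h2⟩
    rw [Finset.sum_range_succ] at h1 h2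
    exact ⟨_, by omega, _, _, by rw [← add_assoc] at h2; exact h2, ⟨Rm, by omega, le_rfl⟩, _,
      ⟨Rm, rfl, le_rfl⟩, le_rfl⟩
  · rintro ⟨q, hq, y₁, y₂, hy, ⟨Rm, h1, h2⟩, y₃, ⟨Rm', h3, h4⟩, h5⟩
    have hc : ∀ D < i, ∀ f : ℕ → ℕ, chosen (cond D) (fun x => if cond i x then Rm' x else Rm x) f n =
        chosen (cond D) Rm f n := fun D hD f => chosen_congr fun x _ hx => by
      rw [if_neg fun h => by have := hcond _ _ _ hx h; omega]
    have hc' : ∀ f : ℕ → ℕ, chosen (cond i) (fun x => if cond i x then Rm' x else Rm x) f n =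
        chosen (cond i) Rm' f n := fun f => chosen_congr fun x _ hx => by
      rw [if_pos hx]
    refine ⟨fun x => if cond i x then Rm' x else Rm x, ?_, ?_⟩
    · rw [Finset.sum_range_succ, hc', h3,
        Finset.sum_congr rfl fun D hD => hc D (Finset.mem_range.1 hD) sz, h1]
      omega
    · rw [Finset.sum_range_succ, hc', hc', h3, Finset.sum_congr rfl fun D hD => by
        rw [hc D (Finset.mem_range.1 hD), hc D (Finset.mem_range.1 hD)]]
      omega

/-- The table of a single item, which may be chosen or not. -/
def itemRow : Prog :=
  .seq (fillCap 11) <| .seq (.write 11 0 0) <|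
    .when (.less (.read 15 (.reg 22) * .read 15 (.reg 22)) (.reg 4 + 1))
      (.write 11 (.read 15 (.reg 22)) (.read 15 (.reg 22) * .read 15 (.reg 22)))

theorem Tri.itemRow {B t thr z : ℕ} {s : Store} (ht : s.reg 20 = t) (hthr : s.reg 4 = thr)
    (hz : s.arr 15 (s.reg 22) = z) (htB : t ≤ B) (hB : thr + 1 ≤ B) (hzB : z ≤ B) :
    Tri B itemRow s (t * 13 + 40) fun s' =>
      Table (s'.arr 11) t (thr + 1) fun r y => r = 0 ∨ r = z ∧ z * z ≤ y := by
  refine Tri.mono (Tri.seq ((Tri.fillCap ht hthr htB hB).mono le_rfl fun s₁ hag h _ =>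
    Tri.loopFree (T := 34) (by simp [Prog.maxCost]) ?_ ?_)) (by omega) fun _ _ h => h
  · have r22 : s₁.reg 22 = s.reg 22 := hag.reg 22 rfl
    have a15 : s₁.arr 15 = s.arr 15 := hag.arr 15 rfl
    simp only [Prog.Ok, Prog.exec, Expr.eval_zero, Expr.eval_less, Expr.eval_mul, Expr.eval_read,
      Expr.eval_reg, Expr.eval_add, Expr.eval_one, Store.setArr_arr, Store.setArr_reg,
      Nat.reduceEqDiff, if_false, hag.reg 4 rfl, hthr, r22, a15, hz]
    refine ⟨⟨by omega, by omega⟩, ?_⟩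
    by_cases hlt : z * z < thr + 1
    · simp [hlt, hzB]; omega
    · simp [hlt]
  · have r22 : s₁.reg 22 = s.reg 22 := hag.reg 22 rfl
    have a15 : s₁.arr 15 = s.arr 15 := hag.arr 15 rfl
    simp only [Prog.exec, Expr.eval_zero, Expr.eval_less, Expr.eval_mul, Expr.eval_read,
      Expr.eval_reg, Expr.eval_add, Expr.eval_one, Store.setArr_arr, Store.setArr_reg,
      Nat.reduceEqDiff, if_false, hag.reg 4 rfl, hthr, r22, a15, hz]
    intro r hr
    have hcap := h r hr
    by_cases hlt : z * z < thr + 1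
    · simp only [hlt, if_true, ne_eq, one_ne_zero, not_false_eq_true, Store.setArr_arr,
        Function.update_apply]
      -- If `z = 0` both writes hit cell `0`, with the same value `0`.
      by_cases h1 : r = z
      · rw [if_pos h1]
        refine ⟨by omega, fun y hy => ?_⟩
        by_cases h0 : r = 0
        · have : z = 0 := by omega
          simp [this, h1]
        · simp [h1, h1 ▸ h0]
      · rw [if_neg h1]
        by_cases h0 : r = 0
        · simp [h0]
        · rw [if_neg h0, hcap]
          refine ⟨le_rfl, fun y hy => ⟨fun h => by omega, ?_⟩⟩
          rintro (h | h)
          · exact absurd h h0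
          · exact absurd h.1 h1
    · simp only [hlt, if_false, ne_eq, not_true_eq_false, Store.setArr_arr, if_true,
        Function.update_apply]
      by_cases h0 : r = 0
      · simp [h0]
      · rw [if_neg h0, hcap]
        refine ⟨le_rfl, fun y hy => ⟨fun h => by omega, ?_⟩⟩
        rintro (h | h)
        · exact absurd h h0
        · omega

/-- What the dynamic program reads. -/
structure IsSetUp (n t thr : ℕ) (lab gl tgt : ℕ → ℕ) (s : Store) : Prop where
  r0 : s.reg 0 = n
  r4 : s.reg 4 = thr
  r20 : s.reg 20 = t
  a12 : ∀ x < n, s.arr 12 x = lab x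
  a15 : ∀ x < n, s.arr 15 x = compSize n lab x
  a16 : ∀ x < n, s.arr 16 x = impurity n lab gl x
  a18 : ∀ x < n, s.arr 18 x = tgt x
  a19 : ∀ D < n, s.arr 19 (D + 1) = groupSize n lab tgt D
  a21 : s.arr 21 0 = separateWeight n lab tgt

theorem IsSetUp.agree {n t thr : ℕ} {lab gl tgt : ℕ → ℕ} {s s' : Store} {p : Prog}
    (h : IsSetUp n t thr lab gl tgt s) (hag : Agree p s s')
    (hr : ∀ x ∈ [0, 4, 20], p.writesReg x = false)
    (ha : ∀ a ∈ [12, 15, 16, 18, 19, 21], p.writesArr a = false) :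
    IsSetUp n t thr lab gl tgt s' where
  r0 := (hag.reg 0 (hr 0 (by simp))).trans h.r0
  r4 := (hag.reg 4 (hr 4 (by simp))).trans h.r4
  r20 := (hag.reg 20 (hr 20 (by simp))).trans h.r20
  a12 := by rw [hag.arr 12 (ha 12 (by simp))]; exact h.a12
  a15 := by rw [hag.arr 15 (ha 15 (by simp))]; exact h.a15
  a16 := by rw [hag.arr 16 (ha 16 (by simp))]; exact h.a16
  a18 := by rw [hag.arr 18 (ha 18 (by simp))]; exact h.a18
  a19 := by rw [hag.arr 19 (ha 19 (by simp))]; exact h.a19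
  a21 := by rw [hag.arr 21 (ha 21 (by simp))]; exact h.a21

/-- The table of the choices among the pure components in the group `reg 21 + 1`. -/
def itemTable : Prog :=
  .seq (fillCap 10) <| .seq (.write 10 0 0) <| forLoop 22 0 <|
    .when (.equal (.read 12 (.reg 22)) (.reg 22) * .equal (.read 16 (.reg 22)) 0 *
      .equal (.read 18 (.reg 22)) (.reg 21 + 1)) (.seq itemRow (convolve 10 11))

theorem Tri.itemTable {B n t thr D : ℕ} {lab gl tgt : ℕ → ℕ} {s : Store}
    (hs : IsSetUp n t thr lab gl tgt s) (hD : s.reg 21 = D) (hn : n ≤ B) (htB : t ≤ B)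
    (hB : thr + 1 ≤ B) : Tri B itemTable s ((n + 1) * (t * (t * 40 + 70) + 100)) fun s' =>
      Table (s'.arr 10) t (thr + 1)
        (ItemSum (fun x => IsPure n lab gl x ∧ tgt x = D + 1) (compSize n lab) n) := by
  refine Tri.mono (Tri.seq ((Tri.fillCap hs.r20 hs.r4 htB hB).mono le_rfl fun s₁ hag₁ hcap _ =>
    Tri.seq (Tri.write (by simp) (by simp) fun hag₂ =>
    (Tri.forLoop (T := t * (t * 40 + 53) + 70) (N := n) (fun i s' => Table (s'.arr 10) t (thr + 1)
      (ItemSum (fun x => IsPure n lab gl x ∧ tgt x = D + 1) (compSize n lab) i)) rfl rfl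
      (by decide) ?_ hn ?_ ?_).mono le_rfl fun s' _ h => h.2))) ?_ fun _ _ h => h
  · simpa using (hag₁.reg 0 rfl).trans hs.r0
  · intro r hr
    simp only [Expr.eval_zero, Store.setReg_arr, Store.setArr_arr, if_true, Function.update_apply]
    by_cases h0 : r = 0
    · simp [h0, itemSum_zero]
    · rw [if_neg h0, hcap r hr]
      exact ⟨le_rfl, fun y hy => ⟨fun h => by omega, fun h => absurd (itemSum_zero.1 h) h0⟩⟩
  · intro x s' hx h22 _ hag hinv
    have hs' : IsSetUp n t thr lab gl tgt s' := ((hs.agree hag₁ (by decide) (by decide)).agree hag₂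
      (by decide) (by decide)).agree hag (by decide) (by decide)
    have r21 : s'.reg 21 = D := by
      rw [hag.reg 21 rfl, hag₂.reg 21 rfl, hag₁.reg 21 rfl, hD]
    have hcond : (Expr.equal (.read 12 (.reg 22)) (.reg 22) * .equal (.read 16 (.reg 22)) 0 *
        .equal (.read 18 (.reg 22)) (.reg 21 + 1)).eval s' ≠ 0 ↔
        IsPure n lab gl x ∧ tgt x = D + 1 := by
      simp only [Expr.eval_mul, Expr.eval_equal, Expr.eval_read, Expr.eval_reg, Expr.eval_zero,
        Expr.eval_add, Expr.eval_one, h22, r21, hs'.a12 x hx, hs'.a16 x hx, hs'.a18 x hx, IsPure]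
      split_ifs <;> simp_all
    refine (Tri.when (T := t * 13 + 40 + (t * (t * 40 + 40) + 6)) (fun h => ?_) fun h => ?_).mono
      (by simp; nlinarith) fun _ _ h => h
    · rw [hcond] at h
      refine Tri.seq ((Tri.itemRow hs'.r20 hs'.r4 ((h22 ▸ hs'.a15 x hx : s'.arr 15 (s'.reg 22) =
        compSize n lab x)) htB hB ((tally_one_le _ _ _ _ fun _ _ => le_rfl).trans hn)).mono le_rfl
        fun s₂ hag₃ hrow _ => ?_)
      have h10 : Table (s₂.arr 10) t (thr + 1) _ := (hag₃.arr 10 rfl).symm ▸ hinv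
      refine (Tri.convolve (by decide) ((hag₃.reg 20 rfl).trans hs'.r20)
        ((hag₃.reg 4 rfl).trans hs'.r4) htB hB h10 hrow).mono le_rfl fun s₃ _ h' => ?_
      exact h'.congr fun r _ y _ => (itemSum_succ (i := x) h).symm
    · have h' : ¬ (IsPure n lab gl x ∧ tgt x = D + 1) := fun h' => hcond.2 h' h
      exact Table.congr hinv fun r _ y _ => (itemSum_succ_of_not (i := x) h').symm
  · simp only [Expr.cost_zero]
    nlinarith [Nat.zero_le (t * t), Nat.zero_le (n * t)]

/-- Account for the vertices that remain in the group `reg 21 + 1`. -/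
def addRest : Prog :=
  forLoop 23 20 <| .seq (.assign 24 (.read 19 (.reg 21 + 1) - .reg 23)) <|
    .seq (.assign 24 (.read 10 (.reg 23) + .reg 24 * .reg 24)) <|
    .ite (.less (.reg 24) (.reg 4 + 1)) (.write 10 (.reg 23) (.reg 24))
      (.write 10 (.reg 23) (.reg 4 + 1))

/-- Once vertices of total size `r` have left a group of size `S`, the remaining `S - r` form one
cluster and contribute their square. The sum may temporarily exceed the cap by up to `n * n`, hence
the stronger bound on `B`; it is capped again when stored. -/
theorem Tri.addRest {B t thr S n : ℕ} {P : ℕ → ℕ → Prop} {s : Store} (ht : s.reg 20 = t)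
    (hthr : s.reg 4 = thr) (hS : s.arr 19 (s.reg 21 + 1) = S) (hSn : S ≤ n) (htB : t ≤ B)
    (hB : thr + 1 + n * n ≤ B) (hP : Table (s.arr 10) t (thr + 1) P) :
    Tri B addRest s (t * 50 + 6) fun s' => Table (s'.arr 10) t (thr + 1)
      fun r y => ∃ y', P r y' ∧ y' + (S - r) * (S - r) ≤ y := by
  have hnn : n ≤ n * n := le_sq n
  refine (Tri.forLoop (T := 42) (N := t) (fun i s' => (∀ r < t, i ≤ r → s'.arr 10 r = s.arr 10 r) ∧
    Table (s'.arr 10) i (thr + 1) fun r y => ∃ y', P r y' ∧ y' + (S - r) * (S - r) ≤ y) rfl rfl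
    (by decide) ht htB ⟨fun r _ _ => by simp, fun r hr => by omega⟩ ?_).mono (by omega)
    fun s' _ h => h.2.2
  intro i s' hi h23 h20 hag ⟨h1, h2⟩
  have r4 : s'.reg 4 = thr := (hag.reg 4 rfl).trans hthr
  have a19 : s'.arr 19 (s'.reg 21 + 1) = S := by rw [hag.arr 19 rfl, hag.reg 21 rfl, hS]
  have a10 := h1 i hi le_rfl
  obtain ⟨hle, hiff⟩ := hP i hi
  have hsq : (S - i) * (S - i) ≤ n * n := Nat.mul_le_mul (by omega) (by omega)
  obtain ⟨Y, hY⟩ : ∃ Y, Y = s.arr 10 i + (S - i) * (S - i) := ⟨_, rfl⟩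
  have hYB : Y ≤ B := by omega
  have key : ∀ y < thr + 1, Y ≤ y ↔ ∃ y', P i y' ∧ y' + (S - i) * (S - i) ≤ y := by
    intro y hy
    constructor
    · intro h
      exact ⟨s.arr 10 i, (hiff _ (by omega)).1 le_rfl, by omega⟩
    · rintro ⟨y', h, h'⟩
      have := (hiff y' (by omega)).2 h
      omega
  refine Tri.loopFree (by simp [Prog.maxCost]) ?_ ?_
  · simp only [Prog.Ok, Prog.exec, Expr.eval_sub, Expr.eval_read, Expr.eval_add, Expr.eval_reg,
      Expr.eval_one, Expr.eval_mul, Expr.eval_less, Store.setReg_reg, Store.setReg_arr, a19, h23,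
      Nat.reduceEqDiff, if_false, if_true, a10, r4, ← hY]
    refine ⟨by omega, hYB, ?_⟩
    by_cases hlt : Y < thr + 1
    · simp [hlt]; omega
    · simp [hlt]; omega
  · simp only [Prog.exec, Expr.eval_sub, Expr.eval_read, Expr.eval_add, Expr.eval_reg,
      Expr.eval_one, Expr.eval_mul, Expr.eval_less, Store.setReg_reg, Store.setReg_arr, a19, h23,
      Nat.reduceEqDiff, if_false, if_true, a10, r4, ← hY]
    have hgen : ∀ f : ℕ → ℕ, f = Function.update (s'.arr 10) i (min Y (thr + 1)) →
        (∀ r < t, i + 1 ≤ r → f r = s.arr 10 r) ∧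
        Table f (i + 1) (thr + 1) fun r y => ∃ y', P r y' ∧ y' + (S - r) * (S - r) ≤ y := by
      rintro f rfl
      refine ⟨fun r hr hr' => ?_, fun r hr => ?_⟩
      · rw [Function.update_of_ne (by omega), h1 r hr (by omega)]
      · by_cases hri : r = i
        · subst hri
          rw [Function.update_self]
          refine ⟨by omega, fun y hy => ?_⟩
          exact Iff.trans (by omega) (key y hy)
        · rw [Function.update_of_ne hri]
          exact h2 r (by omega)
    by_cases hlt : Y < thr + 1
    · simp only [hlt, if_true, ne_eq, one_ne_zero, not_false_eq_true, Store.setArr_arr,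
        Store.setReg_arr]
      exact hgen _ (by rw [min_eq_left hlt.le])
    · simp only [hlt, if_true, if_false, ne_eq, not_true_eq_false, Store.setArr_arr,
        Store.setReg_arr]
      exact hgen _ (by rw [min_eq_right (by omega)])

/-- Decide whether pure components can be removed within the bounds. -/
def removeProg : Prog :=
  .seq (.seq (fillCap 9) (.when (.less (.read 21 0) (.reg 4 + 1)) (.write 9 0 (.read 21 0)))) <|
    .seq (forLoop 21 0 (.seq itemTable (.seq addRest (convolve 9 10)))) acceptProg

/-- For each group and each vertex there is at most one convolution of length `t`, and one more for
each group to combine the groups: `O(n² t²)` plus lower terms. -/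
theorem Tri.removeProg {B n t thr : ℕ} {lab gl tgt : ℕ → ℕ} {s : Store}
    (hs : IsSetUp n t thr lab gl tgt s) (hn : n ≤ B) (htB : t ≤ B)
    (hB : thr + 1 + n * n ≤ B) :
    Tri B removeProg s ((n * n + 1) * ((t + 1) * (t + 1) * 500)) fun s' =>
      (s'.reg 8 ≠ 0 ↔ s.reg 8 ≠ 0 ∨ ∃ r < t, Removable n lab gl tgt thr r) := by
  have hnn := le_sq n
  have hdisj : ∀ D D' x, (IsPure n lab gl x ∧ tgt x = D + 1) → (IsPure n lab gl x ∧
    tgt x = D' + 1) → D = D' := by rintro D D' x ⟨-, h⟩ ⟨-, h'⟩; omega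
  refine Tri.mono (Tri.seq (T₁ := t * 13 + 6 + 13) (Tri.seq ((Tri.fillCap hs.r20 hs.r4 htB
    (by omega)).mono le_rfl fun s₁ hag₁ hcap _ => Tri.loopFree (T := 13) (by simp [Prog.maxCost])
      ?_ ?_))) (T₁ := t * 13 + 6 + 13 + (n * ((n + 1) * (t * (t * 40 + 70) + 100) + (t * 50 + 6 +
        (t * (t * 40 + 40) + 6)) + 8) + 6 + (t * 19 + 6))) ?_ fun _ _ h => h
  · have r4 : s₁.reg 4 = thr := (hag₁.reg 4 rfl).trans hs.r4
    simp only [Prog.Ok, Expr.eval_less, Expr.eval_read, Expr.eval_zero, Expr.eval_add, Expr.eval_reg,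
      Expr.eval_one, r4]
    by_cases hlt : s₁.arr 21 0 < thr + 1
    · simp [hlt]; omega
    · simp [hlt]
  · intro hag₂
    have hs₂ : IsSetUp n t thr lab gl tgt (Prog.exec (.when (.less (.read 21 0) (.reg 4 + 1))
        (.write 9 0 (.read 21 0))) s₁) := hs.agree hag₂ (by decide) (by decide)
    have h9 : Table ((Prog.exec (.when (.less (.read 21 0) (.reg 4 + 1))
        (.write 9 0 (.read 21 0))) s₁).arr 9) t (thr + 1) (GroupSum n
        (fun D x => IsPure n lab gl x ∧ tgt x = D + 1) (compSize n lab) (groupSize n lab tgt)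
        (separateWeight n lab tgt) 0) := by
      have r4 : s₁.reg 4 = thr := (hag₁.reg 4 rfl).trans hs.r4
      have a21 : s₁.arr 21 0 = separateWeight n lab tgt := by rw [hag₁.arr 21 rfl]; exact hs.a21
      intro r hr
      simp only [Prog.exec, Expr.eval_less, Expr.eval_read, Expr.eval_zero, Expr.eval_add,
        Expr.eval_reg, Expr.eval_one, r4, a21, groupSum_zero]
      have := hcap r hr
      by_cases hlt : separateWeight n lab tgt < thr + 1
      · simp only [hlt, if_true, ne_eq, one_ne_zero, not_false_eq_true, Store.setArr_arr,
          Function.update_apply]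
        by_cases h0 : r = 0
        · simp [h0, hlt.le]
        · rw [if_neg h0, this]
          exact ⟨le_rfl, fun y hy => ⟨fun h => by omega, fun h => absurd h.1 h0⟩⟩
      · simp only [hlt, if_false, ne_eq, not_true_eq_false, this]
        exact ⟨le_rfl, fun y hy => ⟨fun h => by omega, fun h => by omega⟩⟩
    have r8 : (Prog.exec (.when (.less (.read 21 0) (.reg 4 + 1))
        (.write 9 0 (.read 21 0))) s₁).reg 8 = s.reg 8 := hag₂.reg 8 rfl
    generalize Prog.exec (.when (.less (.read 21 0) (.reg 4 + 1)) (.write 9 0 (.read 21 0))) s₁ =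
      s₂ at *
    refine Tri.seq ((Tri.forLoop (N := n) (fun i s' => Table (s'.arr 9) t (thr + 1) (GroupSum n
        (fun D x => IsPure n lab gl x ∧ tgt x = D + 1) (compSize n lab) (groupSize n lab tgt)
        (separateWeight n lab tgt) i)) rfl rfl (by decide) hs₂.r0 hn h9 ?_).mono le_rfl
        fun s₃ hag₃ h _ => ?_)
    · intro D s₃ hD h21 _ hag₃ hinv
      have hs₃ := hs₂.agree hag₃ (by decide) (by decide)
      refine Tri.seq ((Tri.itemTable hs₃ h21 hn htB (by omega)).mono le_rfl fun s₄ hag₄ h₄ _ => ?_)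
      have hs₄ := hs₃.agree hag₄ (by decide) (by decide)
      have h21' : s₄.reg 21 = D := (hag₄.reg 21 rfl).trans h21
      refine Tri.seq ((Tri.addRest hs₄.r20 hs₄.r4 (S := groupSize n lab tgt D) (n := n)
        (by rw [h21']; exact hs₄.a19 D hD) (tally_one_le _ _ _ _ fun _ _ => le_rfl) htB hB h₄).mono
        le_rfl fun s₅ hag₅ h₅ _ => ?_)
      have hs₅ := hs₄.agree hag₅ (by decide) (by decide)
      have h9' : Table (s₅.arr 9) t (thr + 1) (GroupSum n
          (fun D x => IsPure n lab gl x ∧ tgt x = D + 1) (compSize n lab) (groupSize n lab tgt)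
          (separateWeight n lab tgt) D) := by
        rw [hag₅.arr 9 rfl, hag₄.arr 9 rfl]; exact hinv
      refine (Tri.convolve (by decide) hs₅.r20 hs₅.r4 htB (by omega) h9' h₅).mono le_rfl
        fun s₆ _ h₆ => ?_
      exact h₆.congr fun r _ y _ => (groupSum_succ hdisj).symm
    · have hs₃ := hs₂.agree hag₃ (by decide) (by decide)
      refine (Tri.acceptProg hs₃.r20 hs₃.r4 htB (by omega)).mono le_rfl fun s' _ h' => ?_
      rw [h', hag₃.reg 8 rfl, r8]
      refine or_congr Iff.rfl (exists_congr fun r => and_congr_right fun hr => ?_)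
      exact (h.2 r hr).2 thr (by omega)
  · have h1 : n * n + n ≤ 2 * (n * n) := by omega
    obtain ⟨X, hX⟩ : ∃ X, X = n * n := ⟨_, rfl⟩
    obtain ⟨Z, hZ⟩ : ∃ Z, Z = (t + 1) * (t + 1) := ⟨_, rfl⟩
    have e1 : t * (t * 40 + 70) + 100 ≤ Z * 100 := by subst hZ; nlinarith
    have e2 : t * 50 + 6 + (t * (t * 40 + 40) + 6) + 8 ≤ Z * 100 := by subst hZ; nlinarith
    have e3 : t + 1 ≤ Z := by subst hZ; nlinarith
    calc _ = t * 32 + 31 + ((n * n + n) * (t * (t * 40 + 70) + 100) +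
          n * (t * 50 + 6 + (t * (t * 40 + 40) + 6) + 8)) := by ring
      _ ≤ Z * 32 + (2 * X * (Z * 100) + X * (Z * 100)) := by
          refine Nat.add_le_add (by omega) (Nat.add_le_add (Nat.mul_le_mul (by omega) e1)
            (Nat.mul_le_mul (by omega) e2))
      _ ≤ (n * n + 1) * ((t + 1) * (t + 1) * 500) := by
          rw [← hX, ← hZ]
          nlinarith [Nat.zero_le (X * Z)]

section

/-! ### The program for the matching-based distance -/

/-- The label of the vertex in register `25`. -/
abbrev labelOf : Expr := .read 12 (.reg 25)

/-- The two summands are the two exclusive cases of `Selects`: the representative of a pure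
component, or the vertex whose index plus one equals the digit of its impure component. -/
def targetProg : Prog :=
  tallyProg 18 labelOf ((.read 13 (.reg 25) + 1) *
    (.equal (.read 16 labelOf) 0 * .equal (.reg 25) labelOf + .less 0 (.read 16 labelOf) *
      .equal (.read 6 (.read 17 labelOf + 1)) (.read 14 (.reg 25) + 1)))

def misplacedProg : Prog :=
  tallyProg 20 0 (1 - .equal (.read 18 labelOf) (.read 13 (.reg 25) + 1))

def groupSizeProg : Prog := tallyProg 19 (.read 18 labelOf) 1

def separateProg : Prog := tallyProg 21 0 (.equal (.read 18 labelOf) 0 * .read 15 labelOf)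

/-- Test the assignment given by the digits in array `6`. -/
def tryDigits : Prog :=
  .seq targetProg <| .seq misplacedProg <| .when (.less (.read 20 0) (.reg 2 + 1)) <|
    .seq (.assign 20 (.reg 2 - .read 20 0 + 1)) <| .seq groupSizeProg <|
    .seq separateProg removeProg

/-- What is computed before the search. -/
structure IsReady (n d thr : ℕ) (lab gl : ℕ → ℕ) (s : Store) : Prop where
  r0 : s.reg 0 = n
  r2 : s.reg 2 = d
  r4 : s.reg 4 = thr
  a12 : ∀ x < n, s.arr 12 x = lab x
  a13 : ∀ x < n, s.arr 13 x = gl x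
  a14 : ∀ x < n, s.arr 14 x = rankIn (fun u w => lab u = lab w) x
  a15 : ∀ x < n, s.arr 15 x = compSize n lab x
  a16 : ∀ x < n, s.arr 16 x = impurity n lab gl x
  a17 : ∀ x < n, s.arr 17 x = rankIn (fun u _ => impurity n lab gl u ≠ 0) x

theorem IsReady.agree {n d thr : ℕ} {lab gl : ℕ → ℕ} {s s' : Store} {p : Prog}
    (h : IsReady n d thr lab gl s) (hag : Agree p s s')
    (hr : ∀ x ∈ [0, 2, 4], p.writesReg x = false)
    (ha : ∀ a ∈ [12, 13, 14, 15, 16, 17], p.writesArr a = false) :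
    IsReady n d thr lab gl s' where
  r0 := (hag.reg 0 (hr 0 (by simp))).trans h.r0
  r2 := (hag.reg 2 (hr 2 (by simp))).trans h.r2
  r4 := (hag.reg 4 (hr 4 (by simp))).trans h.r4
  a12 := by rw [hag.arr 12 (ha 12 (by simp))]; exact h.a12
  a13 := by rw [hag.arr 13 (ha 13 (by simp))]; exact h.a13
  a14 := by rw [hag.arr 14 (ha 14 (by simp))]; exact h.a14
  a15 := by rw [hag.arr 15 (ha 15 (by simp))]; exact h.a15
  a16 := by rw [hag.arr 16 (ha 16 (by simp))]; exact h.a16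
  a17 := by rw [hag.arr 17 (ha 17 (by simp))]; exact h.a17

section

variable {B n d thr : ℕ} {lab gl : ℕ → ℕ} {s : Store}

theorem tally_le {m : ℕ} (key val : ℕ → ℕ) (x : ℕ) (hval : ∀ v < n, val v ≤ m) :
    tally n key val x ≤ n * m := by
  refine (Finset.sum_le_card_nsmul _ _ m fun v hv => ?_).trans (by simp)
  have := hval v (Finset.mem_range.1 hv)
  split <;> omega

theorem Tri.targetProg (hs : IsReady n d thr lab gl s) (hlt : ∀ v < n, lab v < n)
    (hgl : ∀ v < n, gl v < n) (hB : n + 1 ≤ B) :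
    Tri B targetProg s ((n + 1) * 100) fun s' =>
      ∀ x ≤ n, s'.arr 18 x = target n lab gl (s.arr 6) x := by
  classical
  refine (Tri.tallyProg (K := lab) (V := fun v => if Selects n lab gl (s.arr 6) v then gl v + 1
    else 0) hs.r0 hB (fun s' hag v hv h25 => ?_) (fun v hv => (hlt v hv).le) fun x =>
      (target_le hgl x).trans (by omega)).mono (by simp) fun s' _ h => h
  have hs' := hs.agree hag (by decide) (by decide)
  have a6 : s'.arr 6 = s.arr 6 := hag.arr 6 rfl
  have hl := hlt v hv
  refine ⟨by simp [h25, hs'.a12 v hv], ?_⟩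
  simp only [Expr.eval_mul, Expr.eval_add, Expr.eval_read, Expr.eval_reg, Expr.eval_one,
    Expr.eval_equal, Expr.eval_less, Expr.eval_zero, h25, hs'.a12 v hv, hs'.a13 v hv,
    hs'.a16 _ hl, hs'.a17 _ hl, hs'.a14 v hv, a6]
  unfold Selects
  by_cases h0 : impurity n lab gl (lab v) = 0
  · simp [h0]
  · simp [h0, Nat.pos_of_ne_zero h0]

theorem Tri.misplacedProg {tgt : ℕ → ℕ} (hs : IsReady n d thr lab gl s) (hlt : ∀ v < n, lab v < n)
    (h18 : ∀ x ≤ n, s.arr 18 x = tgt x) (hB : n + 1 ≤ B) :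
    Tri B misplacedProg s ((n + 1) * 100) fun s' => s'.arr 20 0 = misplaced n lab gl tgt := by
  refine (Tri.tallyProg (K := fun _ => 0) (V := fun v => 1 - if tgt (lab v) = gl v + 1 then 1 else 0)
    hs.r0 hB (fun s' hag v hv h25 => ?_) (fun v hv => Nat.zero_le _) fun x =>
      (tally_one_le _ _ _ _ fun _ _ => by omega).trans (by omega)).mono (by simp)
      fun s' _ h => (h 0 (Nat.zero_le _)).trans ?_
  · have hs' := hs.agree hag (by decide) (by decide)
    have a18 : s'.arr 18 = s.arr 18 := hag.arr 18 rfl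
    have hl := hlt v hv
    simp [h25, hs'.a12 v hv, hs'.a13 v hv, a18, h18 _ hl.le]
  · rw [misplaced, Finset.card_filter, tally]
    refine Finset.sum_congr rfl fun v _ => ?_
    by_cases h : tgt (lab v) = gl v + 1 <;> simp [h]

theorem Tri.groupSizeProg {tgt : ℕ → ℕ} (hs : IsReady n d thr lab gl s) (hlt : ∀ v < n, lab v < n)
    (h18 : ∀ x ≤ n, s.arr 18 x = tgt x) (htgt : ∀ x, tgt x ≤ n) (hB : n + 1 ≤ B) :
    Tri B groupSizeProg s ((n + 1) * 100) fun s' =>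
      ∀ D < n, s'.arr 19 (D + 1) = groupSize n lab tgt D := by
  refine (Tri.tallyProg (K := fun v => tgt (lab v)) (V := fun _ => 1) hs.r0 hB
    (fun s' hag v hv h25 => ?_) (fun v hv => htgt _) fun x =>
      (tally_one_le _ _ _ _ fun _ _ => le_rfl).trans (by omega)).mono (by simp)
      fun s' _ h D hD => h (D + 1) hD
  have hs' := hs.agree hag (by decide) (by decide)
  have a18 : s'.arr 18 = s.arr 18 := hag.arr 18 rfl
  have hl := hlt v hv
  simp [h25, hs'.a12 v hv, a18, h18 _ hl.le]

theorem Tri.separateProg {tgt : ℕ → ℕ} (hs : IsReady n d thr lab gl s) (hlt : ∀ v < n, lab v < n)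
    (h18 : ∀ x ≤ n, s.arr 18 x = tgt x) (hB : n + 1 ≤ B) (hBn : n * n ≤ B) :
    Tri B separateProg s ((n + 1) * 100) fun s' =>
      s'.arr 21 0 = separateWeight n lab tgt := by
  refine (Tri.tallyProg (K := fun _ => 0) (V := fun v => if tgt (lab v) = 0 then
    compSize n lab (lab v) else 0) hs.r0 hB (fun s' hag v hv h25 => ?_) (fun v hv => Nat.zero_le _)
      fun x => (tally_le (m := n) _ _ _ fun v _ => ?_).trans hBn).mono (by simp)
      fun s' _ h => (h 0 (Nat.zero_le _)).trans ?_
  · have hs' := hs.agree hag (by decide) (by decide)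
    have a18 : s'.arr 18 = s.arr 18 := hag.arr 18 rfl
    have hl := hlt v hv
    simp [h25, hs'.a12 v hv, a18, h18 _ hl.le, hs'.a15 _ hl]
  · split
    · exact tally_one_le _ _ _ _ fun _ _ => le_rfl
    · omega
  · simp [tally, separateWeight]

/-- The tables get length `d - misplaced + 1`, one cell for each number of vertices that may still
become misplaced; if the digits alone exceed `d`, the string is skipped. -/
theorem Tri.tryDigits (hs : IsReady n d thr lab gl s) (hlt : ∀ v < n, lab v < n)
    (hgl : ∀ v < n, gl v < n) (hB : n + 1 ≤ B) (hd : d + 1 ≤ B) (hthr : thr + 1 + n * n ≤ B) :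
    Tri B tryDigits s ((n * n + 1) * ((d + 2) * (d + 2) * 700)) fun s' =>
      (s'.reg 8 ≠ 0 ↔ s.reg 8 ≠ 0 ∨ (misplaced n lab gl (target n lab gl (s.arr 6)) ≤ d ∧
        ∃ r < d - misplaced n lab gl (target n lab gl (s.arr 6)) + 1,
          Removable n lab gl (target n lab gl (s.arr 6)) thr r)) := by
  have hnn := le_sq n
  refine Tri.mono (Tri.seq ((Tri.targetProg hs hlt hgl hB).mono le_rfl fun s₁ hag₁ h18 _ => ?_))
    (T₁ := (n + 1) * 100 + ((n + 1) * 100 + (7 + (8 + ((n + 1) * 100 + ((n + 1) * 100 +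
      (n * n + 1) * ((d + 2) * (d + 2) * 500))) + 1)))) ?_ fun _ _ h => h
  · have r8₁ : s₁.reg 8 = s.reg 8 := hag₁.reg 8 rfl
    rw [← r8₁]
    have htgt := target_le (n := n) (lab := lab) (dig := s.arr 6) hgl
    generalize target n lab gl (s.arr 6) = tgt at *
    have hs₁ := hs.agree hag₁ (by decide) (by decide)
    refine Tri.seq ((Tri.misplacedProg hs₁ hlt h18 hB).mono le_rfl fun s₂ hag₂ h20 _ => ?_)
    have hs₂ := hs₁.agree hag₂ (by decide) (by decide)
    have h18₂ : ∀ x ≤ n, s₂.arr 18 x = tgt x := by rw [hag₂.arr 18 rfl]; exact h18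
    have r8₂ : s₂.reg 8 = s₁.reg 8 := hag₂.reg 8 rfl
    rw [← r8₂]
    refine (Tri.when (T := 8 + ((n + 1) * 100 + ((n + 1) * 100 +
      (n * n + 1) * ((d + 2) * (d + 2) * 500)))) (fun h => ?_) fun h => ?_).mono
      (by simp only [Expr.cost_less, Expr.cost_read, Expr.cost_zero, Expr.cost_add, Expr.cost_reg,
        Expr.cost_one]; omega) fun _ _ h => h
    · have hle : misplaced n lab gl tgt ≤ d := by simp [h20, hs₂.r2] at h; omega
      refine Tri.mono (Tri.seq (T₂ := (n + 1) * 100 + ((n + 1) * 100 +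
        (n * n + 1) * ((d + 2) * (d + 2) * 500))) (Tri.assign (by simp [h20, hs₂.r2]; omega) ?_))
        (by simp) fun _ _ h => h
      intro hag₃
      simp only [Expr.eval_add, Expr.eval_sub, Expr.eval_reg, Expr.eval_read, Expr.eval_zero,
        Expr.eval_one, h20, hs₂.r2] at hag₃ ⊢
      have r20 : (s₂.setReg 20 (d - misplaced n lab gl tgt + 1)).reg 20 =
        d - misplaced n lab gl tgt + 1 := by simp
      have hs₃ := hs₂.agree hag₃ (by decide) (by decide)
      have r8₃ := hag₃.reg 8 rfl
      have h18₃ : ∀ x ≤ n, (s₂.setReg 20 (d - misplaced n lab gl tgt + 1)).arr 18 x = tgt x := h18₂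
      generalize s₂.setReg 20 (d - misplaced n lab gl tgt + 1) = s₃ at *
      refine Tri.seq ((Tri.groupSizeProg hs₃ hlt h18₃ htgt hB).mono le_rfl fun s₄ hag₄ h19 _ => ?_)
      have hs₄ := hs₃.agree hag₄ (by decide) (by decide)
      have h18₄ : ∀ x ≤ n, s₄.arr 18 x = tgt x := by rw [hag₄.arr 18 rfl]; exact h18₃
      refine Tri.seq ((Tri.separateProg hs₄ hlt h18₄ hB (by omega)).mono le_rfl
        fun s₅ hag₅ h21 _ => ?_)
      have hs₅ := hs₄.agree hag₅ (by decide) (by decide)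
      have hset : IsSetUp n (d - misplaced n lab gl tgt + 1) thr lab gl tgt s₅ :=
        ⟨hs₅.r0, hs₅.r4, by rw [hag₅.reg 20 rfl, hag₄.reg 20 rfl, r20], hs₅.a12, hs₅.a15, hs₅.a16,
          fun x hx => by rw [hag₅.arr 18 rfl]; exact h18₄ x hx.le,
          by rw [hag₅.arr 19 rfl]; exact h19, h21⟩
      refine (Tri.removeProg hset (by omega) (by omega) hthr).mono ?_ fun s' _ h' => ?_
      · refine Nat.mul_le_mul_left _ (Nat.mul_le_mul_right _ (Nat.mul_le_mul ?_ ?_)) <;> omega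
      · rw [h', hag₅.reg 8 rfl, hag₄.reg 8 rfl, r8₃]
        exact or_congr Iff.rfl (and_iff_right hle).symm
    · have hlt' : d < misplaced n lab gl tgt := by simp [h20, hs₂.r2] at h; omega
      exact ⟨Or.inl, fun h => h.resolve_right fun h => by omega⟩
  · obtain ⟨Z, hZ⟩ : ∃ Z, Z = (d + 2) * (d + 2) := ⟨_, rfl⟩
    have e1 : 4 ≤ Z := by subst hZ; nlinarith
    obtain ⟨X, hX⟩ : ∃ X, X = n * n := ⟨_, rfl⟩
    rw [← hX] at hnn
    rw [← hZ, ← hX]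
    nlinarith [Nat.mul_le_mul_left X e1]

end

/-- Compute the labels and component data. -/
def prepare : Prog :=
  .seq (mergeLabels 0 12) <| .seq (mergeLabels 1 13) <|
  .seq (rankProg 14 (.equal (.read 12 (.reg 27 / .reg 0)) (.read 12 (.reg 27 % .reg 0)))) <|
  .seq (tallyProg 15 labelOf 1) <|
  .seq (tallyProg 16 labelOf (1 - .equal (.read 13 (.reg 25)) (.read 13 labelOf))) <|
  rankProg 17 (.less 0 (.read 16 (.reg 27 / .reg 0)))

theorem Tri.prepare {B n d thr : ℕ} {s : Store} {E E' : ℕ → ℕ → Prop} (hs : HasSize n s)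
    (r2 : s.reg 2 = d) (r4 : s.reg 4 = thr) (hB : n * n * n ≤ B) (hB1 : n + 1 ≤ B)
    (h0 : IsMatrix n (s.arr 0) (ind E)) (h1 : IsMatrix n (s.arr 1) (ind E')) :
    Tri B prepare s ((n * n * n + 1) * 500) fun s' => ∃ lab gl, IsLabeling n E lab ∧
      IsLabeling n E' gl ∧ IsReady n d thr lab gl s' := by
  have hnn := le_sq n
  have hn3 := sq_le_cube n
  refine Tri.mono (Tri.seq ((Tri.mergeLabels hs (by decide) hB h0).mono le_rfl
    fun s₁ hag₁ hlab _ => Tri.seq ((Tri.mergeLabels (hs.agree hag₁ (by decide)) (by decide) hB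
      (by rw [hag₁.arr 1 rfl]; exact h1)).mono le_rfl fun s₂ hag₂ hgl _ => ?_)))
    (T₁ := (n * n * n + 1) * 100 + ((n * n * n + 1) * 100 + ((n * n + 1) * 69 + ((n + 1) * 60 +
      ((n + 1) * 60 + (n * n + 1) * 66))))) (by nlinarith) fun _ _ h => h
  have hs₂ : HasSize n s₂ := (hs.agree hag₁ (by decide)).agree hag₂ (by decide)
  have l12 : s₂.arr 12 = s₁.arr 12 := hag₂.arr 12 rfl
  have q2 : s₂.reg 2 = d := by rw [hag₂.reg 2 rfl, hag₁.reg 2 rfl, r2]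
  have q4 : s₂.reg 4 = thr := by rw [hag₂.reg 4 rfl, hag₁.reg 4 rfl, r4]
  generalize s₁.arr 12 = lab at *
  generalize hgl' : s₂.arr 13 = gl at hgl
  refine Tri.seq ((Tri.rankProg (E := fun u w => lab u = lab w) hs₂ hB
    fun s' hag p hp h27 => ?_).mono (by simp) fun s₃ hag₃ h14 _ => ?_)
  · have r0 : s'.reg 0 = n := (hag.reg 0 rfl).trans hs₂.r0
    have a12 : s'.arr 12 = lab := (hag.arr 12 rfl).trans l12
    simp [h27, r0, a12]
  have hs₃ : HasSize n s₃ := hs₂.agree hag₃ (by decide)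
  have l12₃ : s₃.arr 12 = lab := (hag₃.arr 12 rfl).trans l12
  have l13₃ : s₃.arr 13 = gl := (hag₃.arr 13 rfl).trans hgl'
  refine Tri.seq ((Tri.tallyProg (K := lab) (V := fun _ => 1) hs₃.r0 hB1
    (fun s' hag v hv h25 => ?_) (fun v hv => (hlab.lt v hv).le) fun x =>
      (tally_one_le _ _ _ _ fun _ _ => le_rfl).trans (by omega)).mono (by simp)
      fun s₄ hag₄ h15 _ => ?_)
  · have a12 : s'.arr 12 = lab := (hag.arr 12 rfl).trans l12₃
    simp [h25, a12]
  have hs₄ : HasSize n s₄ := hs₃.agree hag₄ (by decide)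
  have l12₄ : s₄.arr 12 = lab := (hag₄.arr 12 rfl).trans l12₃
  have l13₄ : s₄.arr 13 = gl := (hag₄.arr 13 rfl).trans l13₃
  refine Tri.seq ((Tri.tallyProg (K := lab) (V := fun v => 1 - if gl v = gl (lab v) then 1 else 0)
    hs₄.r0 hB1 (fun s' hag v hv h25 => ?_) (fun v hv => (hlab.lt v hv).le) fun x =>
      (tally_one_le _ _ _ _ fun _ _ => by omega).trans (by omega)).mono (by simp)
      fun s₅ hag₅ h16 _ => ?_)
  · have a12 : s'.arr 12 = lab := (hag.arr 12 rfl).trans l12₄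
    have a13 : s'.arr 13 = gl := (hag.arr 13 rfl).trans l13₄
    simp [h25, a12, a13]
  have hs₅ : HasSize n s₅ := hs₄.agree hag₅ (by decide)
  refine (Tri.rankProg (E := fun u _ => impurity n lab gl u ≠ 0) hs₅ hB
    fun s' hag p hp h27 => ?_).mono (by simp) fun s₆ hag₆ h17 => ⟨lab, gl, hlab, hgl, ?_⟩
  · have r0 : s'.reg 0 = n := (hag.reg 0 rfl).trans hs₅.r0
    have a16 : s'.arr 16 = s₅.arr 16 := hag.arr 16 rfl
    simp only [Expr.eval_less, Expr.eval_zero, Expr.eval_read, Expr.eval_div, Expr.eval_reg, h27,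
      r0, a16, h16 _ (div_lt_of_lt_sq hp).le]
    change (if 0 < impurity n lab gl (p / n) then 1 else 0) ≠ 0 ↔ _
    split_ifs with h <;> simp_all; omega
  · refine ⟨(hs₅.agree hag₆ (by decide)).r0, ?_, ?_, fun x hx => ?_, fun x hx => ?_, fun x hx => ?_,
      fun x hx => ?_, fun x hx => ?_, h17⟩
    · rw [hag₆.reg 2 rfl, hag₅.reg 2 rfl, hag₄.reg 2 rfl, hag₃.reg 2 rfl, q2]
    · rw [hag₆.reg 4 rfl, hag₅.reg 4 rfl, hag₄.reg 4 rfl, hag₃.reg 4 rfl, q4]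
    · rw [hag₆.arr 12 rfl, hag₅.arr 12 rfl, l12₄]
    · rw [hag₆.arr 13 rfl, hag₅.arr 13 rfl, l13₄]
    · rw [hag₆.arr 14 rfl, hag₅.arr 14 rfl, hag₄.arr 14 rfl]; exact h14 x hx
    · rw [hag₆.arr 15 rfl, hag₅.arr 15 rfl]; exact h15 x hx.le
    · rw [hag₆.arr 16 rfl]; exact h16 x hx.le

/-- Register `4` receives the bound `2 * (k + |E(G)|) + n` on ordered pairs, and register `5` the
base `d + 2` of the odometer, whose length is `d`. -/
def completionMatchingProg : Prog :=
  .seq (.seq (.assign 6 (.reg 0 * .reg 0)) (.assign 7 (.reg 6 * .reg 0))) <|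
  .seq countEdges <|
  .seq (.seq (.assign 4 (2 * (.reg 1 + .reg 40) + .reg 0)) (.assign 5 (.reg 2 + 2))) <|
  .seq prepare <| .seq (odoLoop 6 5 2 35 29 tryDigits) (.ite (.reg 8) (.assign 0 1) (.assign 0 0))

/-- The enumeration contributes `(d + 2) ^ d * (d + 2) ^ 2` times `n² + 1`; the cubic dependence on
`n` comes from computing the labels. -/
theorem exists_matching_time_le : ∃ C, ∀ n d,
    (n * n * n + 1) * 600 + ((d + 2) ^ d * ((n * n + 1) * ((d + 2) * (d + 2) * 700) + 20 * d + 42) +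
      4) ≤ C * max d 1 ^ (d + 2) * max n 1 ^ 3 := by
  obtain ⟨C, hC, h⟩ := add_pow_le_mul_max_pow 2
  refine ⟨6000 * C, fun n d => ?_⟩
  have h1 := cube_add_le n
  have h2 := sq_le_cube n
  have h3 := h d
  have hp : (d + 2) ^ (d + 2) = (d + 2) ^ d * ((d + 2) * (d + 2)) := by ring
  have h4 : 1 ≤ (d + 2) ^ d := Nat.one_le_pow _ _ (by omega)
  obtain ⟨A, hA⟩ : ∃ A, A = (d + 2) ^ d := ⟨_, rfl⟩
  obtain ⟨Z, hZ⟩ : ∃ Z, Z = (d + 2) * (d + 2) := ⟨_, rfl⟩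
  obtain ⟨X, hX⟩ : ∃ X, X = n * n * n := ⟨_, rfl⟩
  rw [hp] at h3
  rw [← hA, ← hZ] at h3
  rw [← hA] at h4
  rw [← hX] at h1 h2
  rw [← hA, ← hZ, ← hX]
  have e1 : 20 * d + 42 ≤ Z * 21 := by subst hZ; nlinarith
  have e2 : 1 ≤ Z := by subst hZ; nlinarith
  have e3 : 1 ≤ A * Z := Nat.one_le_iff_ne_zero.2 (by positivity)
  calc (X + 1) * 600 + (A * ((n * n + 1) * (Z * 700) + 20 * d + 42) + 4)
      ≤ (X + 1) * 600 + (A * ((X + 1) * (Z * 700) + (X + 1) * (Z * 21)) + 4) := by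
        have : (n * n + 1) * (Z * 700) ≤ (X + 1) * (Z * 700) :=
          Nat.mul_le_mul_right _ (by omega)
        have : Z * 21 ≤ (X + 1) * (Z * 21) := Nat.le_mul_of_pos_left _ (by omega)
        refine Nat.add_le_add_left (Nat.add_le_add_right (Nat.mul_le_mul_left _ ?_) _) _
        omega
    _ ≤ (X + 3) * (1500 * (A * Z)) := by nlinarith [Nat.zero_le (X * (A * Z))]
    _ ≤ (4 * max n 1 ^ 3) * (1500 * (C * max d 1 ^ (d + 2))) :=
        Nat.mul_le_mul h1 (Nat.mul_le_mul_left _ h3)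
    _ = _ := by ring

theorem exists_decides_completionMatching : ∃ C, DecidesInTime completionMatchingProg
    CompletionMatching fun I => C * max I.d 1 ^ (I.d + 2) * max I.n 1 ^ 3 := by
  classical
  obtain ⟨C, hC⟩ := exists_matching_time_le
  refine ⟨C, 6, fun I => ?_⟩
  obtain ⟨X, hX, b1, b2, b3, b4, b5⟩ := word_bounds I.n I.k I.d
  -- Covers the threshold `2 * (k + |E(G)|) + n` together with the extra `n * n` asked for by
  -- `Tri.addRest`, as `|E(G)|` and `n` are at most `n * n`.
  have b6 : 4 * (I.k + I.n * I.n + 2) ≤ X ^ 6 := by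
    have e1 : I.k + I.n * I.n + 2 ≤ X ^ 2 := by subst hX; nlinarith
    have e2 : 2 ^ 4 ≤ X ^ 4 := Nat.pow_le_pow_left (by omega) _
    calc 4 * (I.k + I.n * I.n + 2) ≤ X ^ 4 * X ^ 2 := Nat.mul_le_mul (by omega) e1
      _ = X ^ 6 := by ring
  rw [← hX]
  generalize X ^ 6 = B at *
  have hm0 : IsMatrix I.n (I.init.arr 0) (ind (adjRel I.G)) := isMatrix_adjArray I.G
  have hm1 : IsMatrix I.n (I.init.arr 1) (ind (adjRel I.Gc)) := isMatrix_adjArray I.Gc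
  have hr0 : I.init.reg 0 = I.n := rfl
  have hr1 : I.init.reg 1 = I.k := rfl
  have hr2 : I.init.reg 2 = I.d := rfl
  have hn2 := sq_le_cube I.n
  have hn1 := le_sq I.n
  have hnum := numPairs_le I.n (adjRel I.G)
  obtain ⟨thr, hthr⟩ : ∃ thr, thr = 2 * (I.k + numPairs I.n (adjRel I.G)) + I.n := ⟨_, rfl⟩
  have hmain : Tri B completionMatchingProg I.init (10 + (I.n * I.n * 40 + 6 + (20 +
      ((I.n * I.n * I.n + 1) * 500 + ((I.d + 2) ^ I.d * ((I.n * I.n + 1) * ((I.d + 2) *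
        (I.d + 2) * 700) + 20 * I.d + 42) + 4 + 4)))))
      fun s => (s.reg 0 ≠ 0 ↔ CompletionMatching I) := by
    refine Tri.seq (Tri.loopFree (by simp [Prog.maxCost]) ?_ ?_)
    · simp [Prog.Ok, Prog.exec, hr0]
      omega
    intro hag₁
    refine Tri.seq ((Tri.countEdges (n := I.n) (E := adjRel I.G) (E' := adjRel I.Gc)
      ⟨by simp [Prog.exec, hr0], by simp [Prog.exec, hr0], by simp [Prog.exec, hr0]⟩ (by omega)
      ?_ ?_ ?_ ?_).mono le_rfl ?_)
    · rw [hag₁.arr 0 rfl]; exact hm0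
    · rw [hag₁.arr 1 rfl]; exact hm1
    · rw [hag₁.reg 40 rfl, init_reg I _ (by omega)]
    · rw [hag₁.reg 41 rfl, init_reg I _ (by omega)]
    rintro s₂ hag₂ ⟨e40, -⟩ -
    have hs₂ : HasSize I.n s₂ :=
      ⟨by rw [hag₂.reg 0 rfl]; simp [Prog.exec, hr0], by rw [hag₂.reg 6 rfl]; simp [Prog.exec, hr0],
        by rw [hag₂.reg 7 rfl]; simp [Prog.exec, hr0]⟩
    have r2 : s₂.reg 2 = I.d := by rw [hag₂.reg 2 rfl]; simp [Prog.exec, hr2]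
    have r1 : s₂.reg 1 = I.k := by rw [hag₂.reg 1 rfl]; simp [Prog.exec, hr1]
    refine Tri.seq (Tri.loopFree (by simp [Prog.maxCost]) ?_ ?_)
    · simp [Prog.Ok, Prog.exec, r1, r2, e40, hs₂.r0]
      omega
    intro hag₃
    refine Tri.seq ((Tri.prepare (n := I.n) (d := I.d) (thr := thr) (E := adjRel I.G)
      (E' := adjRel I.Gc) ⟨?_, ?_, ?_⟩ ?_ ?_ b1 (by omega) ?_ ?_).mono le_rfl ?_)
    · simp [Prog.exec, hs₂.r0]
    · simp [Prog.exec, hs₂.r6]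
    · simp [Prog.exec, hs₂.r7]
    · simp [Prog.exec, r2]
    · simp [Prog.exec, r1, e40, hs₂.r0, hthr]
    · rw [hag₃.arr 0 rfl, hag₂.arr 0 rfl, hag₁.arr 0 rfl]; exact hm0
    · rw [hag₃.arr 1 rfl, hag₂.arr 1 rfl, hag₁.arr 1 rfl]; exact hm1
    rintro s₄ hag₄ ⟨lab, gl, hlab, hgl, hready⟩ -
    have r5 : s₄.reg 5 = I.d + 2 := by rw [hag₄.reg 5 rfl]; simp [Prog.exec, r2]
    have a6 : s₄.arr 6 = fun _ => 0 := by
      rw [hag₄.arr 6 rfl, hag₃.arr 6 rfl, hag₂.arr 6 rfl, hag₁.arr 6 rfl, init_arr I 6 (by omega)]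
    have r8 : s₄.reg 8 = 0 := by
      rw [hag₄.reg 8 rfl, hag₃.reg 8 rfl, hag₂.reg 8 rfl, hag₁.reg 8 rfl, init_reg I 8 (by omega)]
    refine Tri.seq ((Tri.odoLoop (β := I.d + 2) (ℓ := I.d)
      (T := (I.n * I.n + 1) * ((I.d + 2) * (I.d + 2) * 700))
      (fun c s => (s.reg 8 ≠ 0 ↔ ∃ c' < c,
        misplaced I.n lab gl (target I.n lab gl (digArr (I.d + 2) c')) ≤ I.d ∧
          ∃ r < I.d - misplaced I.n lab gl (target I.n lab gl (digArr (I.d + 2) c')) + 1,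
            Removable I.n lab gl (target I.n lab gl (digArr (I.d + 2) c')) thr r))
      (by decide) (by decide) (by decide) (by decide) (by decide) rfl rfl rfl rfl r5
      hready.r2 (by omega) (by omega) (by omega) a6 ?_ ?_ ?_).mono le_rfl ?_)
    · intro c s₁ s₂ hag h
      rw [hag.reg 8 rfl]
      exact h
    · simp [r8]
    · intro c s' hc ha hag hinv
      have hs' := hready.agree hag (by decide) (by decide)
      refine (Tri.tryDigits hs' hlab.lt hgl.lt (by omega) (by omega) (by omega)).mono le_rfl
        fun s'' _ h => ?_
      rw [h, hinv, ha]
      constructor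
      · rintro (⟨c', hc', h⟩ | h)
        · exact ⟨c', by omega, h⟩
        · exact ⟨c, by omega, h⟩
      · rintro ⟨c', hc', h⟩
        rcases Nat.lt_succ_iff_lt_or_eq.1 hc' with hc' | rfl
        · exact Or.inl ⟨c', hc', h⟩
        · exact Or.inr h
    · rintro s₅ hag₅ ⟨-, h⟩ -
      rw [← exists_assignment_iff hlab.lt hlab.idem hgl.lt, hthr,
        ← completionMatching_iff I hlab hgl] at h
      refine (Tri.ite (T := 2) (fun h8 => Tri.assign (by simp; omega) ?_)
        fun h8 => Tri.assign (by simp) ?_).mono (by simp) fun _ _ h => h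
      · simpa using h.1 (by simpa using h8)
      · simpa using fun h' => h.2 h' (by simpa using h8)
  obtain ⟨s, t, h1, h2, h3⟩ := hmain
  refine ⟨s, t, h1, h2.trans (le_trans ?_ (hC I.n I.d)), h3⟩
  omega

end

end DynCluster

theorem mainTheorem4 :
    (DynCluster.IsFPT DynCluster.DeletionEdge (fun I => I.k) ∧
      ∃ (p : DynCluster.Prog) (C : ℕ),
        DynCluster.DecidesInTime p DynCluster.DeletionEdge
          (fun I => C * 4 ^ (I.k ^ 2) * (max I.n 1) ^ 3)) ∧
    (DynCluster.IsFPT DynCluster.CompletionMatching (fun I => I.d) ∧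
      ∃ (p : DynCluster.Prog) (C : ℕ),
        DynCluster.DecidesInTime p DynCluster.CompletionMatching
          (fun I => C * (max I.d 1) ^ (I.d + 2) * (max I.n 1) ^ 3)) ∧
    (DynCluster.IsFPT DynCluster.CompletionEdge (fun I => I.d) ∧
      ∃ (p : DynCluster.Prog) (C : ℕ),
        DynCluster.DecidesInTime p DynCluster.CompletionEdge
          (fun I => C * (max I.d 1) ^ (I.d + 1) * (max I.n 1) ^ 3)) := by
  obtain ⟨C₁, h₁⟩ := DynCluster.exists_decides_deletionEdge
  obtain ⟨C₂, h₂⟩ := DynCluster.exists_decides_completionMatching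
  obtain ⟨C₃, h₃⟩ := DynCluster.exists_decides_completionEdge
  have hpow : ∀ C a : ℕ, Primrec fun k => C * max k 1 ^ (k + a) := fun C a =>
    Primrec.nat_mul.comp (Primrec.const C) (DynCluster.primrec_pow.comp
      (Primrec.nat_max.comp Primrec.id (Primrec.const 1))
      (Primrec.nat_add.comp Primrec.id (Primrec.const a)))
  refine ⟨⟨DynCluster.DecidesInTime.isFPT (param := fun I => I.k) (hpow C₁ 1) h₁,
      DynCluster.deletionEdgeProg, C₁, ?_⟩,
    ⟨DynCluster.DecidesInTime.isFPT (param := fun I => I.d) (hpow C₂ 2) h₂,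
      DynCluster.completionMatchingProg, C₂, h₂⟩,
    DynCluster.DecidesInTime.isFPT (param := fun I => I.d) (hpow C₃ 1) h₃,
      DynCluster.completionEdgeProg, C₃, h₃⟩
  -- The deletion program runs in `O(max k 1 ^ (k + 1) * max n 1 ^ 3)`, which implies the required
  -- bound.
  obtain ⟨c, h⟩ := h₁
  refine ⟨c, fun I => ?_⟩
  obtain ⟨s, t, e1, e2, e3⟩ := h I
  exact ⟨s, t, e1, e2.trans (Nat.mul_le_mul_right _ (Nat.mul_le_mul_left _
    (DynCluster.max_pow_le_four_pow I.k))), e3⟩
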